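/- **Theorem 1.1 (Perelman).** Let $M$ be a closed (compact, without boundary) smooth $n$-manifold. For a smooth Riemannian metric $g$ and a smooth function $f:M\to\mathbb R$ put $$\mathcal F(g,f)=\int_M\left(R+|\nabla f|^2\right)e^{-f}\,dV,$$ where $R$, $\nabla$ and $dV$ are the scalar curvature, the Levi-Civita connection and the Riemannian volume measure of $g$. Let $v_{ij}$ be a smooth symmetric covariant $2$-tensor and $h$ a smooth function on $M$, and put $v=g^{ij}v_{ij}$. Let $(g_t,f_t)$, $|t|<\varepsilon$, be a family of symmetric covariant $2$-tensors and functions, smooth in $(t,x)\in(-\varepsilon,\varepsilon)\times M$, with $g_0=g$, $f_0=f$, $\partial_t g_t|_{t=0}=v_{ij}$ and $\partial_t f_t|_{t=0}=h$; for example $(g+tv_{ij},f+th)$. (For $|t|$ small, $g_t$ is a Riemannian metric.) Write $\delta=\frac{d}{dt}\big|_{t=0}$. Then, with all geometric quantities on the right-hand sides taken with respect to $g$, and repeated indices contracted with $g$: 1. at every point of $M$, the derivative $\delta R$ of the scalar curvature of $g_t$ exists and $$\delta R=-\Delta v+\nabla_i\nabla_j v_{ij}-R_{ij}v_{ij};$$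 2. the derivative of $\mathcal F(g_t,f_t)$ at $t=0$ exists and $$\delta\mathcal F(v_{ij},h)=\int_M e^{-f}\left[-v_{ij}\left(R_{ij}+\nabla_i\nabla_j f\right)+\left(\frac v2-h\right)\left(2\Delta f-|\nabla f|^2+R\right)\right]dV,$$ where the integrand on the right is integrable, and so is the integrand of $\mathcal F(g_t,f_t)$ for $|t|$ small. -/

import Mathlib

open scoped Manifold ContDiff Topology Bundle
open MeasureTheory Set Filter

namespace Perelman

noncomputable section

/-- Coordinate space `ℝⁿ`. -/
abbrev Coord (n : ℕ) : Type := EuclideanSpace ℝ (Fin n)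

/-! ### Riemannian geometry in a coordinate domain of `ℝⁿ`

`G : Coord n → Matrix (Fin n) (Fin n) ℝ` stands for the components `g_ij` of a metric,
and `(G y)⁻¹ i j` for the components `g^ij` of its inverse. -/

section Local

variable {n : ℕ}

/-- The partial derivative `∂_i u` at `y`. -/
def pd (i : Fin n) (u : Coord n → ℝ) (y : Coord n) : ℝ :=
  fderiv ℝ u y (EuclideanSpace.single i 1)

/-- Christoffel symbols of the Levi-Civita connection,
`Γ^k_ij = ½ g^kl (∂_i g_jl + ∂_j g_il - ∂_l g_ij)`. -/
def christoffel (G : Coord n → Matrix (Fin n) (Fin n) ℝ) (k i j : Fin n) (y : Coord n) : ℝ :=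
  (1 / 2 : ℝ) * ∑ l, (G y)⁻¹ k l *
    (pd i (fun z => G z j l) y + pd j (fun z => G z i l) y - pd l (fun z => G z i j) y)

/-- The Ricci tensor,
`R_jk = ∂_i Γ^i_jk - ∂_j Γ^i_ik + Γ^i_il Γ^l_jk - Γ^i_jl Γ^l_ik`
(positive on round spheres). -/
def ricciCoord (G : Coord n → Matrix (Fin n) (Fin n) ℝ) (y : Coord n) :
    Matrix (Fin n) (Fin n) ℝ :=
  Matrix.of fun j k =>
    ∑ i, (pd i (christoffel G i j k) y - pd j (christoffel G i i k) y
      + ∑ l, (christoffel G i i l y * christoffel G l j k y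
        - christoffel G i j l y * christoffel G l i k y))

/-- The Hessian, `∇_i ∇_j u = ∂_i ∂_j u - Γ^k_ij ∂_k u`. -/
def hessianCoord (G : Coord n → Matrix (Fin n) (Fin n) ℝ) (u : Coord n → ℝ) (y : Coord n) :
    Matrix (Fin n) (Fin n) ℝ :=
  Matrix.of fun i j => pd i (pd j u) y - ∑ k, christoffel G k i j y * pd k u y

/-- The covariant derivative of a covariant 2-tensor,
`∇_k T_ij = ∂_k T_ij - Γ^l_ki T_lj - Γ^l_kj T_il`. -/
def covDerivTwo (G : Coord n → Matrix (Fin n) (Fin n) ℝ)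
    (T : Coord n → Matrix (Fin n) (Fin n) ℝ) (k i j : Fin n) (y : Coord n) : ℝ :=
  pd k (fun z => T z i j) y
    - ∑ l, christoffel G l k i y * T y l j - ∑ l, christoffel G l k j y * T y i l

/-- The second covariant derivative of a covariant 2-tensor: with `S_kij = ∇_k T_ij`,
`∇_m ∇_k T_ij = ∂_m S_kij - Γ^l_mk S_lij - Γ^l_mi S_klj - Γ^l_mj S_kil`. -/
def covDerivTwoTwo (G : Coord n → Matrix (Fin n) (Fin n) ℝ)
    (T : Coord n → Matrix (Fin n) (Fin n) ℝ) (m k i j : Fin n) (y : Coord n) : ℝ :=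
  pd m (covDerivTwo G T k i j) y
    - ∑ l, christoffel G l m k y * covDerivTwo G T l i j y
    - ∑ l, christoffel G l m i y * covDerivTwo G T k l j y
    - ∑ l, christoffel G l m j y * covDerivTwo G T k i l y

/-- The metric trace `g^ij A_ij`, for the matrix `g` of components of the metric at a point. -/
def traceWith (g A : Matrix (Fin n) (Fin n) ℝ) : ℝ :=
  ∑ i, ∑ j, g⁻¹ i j * A i j

/-- The metric pairing `g^ia g^jb A_ij B_ab` of two covariant 2-tensors at a point. -/
def pairWith (g A B : Matrix (Fin n) (Fin n) ℝ) : ℝ :=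
  ∑ i, ∑ j, ∑ a, ∑ b, g⁻¹ i a * g⁻¹ j b * A i j * B a b

end Local

/-! ### Tensor fields, curvature and volume on a manifold

Every tensor is written at `x` in its components with respect to the chart at `x`; the scalar
quantities obtained from them do not depend on the chart. -/

section Global

variable {n : ℕ} {M : Type*} [TopologicalSpace M] [ChartedSpace (Coord n) M]

variable (n M) in
/-- Covariant 2-tensor fields on `M` (no regularity imposed). -/
abbrev TwoTensorField : Type _ :=
  ∀ x : M, TangentSpace (𝓡 n) x →L[ℝ] TangentSpace (𝓡 n) x →L[ℝ] ℝ

/-- The components `T_ij = T(∂_i, ∂_j)` in the chart at `p`, as functions of the coordinates. -/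
def inChart (p : M) (T : TwoTensorField n M) (y : Coord n) : Matrix (Fin n) (Fin n) ℝ :=
  Matrix.of fun i j =>
    T ((extChartAt (𝓡 n) p).symm y)
      (mfderiv (𝓡 n) (𝓡 n) (extChartAt (𝓡 n) p).symm y (EuclideanSpace.single i (1 : ℝ)))
      (mfderiv (𝓡 n) (𝓡 n) (extChartAt (𝓡 n) p).symm y (EuclideanSpace.single j (1 : ℝ)))

/-- A function on `M` read in the chart at `p`. -/
def funInChart (p : M) (u : M → ℝ) : Coord n → ℝ :=
  fun y => u ((extChartAt (𝓡 n) p).symm y)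

/-- The components of a 2-tensor field at `x`. -/
def comps (T : TwoTensorField n M) (x : M) : Matrix (Fin n) (Fin n) ℝ :=
  inChart x T (extChartAt (𝓡 n) x x)

/-- The components `R_ij` of the Ricci tensor at `x`. -/
def ricci (g : TwoTensorField n M) (x : M) : Matrix (Fin n) (Fin n) ℝ :=
  ricciCoord (inChart x g) (extChartAt (𝓡 n) x x)

/-- The components `∇_i ∇_j u` of the Hessian at `x`. -/
def hessian (g : TwoTensorField n M) (u : M → ℝ) (x : M) : Matrix (Fin n) (Fin n) ℝ :=
  hessianCoord (inChart x g) (funInChart x u) (extChartAt (𝓡 n) x x)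

/-- The trace `g^ij T_ij`. -/
def trace (g T : TwoTensorField n M) (x : M) : ℝ :=
  traceWith (comps g x) (comps T x)

/-- The scalar curvature `R = g^ij R_ij`. -/
def scalarCurvature (g : TwoTensorField n M) (x : M) : ℝ :=
  traceWith (comps g x) (ricci g x)

/-- The Laplacian `Δu = g^ij ∇_i ∇_j u`. -/
def laplacian (g : TwoTensorField n M) (u : M → ℝ) (x : M) : ℝ :=
  traceWith (comps g x) (hessian g u x)

/-- The squared norm of the gradient `|∇u|² = g^ij ∂_i u ∂_j u`. -/
def gradNormSq (g : TwoTensorField n M) (u : M → ℝ) (x : M) : ℝ :=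
  traceWith (comps g x) (Matrix.of fun i j =>
    pd i (funInChart x u) (extChartAt (𝓡 n) x x) * pd j (funInChart x u) (extChartAt (𝓡 n) x x))

/-- The double divergence `∇_i ∇_j T_ij`, that is `g^ia g^jb ∇_i ∇_j T_ab`. -/
def divDiv (g T : TwoTensorField n M) (x : M) : ℝ :=
  ∑ i, ∑ j, ∑ a, ∑ b, (comps g x)⁻¹ i a * (comps g x)⁻¹ j b *
    covDerivTwoTwo (inChart x g) (inChart x T) i j a b (extChartAt (𝓡 n) x x)

/-- The Riemannian volume measure `dV`: the smallest measure which, on the domain of each chart,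
dominates `√(det g_ij) dx¹ … dxⁿ`. These local measures agree on the overlaps, so that `dV`
restricts to each of them. -/
def volumeMeasure [MeasurableSpace M] (g : TwoTensorField n M) : Measure M :=
  ⨆ p : M, Measure.map (extChartAt (𝓡 n) p).symm
    ((volume.restrict (extChartAt (𝓡 n) p).target).withDensity
      fun y => ENNReal.ofReal (Real.sqrt (inChart p g y).det))

/-- The integrand `(R + |∇f|²) e^{-f}`. -/
def energyDensity (g : TwoTensorField n M) (f : M → ℝ) (x : M) : ℝ :=
  (scalarCurvature g x + gradNormSq g f x) * Real.exp (-f x)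

/-- Perelman's functional `𝓕(g, f) = ∫_M (R + |∇f|²) e^{-f} dV`. -/
def functionalF [MeasurableSpace M] (g : TwoTensorField n M) (f : M → ℝ) : ℝ :=
  ∫ x, energyDensity g f x ∂(volumeMeasure g)

/-- The integrand
`e^{-f} [-v_ij (R_ij + ∇_i ∇_j f) + (v/2 - h) (2Δf - |∇f|² + R)]` of the first variation. -/
def variationDensity (g : TwoTensorField n M) (f : M → ℝ) (v : TwoTensorField n M) (h : M → ℝ)
    (x : M) : ℝ :=
  Real.exp (-f x) *
    (-pairWith (comps g x) (comps v x) (ricci g x + hessian g f x)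
      + (trace g v x / 2 - h x)
        * (2 * laplacian g f x - gradNormSq g f x + scalarCurvature g x))

end Global

end

end Perelman

open Perelman

/-! Everything pointwise is a computation in one chart, and both formulas come from two product
rules: metric compatibility of the Levi-Civita connection in space, and δ(g⁻¹) = -g⁻¹ v g⁻¹ in time.

For the scalar curvature, the variation of g^jk in R = g^jk R_jk gives -R_ij v_ij, so g^jk δR_jk
remains. Although Γ is not a tensor, its variation is one: the terms produced by δ(g⁻¹) are exactly
those that turn the partial derivatives of v into covariant ones
(`IsVelocityOn.hasDerivAt_christoffel`). Varying the formula for Ricci then gives δR_jk = ∇_i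
Γ̇^i_jk - ∇_j Γ̇^i_ik, where Γ̇^i_ik = ½ ∂_k tr v and g^jk Γ̇^i_jk is the vector dual to div v - ½
d(tr v). The trace is therefore a divergence, ∇_i ∇_j v_ij - ½ Δ tr v, minus another ½ Δ tr v
(`IsVelocityOn.traceWith_ricciDot`).

For the functional, δ√det g = ½ (tr v) √det g. The varied integrand and the claimed density differ
by the weighted divergence of one covector field, w = div v - d(tr v) + v(∇f, ·) + (2h - tr v) df;
this identity is `IsMetricOn.covectorDiv_fluxCoord`, and `IsVelocityOn.hasDerivAt_energyCoord` puts
it in the form density plus ∑ ∂_i W^i. The integral of the divergence must vanish. A finite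
partition of unity χ_a is inserted, each χ_a supported in a chart, and integration by parts in that
chart leaves -∫ e^{-f} ⟨dχ_a, w⟩. These terms add up to zero because ∑ dχ_a = d1 = 0
(`sum_fluxOn_eq_zero`), which takes the place of a global divergence theorem.

The geometric quantities are defined at x in the chart at x, and this chart changes with x.
Continuity, and computation of integrals in a fixed chart, thus require that the coordinate
expressions be invariant. Invariance starts from uniqueness of the torsion-free metric connection
(`IsMetricOn.gam_unique`): the pulled-back connection has both properties, which gives the
transformation laws of Γ, then of the curvature matrices, Ricci, Hessian, divergence and w. The
volume measure, a supremum over charts, is identified with each chart's density measure by the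
change of variables formula (`volumeMeasure_apply_of_subset`).

The coordinate identities use only symmetry and positive determinant of g. For small t a positive
determinant in every chart at once follows from compactness (`eventually_det_inChart_pos`). -/

namespace Perelman

/-! ### Entrywise calculus of matrix-valued functions -/

section MatrixCalculus

variable {m : Type*}

/-- Entrywise derivative of a curve of matrices. -/
def HasMDerivAt (A : ℝ → Matrix m m ℝ) (A' : Matrix m m ℝ) (t : ℝ) : Prop :=
  ∀ i j, HasDerivAt (fun s => A s i j) (A' i j) t

theorem HasMDerivAt.unique {A : ℝ → Matrix m m ℝ} {A' B' : Matrix m m ℝ} {t : ℝ}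
    (h : HasMDerivAt A A' t) (h' : HasMDerivAt A B' t) : A' = B' := by
  ext i j; exact (h i j).unique (h' i j)

theorem HasMDerivAt.transpose {A : ℝ → Matrix m m ℝ} {A' : Matrix m m ℝ} {t : ℝ}
    (h : HasMDerivAt A A' t) : HasMDerivAt (fun s => (A s).transpose) A'.transpose t :=
  fun i j => h j i

theorem HasMDerivAt.mul [Fintype m] {A B : ℝ → Matrix m m ℝ} {A' B' : Matrix m m ℝ} {t : ℝ}
    (hA : HasMDerivAt A A' t) (hB : HasMDerivAt B B' t) :
    HasMDerivAt (fun s => A s * B s) (A' * B t + A t * B') t := by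
  intro i j
  simp only [Matrix.mul_apply, Matrix.add_apply, ← Finset.sum_add_distrib]
  exact HasDerivAt.fun_sum fun k _ => (hA i k).fun_mul (hB k j)

theorem HasMDerivAt.trace [Fintype m] {A : ℝ → Matrix m m ℝ} {A' : Matrix m m ℝ} {t : ℝ}
    (h : HasMDerivAt A A' t) : HasDerivAt (fun s => (A s).trace) A'.trace t :=
  HasDerivAt.fun_sum fun i _ => h i i

theorem HasMDerivAt.congr_of_eventuallyEq {A B : ℝ → Matrix m m ℝ} {A' : Matrix m m ℝ} {t : ℝ}
    (h : HasMDerivAt A A' t) (hAB : B =ᶠ[𝓝 t] A) : HasMDerivAt B A' t := fun i j =>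
  (h i j).congr_of_eventuallyEq (hAB.mono fun s hs => by simp only [hs])

/-- Jacobi's formula. -/
theorem HasMDerivAt.det [Fintype m] [DecidableEq m] {A : ℝ → Matrix m m ℝ} {A' : Matrix m m ℝ} {t : ℝ}
    (h : HasMDerivAt A A' t) :
    HasDerivAt (fun s => (A s).det) ((A t).adjugate * A').trace t := by
  -- By Cramer's rule the trace is the sum over columns i of the determinant with column i replaced
  -- by that of A'. Its Leibniz expansion is what the product rule gives for det A.
  have key : ((A t).adjugate * A').trace = ∑ σ : Equiv.Perm m, ((Equiv.Perm.sign σ : ℤ) : ℝ) *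
      ∑ i, (∏ j ∈ Finset.univ.erase i, A t (σ j) j) • A' (σ i) i := by
    have h1 : ((A t).adjugate * A').trace
        = ∑ i, ((A t).updateCol i (fun k => A' k i)).det := by
      refine Finset.sum_congr rfl fun i _ => ?_
      rw [← Matrix.cramer_apply, Matrix.cramer_eq_adjugate_mulVec]
      rfl
    rw [h1]
    simp only [Matrix.det_apply', Finset.mul_sum]
    rw [Finset.sum_comm]
    refine Finset.sum_congr rfl fun σ _ => Finset.sum_congr rfl fun i _ => ?_
    rw [← Finset.prod_erase_mul _ _ (Finset.mem_univ i)]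
    simp only [Matrix.updateCol_self, smul_eq_mul]
    congr 2
    refine Finset.prod_congr rfl fun j hj => ?_
    rw [Matrix.updateCol_ne (Finset.ne_of_mem_erase hj)]
  rw [key]
  simp only [Matrix.det_apply']
  refine HasDerivAt.fun_sum fun σ _ => HasDerivAt.const_mul _ ?_
  have := HasDerivAt.finsetProd (u := Finset.univ) (x := t) (f := fun i s => A s (σ i) i)
    (f' := fun i => A' (σ i) i) fun i _ => h (σ i) i
  convert this using 1
  ext s; simp

/-- Each adjugate entry is the determinant of A with one row frozen to a unit vector, so Jacobi's
formula makes it differentiable. Only existence matters here; the value is found afterwards from A⁻¹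
A = 1. -/
theorem HasMDerivAt.exists_inv [Fintype m] [DecidableEq m] {A : ℝ → Matrix m m ℝ} {A' : Matrix m m ℝ} {t : ℝ}
    (h : HasMDerivAt A A' t) (hdet : (A t).det ≠ 0) :
    ∃ B', HasMDerivAt (fun s => (A s)⁻¹) B' t := by
  have hu : ∀ i j, ∃ d, HasDerivAt (fun s => (A s).adjugate i j) d t := by
    intro i j
    have : HasMDerivAt (fun s => (A s).updateRow j (Pi.single i 1)) (A'.updateRow j 0) t := by
      intro a b
      by_cases hab : a = j
      · subst hab
        simp only [Matrix.updateRow_self]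
        exact hasDerivAt_const _ _
      · simp only [Matrix.updateRow_ne hab]
        exact h a b
    exact ⟨_, by simpa only [Matrix.adjugate_apply] using this.det⟩
  choose d hd using hu
  refine ⟨Matrix.of fun i j => -((A t).adjugate * A').trace / (A t).det ^ 2 * (A t).adjugate i j +
    (A t).det⁻¹ * d i j, fun i j => ?_⟩
  have := (h.det.fun_inv hdet).fun_mul (hd i j)
  simpa [Matrix.inv_def] using this

/-- A⁻¹ A is identically 1 near t, since the determinant stays nonzero there. The product rule then
forces the derivative of A⁻¹. -/
theorem HasMDerivAt.inv [Fintype m] [DecidableEq m] {A : ℝ → Matrix m m ℝ} {A' : Matrix m m ℝ} {t : ℝ}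
    (h : HasMDerivAt A A' t) (hdet : (A t).det ≠ 0) :
    HasMDerivAt (fun s => (A s)⁻¹) (-((A t)⁻¹ * A' * (A t)⁻¹)) t := by
  obtain ⟨B', hB⟩ := h.exists_inv hdet
  have h1 : HasMDerivAt (fun s => (A s)⁻¹ * A s) 0 t := by
    have hc : HasMDerivAt (fun _ => (1 : Matrix m m ℝ)) 0 t := fun i j => hasDerivAt_const _ _
    refine hc.congr_of_eventuallyEq ?_
    filter_upwards [h.det.continuousAt.eventually_ne hdet] with s hs
    exact Matrix.nonsing_inv_mul _ (isUnit_iff_ne_zero.2 hs)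
  have h2 := (hB.mul h).unique h1
  have h3 : B' = -((A t)⁻¹ * A' * (A t)⁻¹) := by
    have h4 : B' * A t * (A t)⁻¹ = -((A t)⁻¹ * A') * (A t)⁻¹ := by
      rw [eq_neg_of_add_eq_zero_left h2]
    rwa [Matrix.mul_assoc, Matrix.mul_nonsing_inv _ (isUnit_iff_ne_zero.2 hdet), Matrix.mul_one,
      Matrix.neg_mul] at h4
  rw [← h3]; exact hB

/-- Used twice: in time it gives the factor ½ tr v in the variation of the volume, and along
coordinate lines it gives ∂_i √det g = √det g Γ^k_ik. -/
theorem HasMDerivAt.sqrt_det [Fintype m] [DecidableEq m] {A : ℝ → Matrix m m ℝ} {A' : Matrix m m ℝ} {t : ℝ}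
    (h : HasMDerivAt A A' t) (hdet : 0 < (A t).det) :
    HasDerivAt (fun s => √(A s).det) (√(A t).det * (((A t)⁻¹ * A').trace / 2)) t := by
  convert h.det.sqrt hdet.ne' using 1
  have hs : 0 < √(A t).det := Real.sqrt_pos.2 hdet
  rw [Matrix.inv_def, Ring.inverse_eq_inv', Matrix.smul_mul, Matrix.trace_smul, smul_eq_mul]
  field_simp
  rw [Real.sq_sqrt hdet.le]

section Smooth

variable {X : Type*} [NormedAddCommGroup X] [NormedSpace ℝ X] {s : Set X} {k : ℕ∞ω}

theorem contDiffOn_det [Fintype m] [DecidableEq m] {A : X → Matrix m m ℝ} (h : ∀ i j, ContDiffOn ℝ k (fun x => A x i j) s) :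
    ContDiffOn ℝ k (fun x => (A x).det) s := by
  simp only [Matrix.det_apply']
  exact ContDiffOn.sum fun σ _ => contDiffOn_const.mul (contDiffOn_prod fun i _ => h _ _)

theorem contDiffOn_inv_apply [Fintype m] [DecidableEq m] {A : X → Matrix m m ℝ}
    (h : ∀ i j, ContDiffOn ℝ k (fun x => A x i j) s) (hdet : ∀ x ∈ s, (A x).det ≠ 0) (i j : m) :
    ContDiffOn ℝ k (fun x => (A x)⁻¹ i j) s := by
  have h1 : ContDiffOn ℝ k (fun x => (A x).adjugate i j) s := by
    simp only [Matrix.adjugate_apply]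
    refine contDiffOn_det fun a b => ?_
    by_cases hab : a = j
    · subst hab
      simp only [Matrix.updateRow_self]
      exact contDiffOn_const
    · simp only [Matrix.updateRow_ne hab]
      exact h a b
  have := ((contDiffOn_det h).inv hdet).mul h1
  simpa [Matrix.inv_def] using this

end Smooth

end MatrixCalculus

/-! ### Partial derivatives -/

section PartialDerivatives

variable {n : ℕ} {Ω : Set (Coord n)} {y : Coord n}

/-- Entrywise partial derivative of a matrix-valued function. -/
noncomputable def mpd {ι : Type*} (i : Fin n) (A : Coord n → Matrix ι ι ℝ) (y : Coord n) :
    Matrix ι ι ℝ :=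
  Matrix.of fun a b => pd i (fun z => A z a b) y

theorem pd_congr {u w : Coord n → ℝ} (h : u =ᶠ[𝓝 y] w) (i : Fin n) : pd i u y = pd i w y := by
  simp only [pd, h.fderiv_eq]

/-- Turns a partial derivative into the derivative of a curve, so that the calculus of matrix curves
applies to matrix fields. -/
theorem hasDerivAt_pd {u : Coord n → ℝ} (hu : DifferentiableAt ℝ u y) (i : Fin n) :
    HasDerivAt (fun s : ℝ => u (y + s • EuclideanSpace.single i (1 : ℝ))) (pd i u y) 0 := by
  have h1 : HasFDerivAt u (fderiv ℝ u y) (y + (0 : ℝ) • EuclideanSpace.single i (1 : ℝ)) := by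
    simpa using hu.hasFDerivAt
  have h2 : HasDerivAt (fun s : ℝ => y + s • EuclideanSpace.single i (1 : ℝ))
      (EuclideanSpace.single i (1 : ℝ)) 0 := by
    simpa using ((hasDerivAt_id (0 : ℝ)).smul_const (EuclideanSpace.single i (1 : ℝ))).const_add y
  exact h1.comp_hasDerivAt (0 : ℝ) h2

theorem hasMDerivAt_mpd {m : Type*} {A : Coord n → Matrix m m ℝ}
    (h : ∀ a b, DifferentiableAt ℝ (fun z => A z a b) y) (i : Fin n) :
    HasMDerivAt (fun s : ℝ => A (y + s • EuclideanSpace.single i (1 : ℝ))) (mpd i A y) 0 :=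
  fun a b => hasDerivAt_pd (h a b) i

theorem pd_const (i : Fin n) (c : ℝ) : pd i (fun _ => c) y = 0 := by
  simp [pd]

theorem pd_add {u w : Coord n → ℝ} (hu : DifferentiableAt ℝ u y) (hw : DifferentiableAt ℝ w y)
    (i : Fin n) : pd i (fun z => u z + w z) y = pd i u y + pd i w y := by
  simp only [pd, fderiv_fun_add hu hw, _root_.add_apply]

theorem pd_sub {u w : Coord n → ℝ} (hu : DifferentiableAt ℝ u y) (hw : DifferentiableAt ℝ w y)
    (i : Fin n) : pd i (fun z => u z - w z) y = pd i u y - pd i w y := by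
  simp only [pd, fderiv_fun_sub hu hw, _root_.sub_apply]

theorem pd_const_mul {u : Coord n → ℝ} (hu : DifferentiableAt ℝ u y) (c : ℝ)
    (i : Fin n) : pd i (fun z => c * u z) y = c * pd i u y := by
  simp only [pd, fderiv_const_mul hu, _root_.smul_apply, smul_eq_mul]

theorem pd_mul {u w : Coord n → ℝ} (hu : DifferentiableAt ℝ u y) (hw : DifferentiableAt ℝ w y)
    (i : Fin n) : pd i (fun z => u z * w z) y = pd i u y * w y + u y * pd i w y := by
  simp only [pd, fderiv_fun_mul hu hw, _root_.add_apply,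
    _root_.smul_apply, smul_eq_mul]
  ring

theorem pd_sum {ι : Type*} {s : Finset ι} {u : ι → Coord n → ℝ}
    (hu : ∀ a ∈ s, DifferentiableAt ℝ (u a) y) (i : Fin n) :
    pd i (fun z => ∑ a ∈ s, u a z) y = ∑ a ∈ s, pd i (u a) y := by
  simp only [pd, fderiv_fun_sum hu, _root_.sum_apply]

theorem contDiffOn_pd (hΩ : IsOpen Ω) {u : Coord n → ℝ} (hu : ContDiffOn ℝ ∞ u Ω) (i : Fin n) :
    ContDiffOn ℝ ∞ (pd i u) Ω :=
  (hu.fderiv_of_isOpen hΩ (m := ∞) (by simp)).clm_apply contDiffOn_const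

theorem pd_comm (hΩ : IsOpen Ω) {u : Coord n → ℝ} (hu : ContDiffOn ℝ ∞ u Ω) (hy : y ∈ Ω)
    (i j : Fin n) : pd i (pd j u) y = pd j (pd i u) y := by
  have hc : ContDiffAt ℝ ∞ u y := hu.contDiffAt (hΩ.mem_nhds hy)
  have hd : DifferentiableAt ℝ (fderiv ℝ u) y :=
    ((hu.fderiv_of_isOpen hΩ (m := ∞) (by simp)).contDiffAt (hΩ.mem_nhds hy)).differentiableAt
      (by simp)
  have h2 : ∀ a b : Fin n, pd a (pd b u) y = fderiv ℝ (fderiv ℝ u) y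
      (EuclideanSpace.single a 1) (EuclideanSpace.single b 1) := by
    intro a b
    have : pd b u = fun z => fderiv ℝ u z (EuclideanSpace.single b 1) := rfl
    rw [pd, this, fderiv_clm_apply hd (differentiableAt_const _)]
    simp
  rw [h2, h2]
  exact (hc.isSymmSndFDerivAt (by simpa using (WithTop.coe_le_coe.2 le_top : ((2 : ℕ∞) : WithTop ℕ∞) ≤ ∞))).eq _ _

theorem _root_.ContDiffOn.differentiableAt_of_isOpen {X : Type*} [NormedAddCommGroup X] [NormedSpace ℝ X]
    {s : Set X} {u : X → ℝ} (hu : ContDiffOn ℝ ∞ u s) (hs : IsOpen s) {x : X} (hx : x ∈ s) :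
    DifferentiableAt ℝ u x :=
  (hu.contDiffAt (hs.mem_nhds hx)).differentiableAt (by simp)

theorem mpd_congr {m : Type*} {A B : Coord n → Matrix m m ℝ} (h : A =ᶠ[𝓝 y] B) (i : Fin n) :
    mpd i A y = mpd i B y := by
  ext a b
  exact pd_congr (h.mono fun z hz => by simp only [hz]) i

theorem mpd_transpose {m : Type*} (A : Coord n → Matrix m m ℝ) (i : Fin n) :
    mpd i (fun z => (A z).transpose) y = (mpd i A y).transpose := rfl

theorem mpd_mul {m : Type*} [Fintype m] {A B : Coord n → Matrix m m ℝ}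
    (hA : ∀ a b, DifferentiableAt ℝ (fun z => A z a b) y)
    (hB : ∀ a b, DifferentiableAt ℝ (fun z => B z a b) y) (i : Fin n) :
    mpd i (fun z => A z * B z) y = mpd i A y * B y + A y * mpd i B y := by
  have hAB : ∀ a b, DifferentiableAt ℝ (fun z => (A z * B z) a b) y := by
    intro a b
    simp only [Matrix.mul_apply]
    exact DifferentiableAt.fun_sum fun k _ => (hA a k).fun_mul (hB k b)
  have := (hasMDerivAt_mpd hAB i).unique ((hasMDerivAt_mpd hA i).mul (hasMDerivAt_mpd hB i))
  simpa using this

theorem mpd_add {m : Type*} {A B : Coord n → Matrix m m ℝ}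
    (hA : ∀ a b, DifferentiableAt ℝ (fun z => A z a b) y)
    (hB : ∀ a b, DifferentiableAt ℝ (fun z => B z a b) y) (i : Fin n) :
    mpd i (fun z => A z + B z) y = mpd i A y + mpd i B y := by
  ext a b
  exact pd_add (hA a b) (hB a b) i

end PartialDerivatives

/-! ### The Levi-Civita connection of a metric in coordinates -/

section Connection

variable {n : ℕ} {Ω : Set (Coord n)} {G : Coord n → Matrix (Fin n) (Fin n) ℝ} {y : Coord n}

/-- `G` is a smooth symmetric matrix field with positive determinant on the open set `Ω`. -/
structure IsMetricOn (G : Coord n → Matrix (Fin n) (Fin n) ℝ) (Ω : Set (Coord n)) : Prop where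
  isOpen : IsOpen Ω
  contDiffOn : ∀ i j, ContDiffOn ℝ ∞ (fun z => G z i j) Ω
  symm : ∀ z ∈ Ω, (G z).transpose = G z
  det_pos : ∀ z ∈ Ω, 0 < (G z).det

/-- The connection matrix `(Γ_i)^k_j` in the direction `i`. -/
noncomputable def gam (G : Coord n → Matrix (Fin n) (Fin n) ℝ) (i : Fin n) (y : Coord n) :
    Matrix (Fin n) (Fin n) ℝ :=
  Matrix.of fun k j => christoffel G k i j y

/-- The matrix `∇_i S_ab` for a fixed direction `i`. -/
noncomputable def cov (G S : Coord n → Matrix (Fin n) (Fin n) ℝ) (i : Fin n) (y : Coord n) :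
    Matrix (Fin n) (Fin n) ℝ :=
  Matrix.of fun a b => covDerivTwo G S i a b y

theorem cov_eq (G S : Coord n → Matrix (Fin n) (Fin n) ℝ) (i : Fin n) (y : Coord n) :
    cov G S i y = mpd i S y - (gam G i y).transpose * S y - S y * gam G i y := by
  ext a b
  simp only [cov, covDerivTwo, mpd, gam, Matrix.of_apply, Matrix.sub_apply, Matrix.mul_apply,
    Matrix.transpose_apply]
  congr 1
  exact Finset.sum_congr rfl fun _ _ => mul_comm _ _

theorem traceWith_eq (g A : Matrix (Fin n) (Fin n) ℝ) :
    traceWith g A = (g⁻¹ * A.transpose).trace := by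
  simp [traceWith, Matrix.trace, Matrix.mul_apply]

theorem inv_mul_of_det_pos {g : Matrix (Fin n) (Fin n) ℝ} (h : 0 < g.det) : g⁻¹ * g = 1 :=
  Matrix.nonsing_inv_mul _ (isUnit_iff_ne_zero.2 h.ne')

theorem mul_inv_of_det_pos {g : Matrix (Fin n) (Fin n) ℝ} (h : 0 < g.det) : g * g⁻¹ = 1 :=
  Matrix.mul_nonsing_inv _ (isUnit_iff_ne_zero.2 h.ne')

namespace IsMetricOn

theorem mono (h : IsMetricOn G Ω) {Ω' : Set (Coord n)} (ho : IsOpen Ω') (hs : Ω' ⊆ Ω) :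
    IsMetricOn G Ω' :=
  ⟨ho, fun i j => (h.contDiffOn i j).mono hs, fun z hz => h.symm z (hs hz),
    fun z hz => h.det_pos z (hs hz)⟩

theorem mem_nhds (h : IsMetricOn G Ω) (hy : y ∈ Ω) : Ω ∈ 𝓝 y := h.isOpen.mem_nhds hy

theorem symm_apply (h : IsMetricOn G Ω) (hy : y ∈ Ω) (i j : Fin n) : G y i j = G y j i := by
  conv_lhs => rw [← h.symm y hy]
  rfl

theorem inv_symm (h : IsMetricOn G Ω) (hy : y ∈ Ω) : (G y)⁻¹.transpose = (G y)⁻¹ := by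
  rw [Matrix.transpose_nonsing_inv, h.symm y hy]

theorem inv_symm_apply (h : IsMetricOn G Ω) (hy : y ∈ Ω) (i j : Fin n) :
    (G y)⁻¹ i j = (G y)⁻¹ j i := by
  conv_lhs => rw [← h.inv_symm hy]
  rfl

theorem contDiffOn_inv (h : IsMetricOn G Ω) (i j : Fin n) :
    ContDiffOn ℝ ∞ (fun z => (G z)⁻¹ i j) Ω :=
  contDiffOn_inv_apply h.contDiffOn (fun z hz => (h.det_pos z hz).ne') i j

theorem contDiffOn_christoffel (h : IsMetricOn G Ω) (k i j : Fin n) :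
    ContDiffOn ℝ ∞ (christoffel G k i j) Ω :=
  contDiffOn_const.mul (ContDiffOn.sum fun l _ => (h.contDiffOn_inv k l).mul
    (((contDiffOn_pd h.isOpen (h.contDiffOn j l) i).add
      (contDiffOn_pd h.isOpen (h.contDiffOn i l) j)).sub
      (contDiffOn_pd h.isOpen (h.contDiffOn i j) l)))

theorem contDiffOn_sqrt_det (h : IsMetricOn G Ω) :
    ContDiffOn ℝ ∞ (fun z => √(G z).det) Ω :=
  (contDiffOn_det h.contDiffOn).sqrt fun z hz => (h.det_pos z hz).ne'

theorem differentiableAt (h : IsMetricOn G Ω) (hy : y ∈ Ω) (i j : Fin n) :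
    DifferentiableAt ℝ (fun z => G z i j) y :=
  (h.contDiffOn i j).differentiableAt_of_isOpen h.isOpen hy

theorem differentiableAt_inv (h : IsMetricOn G Ω) (hy : y ∈ Ω) (i j : Fin n) :
    DifferentiableAt ℝ (fun z => (G z)⁻¹ i j) y :=
  (h.contDiffOn_inv i j).differentiableAt_of_isOpen h.isOpen hy

theorem pd_symm (h : IsMetricOn G Ω) (hy : y ∈ Ω) (l i j : Fin n) :
    pd l (fun z => G z i j) y = pd l (fun z => G z j i) y :=
  pd_congr (by filter_upwards [h.mem_nhds hy] with z hz using h.symm_apply hz i j) l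

theorem christoffel_symm (h : IsMetricOn G Ω) (hy : y ∈ Ω) (k i j : Fin n) :
    christoffel G k i j y = christoffel G k j i y := by
  simp only [christoffel]
  congr 1
  refine Finset.sum_congr rfl fun l _ => ?_
  rw [h.pd_symm hy l i j]; ring

/-- Lowering the upper index cancels g⁻¹ and leaves the Christoffel symbols of the first kind, which
are linear in the derivatives of g. -/
theorem sum_mul_christoffel (h : IsMetricOn G Ω) (hy : y ∈ Ω) (m i j : Fin n) :
    ∑ k, G y m k * christoffel G k i j y = (1 / 2 : ℝ) *
      (pd i (fun z => G z j m) y + pd j (fun z => G z i m) y - pd m (fun z => G z i j) y) := by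
  set c : Fin n → ℝ := fun l =>
    pd i (fun z => G z j l) y + pd j (fun z => G z i l) y - pd l (fun z => G z i j) y
  have h1 : ∀ k, christoffel G k i j y = (1 / 2 : ℝ) * ((G y)⁻¹.mulVec c) k := fun k => rfl
  have h2 : (G y).mulVec ((G y)⁻¹.mulVec c) = c := by
    rw [Matrix.mulVec_mulVec, mul_inv_of_det_pos (h.det_pos y hy), Matrix.one_mulVec]
  calc ∑ k, G y m k * christoffel G k i j y
      = (1 / 2 : ℝ) * ((G y).mulVec ((G y)⁻¹.mulVec c)) m := by
        simp only [h1, Matrix.mulVec, dotProduct, Finset.mul_sum]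
        refine Finset.sum_congr rfl fun k _ => Finset.sum_congr rfl fun l _ => by ring
    _ = _ := by rw [h2]

/-- Metric compatibility, `∂_i g = Γ_iᵀ g + g Γ_i`. -/
theorem mpd_eq (h : IsMetricOn G Ω) (hy : y ∈ Ω) (i : Fin n) :
    mpd i G y = (gam G i y).transpose * G y + G y * gam G i y := by
  ext j l
  simp only [mpd, gam, Matrix.of_apply, Matrix.add_apply, Matrix.mul_apply,
    Matrix.transpose_apply]
  have h1 : ∑ x, christoffel G x i j y * G y x l = ∑ x, G y l x * christoffel G x i j y :=
    Finset.sum_congr rfl fun x _ => by rw [h.symm_apply hy l x, mul_comm]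
  rw [h1, h.sum_mul_christoffel hy, h.sum_mul_christoffel hy, h.pd_symm hy i l j,
    h.pd_symm hy l i j, h.pd_symm hy j i l, h.pd_symm hy j l i, h.pd_symm hy l j i]
  ring

theorem hasMDerivAt_line (h : IsMetricOn G Ω) (hy : y ∈ Ω) (i : Fin n) :
    HasMDerivAt (fun s : ℝ => G (y + s • EuclideanSpace.single i (1 : ℝ))) (mpd i G y) 0 :=
  hasMDerivAt_mpd (h.differentiableAt hy) i

/-- Metric compatibility substituted into the derivative of an inverse: g⁻¹ is parallel too. -/
theorem mpd_inv (h : IsMetricOn G Ω) (hy : y ∈ Ω) (i : Fin n) :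
    mpd i (fun z => (G z)⁻¹) y =
      -((G y)⁻¹ * (gam G i y).transpose + gam G i y * (G y)⁻¹) := by
  have hp := h.det_pos y hy
  have h1 := (h.hasMDerivAt_line hy i).inv (by simpa using hp.ne')
  have h2 := (hasMDerivAt_mpd (h.differentiableAt_inv hy) i).unique h1
  rw [h2, h.mpd_eq hy]
  simp only [zero_smul, add_zero]
  rw [Matrix.mul_add, Matrix.add_mul, Matrix.mul_assoc (G y)⁻¹ _ (G y)⁻¹,
    Matrix.mul_assoc _ (G y) (G y)⁻¹, mul_inv_of_det_pos hp, Matrix.mul_one,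
    ← Matrix.mul_assoc (G y)⁻¹ (G y), inv_mul_of_det_pos hp, Matrix.one_mul]

theorem pd_inv (h : IsMetricOn G Ω) (hy : y ∈ Ω) (i j k : Fin n) :
    pd i (fun z => (G z)⁻¹ j k) y = -(∑ l, (G y)⁻¹ j l * christoffel G k i l y
      + ∑ l, christoffel G j i l y * (G y)⁻¹ l k) := by
  have := congrFun (congrFun (h.mpd_inv hy i) j) k
  simpa [mpd, gam, Matrix.mul_apply] using this

/-- By compatibility g⁻¹ ∂_i g is Γ_i plus a conjugate of its transpose, and these two have the same
trace. -/
theorem trace_gam (h : IsMetricOn G Ω) (hy : y ∈ Ω) (i : Fin n) :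
    (gam G i y).trace = ((G y)⁻¹ * mpd i G y).trace / 2 := by
  have hp := h.det_pos y hy
  rw [h.mpd_eq hy, Matrix.mul_add, Matrix.trace_add, ← Matrix.mul_assoc (G y)⁻¹ (G y),
    inv_mul_of_det_pos hp, Matrix.one_mul, Matrix.trace_mul_comm, Matrix.mul_assoc,
    mul_inv_of_det_pos hp, Matrix.mul_one, Matrix.trace_transpose]
  ring

theorem sum_christoffel (h : IsMetricOn G Ω) (hy : y ∈ Ω) (i : Fin n) :
    ∑ k, christoffel G k k i y = (gam G i y).trace :=
  Finset.sum_congr rfl fun k _ => h.christoffel_symm hy k k i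

theorem pd_sqrt_det (h : IsMetricOn G Ω) (hy : y ∈ Ω) (i : Fin n) :
    pd i (fun z => √(G z).det) y = √(G y).det * (gam G i y).trace := by
  have h1 := (h.hasMDerivAt_line hy i).sqrt_det (by simpa using h.det_pos y hy)
  have h2 := (hasDerivAt_pd (h.contDiffOn_sqrt_det.differentiableAt_of_isOpen h.isOpen hy) i)
  rw [h2.unique h1, h.trace_gam hy]
  simp

/-- As g⁻¹ is parallel, traces commute with ∇. The connection terms of ∂_i g⁻¹ are those subtracted
in ∇_i S, up to cyclic permutation under the trace. -/
theorem pd_traceWith (h : IsMetricOn G Ω) (hy : y ∈ Ω) {S : Coord n → Matrix (Fin n) (Fin n) ℝ}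
    (hS : ∀ a b, DifferentiableAt ℝ (fun z => S z a b) y) (i : Fin n) :
    pd i (fun z => traceWith (G z) (S z)) y = traceWith (G y) (cov G S i y) := by
  have hd : DifferentiableAt ℝ (fun z => traceWith (G z) (S z)) y := by
    simp only [traceWith]
    exact DifferentiableAt.fun_sum fun a _ => DifferentiableAt.fun_sum fun b _ =>
      (h.differentiableAt_inv hy a b).fun_mul (hS a b)
  have h1 := hasDerivAt_pd hd i
  simp only [traceWith_eq] at h1 ⊢
  have h2 := ((hasMDerivAt_mpd (h.differentiableAt_inv hy) i).mul
    (hasMDerivAt_mpd (A := S) hS i).transpose).trace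
  rw [h1.unique h2, h.mpd_inv hy, cov_eq]
  simp only [zero_smul, add_zero, Matrix.transpose_sub, Matrix.transpose_mul,
    Matrix.transpose_transpose, Matrix.mul_sub, Matrix.trace_sub, Matrix.trace_add,
    Matrix.neg_mul, Matrix.trace_neg, Matrix.add_mul]
  rw [Matrix.mul_assoc (gam G i y) _ _, Matrix.trace_mul_comm (gam G i y), Matrix.mul_assoc,
    Matrix.mul_assoc]
  ring

/-- Raising the index of a covector commutes with covariant differentiation. -/
theorem sum_pd_raise (h : IsMetricOn G Ω) (hy : y ∈ Ω) {w : Fin n → Coord n → ℝ}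
    (hw : ∀ b, DifferentiableAt ℝ (w b) y) :
    ∑ i, (pd i (fun z => ∑ b, (G z)⁻¹ i b * w b z) y
        + (gam G i y).trace * ∑ b, (G y)⁻¹ i b * w b y)
      = ∑ a, ∑ b, (G y)⁻¹ a b * (pd a (w b) y - ∑ k, christoffel G k a b y * w k y) := by
  have h1 : ∀ i, pd i (fun z => ∑ b, (G z)⁻¹ i b * w b z) y
      = ∑ b, ((G y)⁻¹ i b * pd i (w b) y) - ∑ b, ∑ l, (G y)⁻¹ i l * christoffel G b i l y * w b y
        - ∑ b, ∑ l, christoffel G i i l y * (G y)⁻¹ l b * w b y := by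
    intro i
    rw [pd_sum fun b _ => (h.differentiableAt_inv hy i b).fun_mul (hw b)]
    simp only [← Finset.sum_sub_distrib]
    refine Finset.sum_congr rfl fun b _ => ?_
    rw [pd_mul (h.differentiableAt_inv hy i b) (hw b), h.pd_inv hy,
      ← Finset.sum_mul, ← Finset.sum_mul]
    ring
  simp only [h1, Finset.sum_add_distrib, Finset.sum_sub_distrib, mul_sub]
  -- Of the two connection terms in ∂_i g^ib, one contracts to Γ^i_il and cancels the trace term on
  -- the left; the other (`h3`) is the Christoffel correction in ∇_a w_b.
  have h2 : ∑ i, ∑ b, ∑ l, christoffel G i i l y * (G y)⁻¹ l b * w b y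
      = ∑ i, (gam G i y).trace * ∑ b, (G y)⁻¹ i b * w b y := by
    simp only [← h.sum_christoffel hy, Finset.mul_sum, Finset.sum_mul]
    rw [Finset.sum_congr rfl fun i _ => Finset.sum_comm, Finset.sum_comm]
    refine Finset.sum_congr rfl fun i _ => ?_
    rw [Finset.sum_comm]
    exact Finset.sum_congr rfl fun b _ => Finset.sum_congr rfl fun k _ => by ring
  have h3 : ∑ i, ∑ b, ∑ l, (G y)⁻¹ i l * christoffel G b i l y * w b y
      = ∑ a, ∑ b, (G y)⁻¹ a b * ∑ k, christoffel G k a b y * w k y := by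
    simp only [Finset.mul_sum]
    refine Finset.sum_congr rfl fun i _ => ?_
    rw [Finset.sum_comm]
    exact Finset.sum_congr rfl fun b _ => Finset.sum_congr rfl fun k _ => by ring
  rw [h2, h3]
  ring

/-- The divergence of the vector field `e^{-f} w^♯` in coordinates. -/
theorem sum_pd_weighted (h : IsMetricOn G Ω) (hy : y ∈ Ω) {w : Fin n → Coord n → ℝ}
    (hw : ∀ b, DifferentiableAt ℝ (w b) y) {f : Coord n → ℝ} (hf : DifferentiableAt ℝ f y) :
    ∑ i, pd i (fun z => √(G z).det * (Real.exp (-f z) * ∑ b, (G z)⁻¹ i b * w b z)) y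
      = √(G y).det * (Real.exp (-f y) *
        (∑ a, ∑ b, (G y)⁻¹ a b * (pd a (w b) y - ∑ k, christoffel G k a b y * w k y)
          - ∑ a, ∑ b, (G y)⁻¹ a b * (pd a f y * w b y))) := by
  have hX : ∀ i, DifferentiableAt ℝ (fun z => ∑ b, (G z)⁻¹ i b * w b z) y := fun i =>
    DifferentiableAt.fun_sum fun b _ => (h.differentiableAt_inv hy i b).fun_mul (hw b)
  have hs := h.contDiffOn_sqrt_det.differentiableAt_of_isOpen h.isOpen hy
  have he : DifferentiableAt ℝ (fun z => Real.exp (-f z)) y := hf.fun_neg.exp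
  have hpe : ∀ i, pd i (fun z => Real.exp (-f z)) y = -(Real.exp (-f y) * pd i f y) := by
    intro i
    have h1 := (hasDerivAt_pd hf i).fun_neg.exp
    rw [(hasDerivAt_pd he i).unique h1]
    simp
  rw [← h.sum_pd_raise hy hw, ← Finset.sum_sub_distrib, Finset.mul_sum, Finset.mul_sum]
  refine Finset.sum_congr rfl fun i _ => ?_
  rw [pd_mul hs (he.fun_mul (hX i)), pd_mul he (hX i), hpe, h.pd_sqrt_det hy]
  have h4 : ∑ b, (G y)⁻¹ i b * (pd i f y * w b y) = pd i f y * ∑ b, (G y)⁻¹ i b * w b y := by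
    rw [Finset.mul_sum]
    exact Finset.sum_congr rfl fun b _ => by ring
  rw [h4]
  ring

end IsMetricOn

end Connection

/-! ### Parameter-dependent functions -/

section Parameter

variable {n : ℕ} {O : Set (ℝ × Coord n)} {U : ℝ → Coord n → ℝ} {y : Coord n} {t : ℝ}

theorem isOpen_slice (hO : IsOpen O) (t : ℝ) : IsOpen {z : Coord n | (t, z) ∈ O} :=
  hO.preimage (by fun_prop)

theorem contDiffOn_slice (hU : ContDiffOn ℝ ∞ (fun q : ℝ × Coord n => U q.1 q.2) O) (t : ℝ) :
    ContDiffOn ℝ ∞ (U t) {z : Coord n | (t, z) ∈ O} :=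
  hU.comp (f := fun z : Coord n => (t, z)) (by fun_prop) fun _ hz => hz

theorem hasFDerivAt_uncurry (hO : IsOpen O)
    (hU : ContDiffOn ℝ ∞ (fun q : ℝ × Coord n => U q.1 q.2) O) (hq : (t, y) ∈ O) :
    HasFDerivAt (fun q : ℝ × Coord n => U q.1 q.2)
      (fderiv ℝ (fun q : ℝ × Coord n => U q.1 q.2) (t, y)) (t, y) :=
  (hU.differentiableAt_of_isOpen hO hq).hasFDerivAt

theorem pd_eq_fderiv_uncurry (hO : IsOpen O)
    (hU : ContDiffOn ℝ ∞ (fun q : ℝ × Coord n => U q.1 q.2) O) (hq : (t, y) ∈ O) (i : Fin n) :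
    pd i (U t) y = fderiv ℝ (fun q : ℝ × Coord n => U q.1 q.2) (t, y)
      ((0 : ℝ), EuclideanSpace.single i (1 : ℝ)) := by
  have h2 : HasFDerivAt (fun z : Coord n => (t, z)) (ContinuousLinearMap.inr ℝ ℝ (Coord n)) y :=
    hasFDerivAt_prodMk_right t y
  have h3 := (hasFDerivAt_uncurry hO hU hq).comp y h2
  have h4 : HasFDerivAt (U t) _ y := h3
  rw [pd, h4.fderiv]
  simp

theorem hasDerivAt_fderiv_uncurry (hO : IsOpen O)
    (hU : ContDiffOn ℝ ∞ (fun q : ℝ × Coord n => U q.1 q.2) O) (hq : (t, y) ∈ O) :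
    HasDerivAt (fun s => U s y) (fderiv ℝ (fun q : ℝ × Coord n => U q.1 q.2) (t, y)
      ((1 : ℝ), (0 : Coord n))) t := by
  have h2 : HasDerivAt (fun s : ℝ => (s, y)) ((1 : ℝ), (0 : Coord n)) t :=
    (hasDerivAt_id t).prodMk (hasDerivAt_const t y)
  exact (hasFDerivAt_uncurry hO hU hq).comp_hasDerivAt t h2

theorem contDiffOn_fderiv_uncurry_apply (hO : IsOpen O)
    (hU : ContDiffOn ℝ ∞ (fun q : ℝ × Coord n => U q.1 q.2) O) (e : ℝ × Coord n) :
    ContDiffOn ℝ ∞ (fun q => fderiv ℝ (fun q : ℝ × Coord n => U q.1 q.2) q e) O :=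
  (hU.fderiv_of_isOpen hO (m := ∞) (by simp)).clm_apply contDiffOn_const

theorem contDiffOn_pd_uncurry (hO : IsOpen O)
    (hU : ContDiffOn ℝ ∞ (fun q : ℝ × Coord n => U q.1 q.2) O) (i : Fin n) :
    ContDiffOn ℝ ∞ (fun q : ℝ × Coord n => pd i (U q.1) q.2) O :=
  (contDiffOn_fderiv_uncurry_apply hO hU _).congr fun q hq =>
    pd_eq_fderiv_uncurry hO hU (t := q.1) (y := q.2) hq i

/-- The velocity is the time component of the joint derivative, so it inherits smoothness from the
family. -/
theorem contDiffOn_of_hasDerivAt (hO : IsOpen O)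
    (hU : ContDiffOn ℝ ∞ (fun q : ℝ × Coord n => U q.1 q.2) O) {u : Coord n → ℝ}
    (hu : ∀ z, (t, z) ∈ O → HasDerivAt (fun s => U s z) (u z) t) :
    ContDiffOn ℝ ∞ u {z : Coord n | (t, z) ∈ O} :=
  (contDiffOn_slice (U := fun s z => fderiv ℝ (fun q : ℝ × Coord n => U q.1 q.2) (s, z)
    ((1 : ℝ), (0 : Coord n))) (contDiffOn_fderiv_uncurry_apply hO hU _) t).congr
    fun z hz => (hu z hz).unique (hasDerivAt_fderiv_uncurry hO hU hz)

/-- The time derivative commutes with partial derivatives. -/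
theorem hasDerivAt_pd_param (hO : IsOpen O)
    (hU : ContDiffOn ℝ ∞ (fun q : ℝ × Coord n => U q.1 q.2) O) (hq : (t, y) ∈ O)
    {u : Coord n → ℝ} (hu : ∀ z, (t, z) ∈ O → HasDerivAt (fun s => U s z) (u z) t) (i : Fin n) :
    HasDerivAt (fun s => pd i (U s) y) (pd i u y) t := by
  set V : ℝ × Coord n → ℝ := fun q => U q.1 q.2 with hV
  set e : ℝ × Coord n := ((0 : ℝ), EuclideanSpace.single i (1 : ℝ)) with he
  have hd : DifferentiableAt ℝ (fderiv ℝ V) (t, y) :=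
    ((hU.fderiv_of_isOpen hO (m := ∞) (by simp)).contDiffAt (hO.mem_nhds hq)).differentiableAt
      (by simp)
  -- Both orders of differentiation are values of the second derivative of the joint function on
  -- space-time, which is symmetric.
  have hsymm : fderiv ℝ (fderiv ℝ V) (t, y) ((1 : ℝ), (0 : Coord n)) e
      = fderiv ℝ (fderiv ℝ V) (t, y) e ((1 : ℝ), (0 : Coord n)) :=
    ((hU.contDiffAt (hO.mem_nhds hq)).isSymmSndFDerivAt
      (by simpa using (WithTop.coe_le_coe.2 le_top : ((2 : ℕ∞) : WithTop ℕ∞) ≤ ∞))).eq _ _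
  have hA : HasDerivAt (fun s => fderiv ℝ V (s, y) e)
      (fderiv ℝ (fderiv ℝ V) (t, y) ((1 : ℝ), (0 : Coord n)) e) t := by
    have h2 : HasDerivAt (fun s : ℝ => (s, y)) ((1 : ℝ), (0 : Coord n)) t :=
      (hasDerivAt_id t).prodMk (hasDerivAt_const t y)
    have h3 := hd.hasFDerivAt.comp_hasDerivAt t h2
    simpa using h3.clm_apply (hasDerivAt_const t e)
  have hB : pd i u y = fderiv ℝ (fderiv ℝ V) (t, y) e ((1 : ℝ), (0 : Coord n)) := by
    have h1 : u =ᶠ[𝓝 y] fun z => fderiv ℝ V (t, z) ((1 : ℝ), (0 : Coord n)) := by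
      filter_upwards [(isOpen_slice hO t).mem_nhds hq] with z hz
      exact (hu z hz).unique (hasDerivAt_fderiv_uncurry hO hU hz)
    rw [pd_congr h1]
    have h2 : HasFDerivAt (fun z : Coord n => (t, z)) (ContinuousLinearMap.inr ℝ ℝ (Coord n)) y :=
      hasFDerivAt_prodMk_right t y
    have h3 := (hd.hasFDerivAt.comp y h2).clm_apply
      (hasFDerivAt_const ((1 : ℝ), (0 : Coord n)) y)
    have h4 : HasFDerivAt (fun z => fderiv ℝ V (t, z) ((1 : ℝ), (0 : Coord n))) _ y := h3
    rw [pd, h4.fderiv]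
    simp [he]
  rw [hB, ← hsymm]
  refine hA.congr_of_eventuallyEq ?_
  have : ∀ᶠ s in 𝓝 t, (s, y) ∈ O :=
    (Continuous.prodMk_left y).continuousAt.eventually (hO.mem_nhds hq)
  filter_upwards [this] with s hs
  exact pd_eq_fderiv_uncurry hO hU hs i

end Parameter

/-! ### Scalar quantities in coordinates -/

section Quantities

variable {n : ℕ}

/-- The scalar curvature in coordinates. -/
noncomputable def scalCoord (G : Coord n → Matrix (Fin n) (Fin n) ℝ) (y : Coord n) : ℝ :=
  traceWith (G y) (ricciCoord G y)

/-- `⟨∇u, ∇w⟩` in coordinates. -/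
noncomputable def gradCoord (G : Coord n → Matrix (Fin n) (Fin n) ℝ) (u w : Coord n → ℝ)
    (y : Coord n) : ℝ :=
  traceWith (G y) (Matrix.of fun i j => pd i u y * pd j w y)

/-- The Laplacian in coordinates. -/
noncomputable def lapCoord (G : Coord n → Matrix (Fin n) (Fin n) ℝ) (u : Coord n → ℝ)
    (y : Coord n) : ℝ :=
  traceWith (G y) (hessianCoord G u y)

/-- The trace of a 2-tensor in coordinates. -/
noncomputable def trCoord (G v : Coord n → Matrix (Fin n) (Fin n) ℝ) (y : Coord n) : ℝ :=
  traceWith (G y) (v y)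

/-- The divergence `g^jb ∇_j v_ab` in coordinates. -/
noncomputable def divCoord (G v : Coord n → Matrix (Fin n) (Fin n) ℝ) (a : Fin n)
    (y : Coord n) : ℝ :=
  traceWith (G y) (Matrix.of fun j b => covDerivTwo G v j a b y)

/-- The double divergence in coordinates. -/
noncomputable def divDivCoord (G v : Coord n → Matrix (Fin n) (Fin n) ℝ) (y : Coord n) : ℝ :=
  ∑ i, ∑ j, ∑ a, ∑ b, (G y)⁻¹ i a * (G y)⁻¹ j b * covDerivTwoTwo G v i j a b y

/-- The contraction `g^ab ∇_a w_b` of the covariant derivative of a covector field. -/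
noncomputable def covectorDiv (G : Coord n → Matrix (Fin n) (Fin n) ℝ)
    (w : Fin n → Coord n → ℝ) (y : Coord n) : ℝ :=
  ∑ a, ∑ b, (G y)⁻¹ a b * (pd a (w b) y - ∑ k, christoffel G k a b y * w k y)

/-- The first variation of the Christoffel symbols. -/
noncomputable def christoffelDot (G v : Coord n → Matrix (Fin n) (Fin n) ℝ) (k i j : Fin n)
    (y : Coord n) : ℝ :=
  (1 / 2 : ℝ) * ∑ l, (G y)⁻¹ k l *
    (covDerivTwo G v i j l y + covDerivTwo G v j i l y - covDerivTwo G v l i j y)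

theorem sum_comm_four {ι : Type*} [Fintype ι] (F : ι → ι → ι → ι → ℝ) :
    ∑ i, ∑ j, ∑ a, ∑ b, F i j a b = ∑ a, ∑ b, ∑ i, ∑ j, F i j a b :=
  calc ∑ i, ∑ j, ∑ a, ∑ b, F i j a b = ∑ i, ∑ a, ∑ b, ∑ j, F i j a b :=
        Finset.sum_congr rfl fun _ _ => Finset.sum_comm.trans
          (Finset.sum_congr rfl fun _ _ => Finset.sum_comm)
    _ = ∑ a, ∑ b, ∑ i, ∑ j, F i j a b :=
        Finset.sum_comm.trans (Finset.sum_congr rfl fun _ _ => Finset.sum_comm)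

theorem pairWith_eq (g A B : Matrix (Fin n) (Fin n) ℝ) :
    pairWith g A B = (g⁻¹.transpose * A * g⁻¹ * B.transpose).trace := by
  simp only [pairWith, Matrix.trace, Matrix.diag_apply, Matrix.mul_apply,
    Matrix.transpose_apply, Finset.sum_mul]
  rw [sum_comm_four]
  refine Finset.sum_congr rfl fun a _ => Finset.sum_congr rfl fun b _ => ?_
  rw [Finset.sum_comm]
  exact Finset.sum_congr rfl fun j _ => Finset.sum_congr rfl fun i _ => by ring

/-- Reconciles the order v, Ric that differentiating a trace produces with the order Ric, v of the
final formula. -/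
theorem pairWith_comm {g : Matrix (Fin n) (Fin n) ℝ} (hg : g⁻¹.transpose = g⁻¹)
    (A B : Matrix (Fin n) (Fin n) ℝ) : pairWith g A B = pairWith g B A := by
  have h (i j : Fin n) : g⁻¹ i j = g⁻¹ j i := congrFun (congrFun hg j) i
  simp only [pairWith]
  rw [sum_comm_four]
  refine Finset.sum_congr rfl fun a _ => Finset.sum_congr rfl fun b _ => Finset.sum_congr rfl
    fun i _ => Finset.sum_congr rfl fun j _ => ?_
  rw [h i a, h j b]; ring

theorem pairWith_add_right (g A B C : Matrix (Fin n) (Fin n) ℝ) :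
    pairWith g A (B + C) = pairWith g A B + pairWith g A C := by
  simp only [pairWith_eq, Matrix.transpose_add, Matrix.mul_add, Matrix.trace_add]

end Quantities

/-! ### Static identities for a metric and a symmetric 2-tensor -/

section Static

variable {n : ℕ} {Ω : Set (Coord n)} {G v : Coord n → Matrix (Fin n) (Fin n) ℝ} {y : Coord n}

theorem traceWith_add (g A B : Matrix (Fin n) (Fin n) ℝ) :
    traceWith g (A + B) = traceWith g A + traceWith g B := by
  simp only [traceWith_eq, Matrix.transpose_add, Matrix.mul_add, Matrix.trace_add]

theorem contDiffOn_traceWith {X : Type*} [NormedAddCommGroup X] [NormedSpace ℝ X] {s : Set X}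
    {A S : X → Matrix (Fin n) (Fin n) ℝ} (hA : ∀ i j, ContDiffOn ℝ ∞ (fun z => A z i j) s)
    (hdet : ∀ z ∈ s, 0 < (A z).det)
    (hS : ∀ i j, ContDiffOn ℝ ∞ (fun z => S z i j) s) :
    ContDiffOn ℝ ∞ (fun z => traceWith (A z) (S z)) s :=
  ContDiffOn.sum fun i _ => ContDiffOn.sum fun j _ =>
    (contDiffOn_inv_apply hA (fun z hz => (hdet z hz).ne') i j).mul (hS i j)

namespace IsMetricOn

theorem traceWith_transpose (h : IsMetricOn G Ω) (hy : y ∈ Ω) (A : Matrix (Fin n) (Fin n) ℝ) :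
    traceWith (G y) A.transpose = traceWith (G y) A := by
  simp only [traceWith]
  rw [Finset.sum_comm]
  refine Finset.sum_congr rfl fun i _ => Finset.sum_congr rfl fun j _ => ?_
  rw [h.inv_symm_apply hy j i, Matrix.transpose_apply]

theorem contDiffOn_covDerivTwo (h : IsMetricOn G Ω)
    (hv : ∀ i j, ContDiffOn ℝ ∞ (fun z => v z i j) Ω) (k i j : Fin n) :
    ContDiffOn ℝ ∞ (covDerivTwo G v k i j) Ω :=
  ((contDiffOn_pd h.isOpen (hv i j) k).sub
    (ContDiffOn.sum fun l _ => (h.contDiffOn_christoffel l k i).mul (hv l j))).sub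
    (ContDiffOn.sum fun l _ => (h.contDiffOn_christoffel l k j).mul (hv i l))

theorem contDiffOn_trCoord (h : IsMetricOn G Ω)
    (hv : ∀ i j, ContDiffOn ℝ ∞ (fun z => v z i j) Ω) : ContDiffOn ℝ ∞ (trCoord G v) Ω :=
  contDiffOn_traceWith h.contDiffOn h.det_pos hv

theorem contDiffOn_divCoord (h : IsMetricOn G Ω)
    (hv : ∀ i j, ContDiffOn ℝ ∞ (fun z => v z i j) Ω) (a : Fin n) :
    ContDiffOn ℝ ∞ (divCoord G v a) Ω :=
  contDiffOn_traceWith h.contDiffOn h.det_pos fun j b => h.contDiffOn_covDerivTwo hv j a b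

theorem contDiffOn_christoffelDot (h : IsMetricOn G Ω)
    (hv : ∀ i j, ContDiffOn ℝ ∞ (fun z => v z i j) Ω) (k i j : Fin n) :
    ContDiffOn ℝ ∞ (christoffelDot G v k i j) Ω :=
  contDiffOn_const.mul (ContDiffOn.sum fun l _ => (h.contDiffOn_inv k l).mul
    (((h.contDiffOn_covDerivTwo hv i j l).add (h.contDiffOn_covDerivTwo hv j i l)).sub
      (h.contDiffOn_covDerivTwo hv l i j)))

theorem pd_trCoord (h : IsMetricOn G Ω) (hy : y ∈ Ω)
    (hv : ∀ i j, ContDiffOn ℝ ∞ (fun z => v z i j) Ω) (i : Fin n) :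
    pd i (trCoord G v) y = traceWith (G y) (cov G v i y) :=
  h.pd_traceWith hy (fun a b => (hv a b).differentiableAt_of_isOpen h.isOpen hy) i

theorem covDerivTwo_symm (h : IsMetricOn G Ω) (hy : y ∈ Ω)
    (hvs : ∀ z ∈ Ω, (v z).transpose = v z) (k i j : Fin n) :
    covDerivTwo G v k i j y = covDerivTwo G v k j i y := by
  have hs : ∀ z ∈ Ω, ∀ a b, v z a b = v z b a := fun z hz a b => by
    conv_lhs => rw [← hvs z hz]
    rfl
  simp only [covDerivTwo]
  rw [pd_congr (u := fun z => v z i j) (w := fun z => v z j i) (by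
    filter_upwards [h.mem_nhds hy] with z hz using hs z hz i j) k]
  rw [Finset.sum_congr rfl fun l _ => by rw [hs y hy l j],
    Finset.sum_congr rfl (f := fun l => christoffel G l k j y * v y i l)
      fun l _ => by rw [hs y hy i l]]
  ring

/-- `Γ̇^i_ik = ½ ∂_k tr v`. -/
theorem sum_christoffelDot (h : IsMetricOn G Ω) (hy : y ∈ Ω)
    (hv : ∀ i j, ContDiffOn ℝ ∞ (fun z => v z i j) Ω)
    (hvs : ∀ z ∈ Ω, (v z).transpose = v z) (k : Fin n) :
    ∑ i, christoffelDot G v i i k y = (1 / 2 : ℝ) * pd k (trCoord G v) y := by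
  rw [h.pd_trCoord hy hv]
  simp only [christoffelDot, ← Finset.mul_sum, traceWith, cov, Matrix.of_apply]
  congr 1
  simp only [mul_sub, mul_add, Finset.sum_sub_distrib, Finset.sum_add_distrib]
  -- The first and third terms of Γ̇ are exchanged by swapping the summed indices, so they cancel
  -- against the symmetric g⁻¹. Only ½ g^il ∇_k v_il survives.
  have : ∑ i, ∑ l, (G y)⁻¹ i l * covDerivTwo G v i k l y
      = ∑ i, ∑ l, (G y)⁻¹ i l * covDerivTwo G v l i k y := by
    rw [Finset.sum_comm]
    refine Finset.sum_congr rfl fun i _ => Finset.sum_congr rfl fun l _ => ?_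
    rw [h.inv_symm_apply hy, h.covDerivTwo_symm hy hvs l k i]
  rw [this]; ring

/-- `g^jk Γ̇^m_jk = g^ml ((div v)_l - ½ ∂_l tr v)`. -/
theorem traceWith_christoffelDot (h : IsMetricOn G Ω) (hy : y ∈ Ω)
    (hv : ∀ i j, ContDiffOn ℝ ∞ (fun z => v z i j) Ω)
    (hvs : ∀ z ∈ Ω, (v z).transpose = v z) (m : Fin n) :
    traceWith (G y) (Matrix.of fun j k => christoffelDot G v m j k y)
      = ∑ l, (G y)⁻¹ m l * (divCoord G v l y - (1 / 2 : ℝ) * pd l (trCoord G v) y) := by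
  have h1 : ∀ l, divCoord G v l y - (1 / 2 : ℝ) * pd l (trCoord G v) y
      = (1 / 2 : ℝ) * ∑ j, ∑ k, (G y)⁻¹ j k *
      (covDerivTwo G v j k l y + covDerivTwo G v k j l y - covDerivTwo G v l j k y) := by
    intro l
    rw [h.pd_trCoord hy hv]
    simp only [divCoord, traceWith, cov, Matrix.of_apply, mul_sub, mul_add,
      Finset.sum_sub_distrib, Finset.sum_add_distrib]
    have e1 : ∑ j, ∑ b, (G y)⁻¹ j b * covDerivTwo G v j l b y
        = ∑ j, ∑ k, (G y)⁻¹ j k * covDerivTwo G v j k l y :=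
      Finset.sum_congr rfl fun i _ => Finset.sum_congr rfl fun l _ => by
        rw [h.covDerivTwo_symm hy hvs]
    have e2 : ∑ j, ∑ k, (G y)⁻¹ j k * covDerivTwo G v k j l y
        = ∑ j, ∑ k, (G y)⁻¹ j k * covDerivTwo G v j k l y := by
      rw [Finset.sum_comm]
      exact Finset.sum_congr rfl fun i _ => Finset.sum_congr rfl fun l _ => by
        rw [h.inv_symm_apply hy]
    rw [e1, e2]; ring
  simp only [h1]
  simp only [traceWith, christoffelDot, Matrix.of_apply, Finset.mul_sum]
  rw [Finset.sum_congr rfl fun j _ => Finset.sum_comm, Finset.sum_comm]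
  exact Finset.sum_congr rfl fun l _ => Finset.sum_congr rfl fun j _ =>
    Finset.sum_congr rfl fun k _ => by ring

/-- The trace inside div v passes through the outer derivative because g is parallel. The
Christoffel term for the free index of div v supplies the remaining correction in ∇∇v. -/
theorem covectorDiv_divCoord (h : IsMetricOn G Ω) (hy : y ∈ Ω)
    (hv : ∀ i j, ContDiffOn ℝ ∞ (fun z => v z i j) Ω) :
    covectorDiv G (divCoord G v) y = divDivCoord G v y := by
  have h1 : ∀ i a, pd i (divCoord G v a) y - ∑ k, christoffel G k i a y * divCoord G v k y
      = ∑ j, ∑ b, (G y)⁻¹ j b * covDerivTwoTwo G v i j a b y := by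
    intro i a
    have e1 : pd i (divCoord G v a) y
        = traceWith (G y) (cov G (fun z => Matrix.of fun j b => covDerivTwo G v j a b z) i y) :=
      h.pd_traceWith hy (fun j b =>
        (h.contDiffOn_covDerivTwo hv j a b).differentiableAt_of_isOpen h.isOpen hy) i
    have e2 : ∑ k, christoffel G k i a y * divCoord G v k y
        = ∑ j, ∑ b, (G y)⁻¹ j b * ∑ l, christoffel G l i a y * covDerivTwo G v j l b y := by
      simp only [divCoord, traceWith, Finset.mul_sum, Matrix.of_apply]
      rw [Finset.sum_comm]
      refine Finset.sum_congr rfl fun j _ => ?_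
      rw [Finset.sum_comm]
      exact Finset.sum_congr rfl fun k _ => Finset.sum_congr rfl fun b _ => by ring
    rw [e1, e2]
    simp only [traceWith, ← Finset.sum_sub_distrib, ← mul_sub]
    refine Finset.sum_congr rfl fun j _ => Finset.sum_congr rfl fun b _ => ?_
    simp only [cov, Matrix.of_apply, covDerivTwoTwo]
    rw [covDerivTwo]
    simp only [Matrix.of_apply]
    have : (fun z => covDerivTwo G v j a b z) = covDerivTwo G v j a b := rfl
    rw [this]; ring
  simp only [covectorDiv, h1, divDivCoord, Finset.mul_sum]
  refine Finset.sum_congr rfl fun i _ => ?_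
  rw [Finset.sum_comm]
  exact Finset.sum_congr rfl fun j _ => Finset.sum_congr rfl fun a _ =>
    Finset.sum_congr rfl fun b _ => by ring

end IsMetricOn

end Static

/-! ### Linearity and Leibniz rule for the divergence of covector fields -/

section CovectorDiv

variable {n : ℕ} {G : Coord n → Matrix (Fin n) (Fin n) ℝ} {y : Coord n} {u w : Fin n → Coord n → ℝ}

theorem covectorDiv_add (hu : ∀ b, DifferentiableAt ℝ (u b) y)
    (hw : ∀ b, DifferentiableAt ℝ (w b) y) :
    covectorDiv G (fun b z => u b z + w b z) y = covectorDiv G u y + covectorDiv G w y := by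
  simp only [covectorDiv, ← Finset.sum_add_distrib]
  refine Finset.sum_congr rfl fun a _ => Finset.sum_congr rfl fun b _ => ?_
  rw [pd_add (hu b) (hw b)]
  simp only [mul_add, Finset.sum_add_distrib]
  ring

theorem covectorDiv_const_mul (hu : ∀ b, DifferentiableAt ℝ (u b) y) (c : ℝ) :
    covectorDiv G (fun b z => c * u b z) y = c * covectorDiv G u y := by
  simp only [covectorDiv, Finset.mul_sum]
  refine Finset.sum_congr rfl fun a _ => Finset.sum_congr rfl fun b _ => ?_
  rw [pd_const_mul (hu b), Finset.sum_congr rfl fun k _ => mul_left_comm _ c _,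
    ← Finset.mul_sum]
  ring

theorem covectorDiv_sub (hu : ∀ b, DifferentiableAt ℝ (u b) y)
    (hw : ∀ b, DifferentiableAt ℝ (w b) y) :
    covectorDiv G (fun b z => u b z - w b z) y = covectorDiv G u y - covectorDiv G w y := by
  have := covectorDiv_add (G := G) hu fun b => (hw b).const_mul (-1)
  rw [covectorDiv_const_mul hw] at this
  simpa [sub_eq_add_neg] using this

theorem covectorDiv_mul_pd {p f : Coord n → ℝ} (hp : DifferentiableAt ℝ p y)
    (hf : ∀ b, DifferentiableAt ℝ (pd b f) y) :
    covectorDiv G (fun b z => p z * pd b f z) y = gradCoord G p f y + p y * lapCoord G f y := by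
  simp only [covectorDiv, gradCoord, lapCoord, traceWith, hessianCoord, Matrix.of_apply,
    Finset.mul_sum, ← Finset.sum_add_distrib]
  refine Finset.sum_congr rfl fun a _ => Finset.sum_congr rfl fun b _ => ?_
  rw [pd_mul hp (hf b), Finset.sum_congr rfl fun k _ => mul_left_comm _ (p y) _,
    ← Finset.mul_sum]
  ring

end CovectorDiv

/-! ### First variation in coordinates -/

section Variation

variable {n : ℕ} {O : Set (ℝ × Coord n)} {𝒢 : ℝ → Coord n → Matrix (Fin n) (Fin n) ℝ}
  {v : Coord n → Matrix (Fin n) (Fin n) ℝ} {y : Coord n} {t : ℝ}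

/-- `𝒢` is a smooth family of symmetric matrix fields with positive determinant on the open set
`O` of space-time. -/
structure IsMetricFamilyOn (𝒢 : ℝ → Coord n → Matrix (Fin n) (Fin n) ℝ)
    (O : Set (ℝ × Coord n)) : Prop where
  isOpen : IsOpen O
  contDiffOn : ∀ i j, ContDiffOn ℝ ∞ (fun q : ℝ × Coord n => 𝒢 q.1 q.2 i j) O
  symm : ∀ q ∈ O, (𝒢 q.1 q.2).transpose = 𝒢 q.1 q.2
  det_pos : ∀ q ∈ O, 0 < (𝒢 q.1 q.2).det

namespace IsMetricFamilyOn

theorem slice (h : IsMetricFamilyOn 𝒢 O) (t : ℝ) :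
    IsMetricOn (𝒢 t) {z : Coord n | (t, z) ∈ O} :=
  ⟨isOpen_slice h.isOpen t, fun i j => contDiffOn_slice (U := fun s z => 𝒢 s z i j)
    (h.contDiffOn i j) t, fun z hz => h.symm (t, z) hz, fun z hz => h.det_pos (t, z) hz⟩

theorem contDiffOn_inv (h : IsMetricFamilyOn 𝒢 O) (i j : Fin n) :
    ContDiffOn ℝ ∞ (fun q : ℝ × Coord n => (𝒢 q.1 q.2)⁻¹ i j) O :=
  contDiffOn_inv_apply h.contDiffOn (fun z hz => (h.det_pos z hz).ne') i j

theorem contDiffOn_christoffel (h : IsMetricFamilyOn 𝒢 O) (k i j : Fin n) :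
    ContDiffOn ℝ ∞ (fun q : ℝ × Coord n => christoffel (𝒢 q.1) k i j q.2) O :=
  contDiffOn_const.mul (ContDiffOn.sum fun l _ => (h.contDiffOn_inv k l).mul
    (((contDiffOn_pd_uncurry (U := fun s z => 𝒢 s z j l) h.isOpen (h.contDiffOn j l) i).add
      (contDiffOn_pd_uncurry (U := fun s z => 𝒢 s z i l) h.isOpen (h.contDiffOn i l) j)).sub
      (contDiffOn_pd_uncurry (U := fun s z => 𝒢 s z i j) h.isOpen (h.contDiffOn i j) l)))

theorem contDiffOn_ricciCoord (h : IsMetricFamilyOn 𝒢 O) (j k : Fin n) :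
    ContDiffOn ℝ ∞ (fun q : ℝ × Coord n => ricciCoord (𝒢 q.1) q.2 j k) O := by
  simp only [ricciCoord, Matrix.of_apply]
  exact ContDiffOn.sum fun i _ => ((contDiffOn_pd_uncurry (U := fun s => christoffel (𝒢 s) i j k)
      h.isOpen (h.contDiffOn_christoffel i j k) i).sub
    (contDiffOn_pd_uncurry (U := fun s => christoffel (𝒢 s) i i k)
      h.isOpen (h.contDiffOn_christoffel i i k) j)).add
    (ContDiffOn.sum fun l _ => ((h.contDiffOn_christoffel i i l).mul
      (h.contDiffOn_christoffel l j k)).sub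
      ((h.contDiffOn_christoffel i j l).mul (h.contDiffOn_christoffel l i k)))

theorem contDiffOn_scalCoord (h : IsMetricFamilyOn 𝒢 O) :
    ContDiffOn ℝ ∞ (fun q : ℝ × Coord n => scalCoord (𝒢 q.1) q.2) O :=
  contDiffOn_traceWith h.contDiffOn h.det_pos h.contDiffOn_ricciCoord

theorem contDiffOn_gradCoord (h : IsMetricFamilyOn 𝒢 O) {U W : ℝ → Coord n → ℝ}
    (hU : ContDiffOn ℝ ∞ (fun q : ℝ × Coord n => U q.1 q.2) O)
    (hW : ContDiffOn ℝ ∞ (fun q : ℝ × Coord n => W q.1 q.2) O) :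
    ContDiffOn ℝ ∞ (fun q : ℝ × Coord n => gradCoord (𝒢 q.1) (U q.1) (W q.1) q.2) O :=
  contDiffOn_traceWith h.contDiffOn h.det_pos fun i j =>
    (contDiffOn_pd_uncurry h.isOpen hU i).mul (contDiffOn_pd_uncurry h.isOpen hW j)

theorem contDiffOn_sqrt_det (h : IsMetricFamilyOn 𝒢 O) :
    ContDiffOn ℝ ∞ (fun q : ℝ × Coord n => √(𝒢 q.1 q.2).det) O :=
  (contDiffOn_det h.contDiffOn).sqrt fun z hz => (h.det_pos z hz).ne'

end IsMetricFamilyOn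

/-- The pairing with a minus sign is the contribution of δ(g⁻¹) = -g⁻¹ A' g⁻¹. Applied to Ricci it
yields -R_ij v_ij, and applied to df ⊗ df it yields -v(∇f, ∇f). -/
theorem HasMDerivAt.traceWith {A S : ℝ → Matrix (Fin n) (Fin n) ℝ}
    {A' S' : Matrix (Fin n) (Fin n) ℝ} (hA : HasMDerivAt A A' t) (hS : HasMDerivAt S S' t)
    (hdet : 0 < (A t).det) (hsymm : (A t).transpose = A t) :
    HasDerivAt (fun s => traceWith (A s) (S s))
      (traceWith (A t) S' - pairWith (A t) A' (S t)) t := by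
  simp only [traceWith_eq]
  have h1 := ((hA.inv hdet.ne').mul hS.transpose).trace
  convert h1 using 1
  rw [pairWith_eq, Matrix.transpose_nonsing_inv, hsymm, Matrix.trace_add, Matrix.neg_mul,
    Matrix.trace_neg]
  ring

/-- `v` is the velocity at time `0` of the metric family `𝒢`. -/
structure IsVelocityOn (𝒢 : ℝ → Coord n → Matrix (Fin n) (Fin n) ℝ)
    (v : Coord n → Matrix (Fin n) (Fin n) ℝ) (O : Set (ℝ × Coord n)) : Prop
    extends IsMetricFamilyOn 𝒢 O where
  hasMDerivAt : ∀ z, ((0 : ℝ), z) ∈ O → HasMDerivAt (fun s => 𝒢 s z) (v z) 0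

namespace IsVelocityOn

theorem contDiffOn_velocity (h : IsVelocityOn 𝒢 v O) (i j : Fin n) :
    ContDiffOn ℝ ∞ (fun z => v z i j) {z : Coord n | ((0 : ℝ), z) ∈ O} :=
  contDiffOn_of_hasDerivAt (U := fun s z => 𝒢 s z i j) h.isOpen (h.contDiffOn i j)
    fun z hz => h.hasMDerivAt z hz i j

theorem eventually_mem (h : IsVelocityOn 𝒢 v O) (hy : ((0 : ℝ), y) ∈ O) :
    ∀ᶠ s in 𝓝 (0 : ℝ), (s, y) ∈ O :=
  (Continuous.prodMk_left y).continuousAt.eventually (h.isOpen.mem_nhds hy)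

/-- The family is symmetric for all times near 0, and derivatives are unique. -/
theorem velocity_symm (h : IsVelocityOn 𝒢 v O) (hy : ((0 : ℝ), y) ∈ O) :
    (v y).transpose = v y :=
  (h.hasMDerivAt y hy).transpose.unique ((h.hasMDerivAt y hy).congr_of_eventuallyEq
    (by filter_upwards [h.eventually_mem hy] with s hs using h.symm (s, y) hs))

/-- The variation of a connection is a tensor. Expanding the three covariant derivatives in Γ̇, the
terms Γ^m_li v_mj and Γ^m_lj v_im cancel and -2 Γ^m_ij v_ml is left, which is what the variation of
g⁻¹ contributes. -/
theorem hasDerivAt_christoffel (h : IsVelocityOn 𝒢 v O) (hy : ((0 : ℝ), y) ∈ O)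
    (k i j : Fin n) :
    HasDerivAt (fun s => christoffel (𝒢 s) k i j y) (christoffelDot (𝒢 0) v k i j y) 0 := by
  have hm := h.slice 0
  have hpd : ∀ a b c, HasDerivAt (fun s => pd a (fun z => 𝒢 s z b c) y)
      (pd a (fun z => v z b c) y) 0 := fun a b c =>
    hasDerivAt_pd_param (U := fun s z => 𝒢 s z b c) h.isOpen (h.contDiffOn b c) hy
      (fun z hz => h.hasMDerivAt z hz b c) a
  have hinv := (h.hasMDerivAt y hy).inv (h.det_pos _ hy).ne'
  have h1 := (HasDerivAt.fun_sum (u := Finset.univ) fun l _ => (hinv k l).fun_mul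
    (((hpd i j l).fun_add (hpd j i l)).fun_sub (hpd l i j))).const_mul (1 / 2 : ℝ)
  refine h1.congr_deriv ?_
  have hvs : ∀ a b, v y a b = v y b a := fun a b => by
    conv_lhs => rw [← h.velocity_symm hy]
    rfl
  rw [christoffelDot]
  congr 1
  -- The rightmost g⁻¹ raises the index of the first-kind symbols, turning them back into 2 Γ^m_ij.
  have h2 : ∑ l, ((𝒢 0 y)⁻¹ * v y * (𝒢 0 y)⁻¹) k l * (pd i (fun z => 𝒢 0 z j l) y
      + pd j (fun z => 𝒢 0 z i l) y - pd l (fun z => 𝒢 0 z i j) y)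
      = ∑ l, (𝒢 0 y)⁻¹ k l * (2 * ∑ m, v y l m * christoffel (𝒢 0) m i j y) := by
    set c : Fin n → ℝ := fun l => pd i (fun z => 𝒢 0 z j l) y
      + pd j (fun z => 𝒢 0 z i l) y - pd l (fun z => 𝒢 0 z i j) y
    have e : ∀ m, 2 * christoffel (𝒢 0) m i j y = ((𝒢 0 y)⁻¹.mulVec c) m := fun m => by
      have : christoffel (𝒢 0) m i j y = (1 / 2 : ℝ) * ((𝒢 0 y)⁻¹.mulVec c) m := rfl
      rw [this]; ring
    calc _ = (((𝒢 0 y)⁻¹ * v y * (𝒢 0 y)⁻¹).mulVec c) k := rfl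
      _ = ((𝒢 0 y)⁻¹.mulVec ((v y).mulVec ((𝒢 0 y)⁻¹.mulVec c))) k := by
        rw [Matrix.mulVec_mulVec, Matrix.mulVec_mulVec]
      _ = ∑ l, (𝒢 0 y)⁻¹ k l * ∑ m, v y l m * ((𝒢 0 y)⁻¹.mulVec c) m := rfl
      _ = _ := by
        refine Finset.sum_congr rfl fun l _ => ?_
        congr 1
        rw [Finset.mul_sum]
        exact Finset.sum_congr rfl fun m _ => by rw [← e]; ring
  simp only [Matrix.neg_apply, neg_mul, Finset.sum_add_distrib, Finset.sum_neg_distrib]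
  rw [h2, ← Finset.sum_neg_distrib, ← Finset.sum_add_distrib]
  refine Finset.sum_congr rfl fun l _ => ?_
  simp only [covDerivTwo]
  rw [Finset.sum_congr rfl (f := fun m => christoffel (𝒢 0) m j i y * v y m l)
      (g := fun m => christoffel (𝒢 0) m i j y * v y m l)
      fun m _ => by rw [hm.christoffel_symm hy],
    Finset.sum_congr rfl (f := fun m => christoffel (𝒢 0) m l i y * v y m j)
      (g := fun m => christoffel (𝒢 0) m i l y * v y j m)
      fun m _ => by rw [hm.christoffel_symm hy, hvs],
    Finset.sum_congr rfl (f := fun m => christoffel (𝒢 0) m l j y * v y i m)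
      (g := fun m => christoffel (𝒢 0) m j l y * v y i m)
      fun m _ => by rw [hm.christoffel_symm hy],
    Finset.sum_congr rfl (f := fun m => v y l m * christoffel (𝒢 0) m i j y)
      (g := fun m => christoffel (𝒢 0) m i j y * v y m l)
      fun m _ => by rw [hvs]; ring]
  ring

/-- The first variation of the Ricci tensor,
`Ṙ_jk = ∇_i Γ̇^i_jk - ½ ∇_j ∇_k tr v`. -/
theorem hasMDerivAt_ricciCoord (h : IsVelocityOn 𝒢 v O) (hy : ((0 : ℝ), y) ∈ O) :
    HasMDerivAt (fun s => ricciCoord (𝒢 s) y) (Matrix.of fun j k =>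
      (∑ i, (covDerivTwo (𝒢 0) (fun z => Matrix.of fun a b => christoffelDot (𝒢 0) v i a b z)
        i j k y + ∑ l, christoffel (𝒢 0) i i l y * christoffelDot (𝒢 0) v l j k y))
      - (1 / 2 : ℝ) * hessianCoord (𝒢 0) (trCoord (𝒢 0) v) y j k) 0 := by
  intro j k
  have hm := h.slice 0
  have hc : ∀ a b c, HasDerivAt (fun s => christoffel (𝒢 s) a b c y)
    (christoffelDot (𝒢 0) v a b c y) 0 := h.hasDerivAt_christoffel hy
  have hpd : ∀ d a b c, HasDerivAt (fun s => pd d (christoffel (𝒢 s) a b c) y)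
      (pd d (christoffelDot (𝒢 0) v a b c) y) 0 := fun d a b c =>
    hasDerivAt_pd_param (U := fun s => christoffel (𝒢 s) a b c) h.isOpen
      (h.contDiffOn_christoffel a b c) hy (fun z hz => h.hasDerivAt_christoffel hz a b c) d
  have h1 := HasDerivAt.fun_sum (u := Finset.univ) fun i _ =>
    ((hpd i i j k).fun_sub (hpd j i i k)).fun_add
      (HasDerivAt.fun_sum (u := Finset.univ) fun l _ =>
        ((hc i i l).fun_mul (hc l j k)).fun_sub ((hc i j l).fun_mul (hc l i k)))
  refine h1.congr_deriv ?_
  -- The contracted symbol is an exact differential, ½ d(tr v). It is needed on a neighbourhood,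
  -- since it gets differentiated in `e1`; together with `e2` it produces the Hessian of tr v.
  have hsd : ∀ c z, ((0 : ℝ), z) ∈ O → ∑ i, christoffelDot (𝒢 0) v i i c z
      = (1 / 2 : ℝ) * pd c (trCoord (𝒢 0) v) z := fun c z hz =>
    hm.sum_christoffelDot hz h.contDiffOn_velocity (fun z hz => h.velocity_symm hz) c
  have e1 : ∑ i, pd j (christoffelDot (𝒢 0) v i i k) y
      = (1 / 2 : ℝ) * pd j (pd k (trCoord (𝒢 0) v)) y := by
    rw [← pd_sum fun i _ => (hm.contDiffOn_christoffelDot h.contDiffOn_velocity i i k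
      ).differentiableAt_of_isOpen hm.isOpen hy,
      pd_congr (w := fun z => (1 / 2 : ℝ) * pd k (trCoord (𝒢 0) v) z) (by
        filter_upwards [hm.mem_nhds hy] with z hz using hsd k z hz),
      pd_const_mul ((contDiffOn_pd hm.isOpen (hm.contDiffOn_trCoord h.contDiffOn_velocity) k
        ).differentiableAt_of_isOpen hm.isOpen hy)]
  have e2 : ∑ i, ∑ l, christoffelDot (𝒢 0) v i i l y * christoffel (𝒢 0) l j k y
      = (1 / 2 : ℝ) * ∑ l, christoffel (𝒢 0) l j k y * pd l (trCoord (𝒢 0) v) y := by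
    rw [Finset.sum_comm, Finset.mul_sum]
    refine Finset.sum_congr rfl fun l _ => ?_
    rw [← Finset.sum_mul, hsd l y hy]; ring
  have e3 : ∑ i, ∑ l, christoffel (𝒢 0) i j l y * christoffelDot (𝒢 0) v l i k y
      = ∑ i, ∑ l, christoffel (𝒢 0) l i j y * christoffelDot (𝒢 0) v i l k y := by
    rw [Finset.sum_comm]
    exact Finset.sum_congr rfl fun i _ => Finset.sum_congr rfl fun l _ => by
      rw [hm.christoffel_symm hy]
  have e4 : ∑ i, ∑ l, christoffelDot (𝒢 0) v i j l y * christoffel (𝒢 0) l i k y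
      = ∑ i, ∑ l, christoffel (𝒢 0) l i k y * christoffelDot (𝒢 0) v i j l y :=
    Finset.sum_congr rfl fun i _ => Finset.sum_congr rfl fun l _ => mul_comm _ _
  simp only [covDerivTwo, hessianCoord, Matrix.of_apply, Finset.sum_add_distrib,
    Finset.sum_sub_distrib]
  rw [e1, e2, e3, e4]
  have : ∀ i, (fun z => christoffelDot (𝒢 0) v i j k z) = christoffelDot (𝒢 0) v i j k :=
    fun _ => rfl
  simp only [this]
  ring

/-- Tracing over j, k turns ∇_i Γ̇^i_jk into the divergence of the vector dual to w = div v - ½ d(tr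
v). This gives ∇∇v - ½ Δ tr v, and the Hessian term gives the other half of the Laplacian. -/
theorem traceWith_ricciDot (h : IsVelocityOn 𝒢 v O) (hy : ((0 : ℝ), y) ∈ O) :
    traceWith (𝒢 0 y) (Matrix.of fun j k =>
      (∑ i, (covDerivTwo (𝒢 0) (fun z => Matrix.of fun a b => christoffelDot (𝒢 0) v i a b z)
        i j k y + ∑ l, christoffel (𝒢 0) i i l y * christoffelDot (𝒢 0) v l j k y))
      - (1 / 2 : ℝ) * hessianCoord (𝒢 0) (trCoord (𝒢 0) v) y j k)
    = divDivCoord (𝒢 0) v y - lapCoord (𝒢 0) (trCoord (𝒢 0) v) y := by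
  have hm := h.slice 0
  have hv := h.contDiffOn_velocity
  have hvs : ∀ z ∈ {z : Coord n | ((0 : ℝ), z) ∈ O}, (v z).transpose = v z :=
    fun z hz => h.velocity_symm hz
  set w : Fin n → Coord n → ℝ := fun l z =>
    divCoord (𝒢 0) v l z - (1 / 2 : ℝ) * pd l (trCoord (𝒢 0) v) z with hw
  have hdiv : ∀ l, DifferentiableAt ℝ (divCoord (𝒢 0) v l) y := fun l =>
    (hm.contDiffOn_divCoord hv l).differentiableAt_of_isOpen hm.isOpen hy
  have hptr : ∀ l, DifferentiableAt ℝ (pd l (trCoord (𝒢 0) v)) y := fun l =>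
    (contDiffOn_pd hm.isOpen (hm.contDiffOn_trCoord hv) l).differentiableAt_of_isOpen
      hm.isOpen hy
  -- For fixed upper index i, Γ̇^i is differentiated as a 2-tensor and the trace commutes with this.
  -- The connection term of the upper index is treated in `h2`.
  have h1 : ∀ i, ∑ j, ∑ k, (𝒢 0 y)⁻¹ j k * covDerivTwo (𝒢 0)
      (fun z => Matrix.of fun a b => christoffelDot (𝒢 0) v i a b z) i j k y
      = pd i (fun z => ∑ l, (𝒢 0 z)⁻¹ i l * w l z) y := by
    intro i
    have := hm.pd_traceWith hy (S := fun z => Matrix.of fun a b => christoffelDot (𝒢 0) v i a b z)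
      (fun a b => (hm.contDiffOn_christoffelDot hv i a b).differentiableAt_of_isOpen hm.isOpen hy)
      i
    rw [pd_congr (w := fun z => ∑ l, (𝒢 0 z)⁻¹ i l * w l z) (by
      filter_upwards [hm.mem_nhds hy] with z hz
        using hm.traceWith_christoffelDot hz hv hvs i)] at this
    rw [this]
    rfl
  have h2 : ∑ i, (gam (𝒢 0) i y).trace * ∑ b, (𝒢 0 y)⁻¹ i b * w b y
      = ∑ j, ∑ k, (𝒢 0 y)⁻¹ j k *
        ∑ i, ∑ l, christoffel (𝒢 0) i i l y * christoffelDot (𝒢 0) v l j k y := by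
    have : ∀ l, ∑ b, (𝒢 0 y)⁻¹ l b * w b y
        = ∑ j, ∑ k, (𝒢 0 y)⁻¹ j k * christoffelDot (𝒢 0) v l j k y := fun l =>
      (hm.traceWith_christoffelDot hy hv hvs l).symm
    have e5 : ∀ j k, ∑ i, ∑ l, christoffel (𝒢 0) i i l y * christoffelDot (𝒢 0) v l j k y
        = ∑ l, (gam (𝒢 0) l y).trace * christoffelDot (𝒢 0) v l j k y := fun j k => by
      rw [Finset.sum_comm]
      exact Finset.sum_congr rfl fun l _ => by rw [← Finset.sum_mul, hm.sum_christoffel hy]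
    simp only [this, e5, Finset.mul_sum]
    rw [Finset.sum_comm]
    refine Finset.sum_congr rfl fun j _ => ?_
    rw [Finset.sum_comm]
    exact Finset.sum_congr rfl fun k _ => Finset.sum_congr rfl fun l _ => by ring
  have h3 := hm.sum_pd_raise hy (w := w) fun b => (hdiv b).fun_sub ((hptr b).const_mul _)
  have h4 : covectorDiv (𝒢 0) w y
      = divDivCoord (𝒢 0) v y - (1 / 2 : ℝ) * lapCoord (𝒢 0) (trCoord (𝒢 0) v) y := by
    rw [hw, covectorDiv_sub hdiv fun b => (hptr b).const_mul _,
      covectorDiv_const_mul hptr, hm.covectorDiv_divCoord hy hv]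
    rfl
  rw [← covectorDiv, h4, Finset.sum_add_distrib, h2, ← Finset.sum_congr rfl fun i _ => h1 i,
    Finset.sum_comm, Finset.sum_congr rfl fun j _ => Finset.sum_comm] at h3
  simp only [traceWith, Matrix.of_apply, mul_sub, mul_add, Finset.sum_add_distrib,
    Finset.sum_sub_distrib, lapCoord] at h3 ⊢
  simp only [← Finset.mul_sum, mul_left_comm _ (1 / 2 : ℝ)] at h3 ⊢
  linarith

/-- The first variation of the scalar curvature in coordinates. -/
theorem hasDerivAt_scalCoord (h : IsVelocityOn 𝒢 v O) (hy : ((0 : ℝ), y) ∈ O) :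
    HasDerivAt (fun s => scalCoord (𝒢 s) y) (-lapCoord (𝒢 0) (trCoord (𝒢 0) v) y
      + divDivCoord (𝒢 0) v y - pairWith (𝒢 0 y) (v y) (ricciCoord (𝒢 0) y)) 0 := by
  have h1 := (h.hasMDerivAt y hy).traceWith (h.hasMDerivAt_ricciCoord hy) (h.det_pos _ hy)
    (h.symm _ hy)
  refine h1.congr_deriv ?_
  rw [h.traceWith_ricciDot hy]
  ring

end IsVelocityOn

end Variation

/-! ### First variation of the energy density modulo a divergence -/

section Energy

variable {n : ℕ} {Ω : Set (Coord n)} {O : Set (ℝ × Coord n)}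
  {G : Coord n → Matrix (Fin n) (Fin n) ℝ} {𝒢 : ℝ → Coord n → Matrix (Fin n) (Fin n) ℝ}
  {v : Coord n → Matrix (Fin n) (Fin n) ℝ} {f h : Coord n → ℝ} {y : Coord n}

/-- The integrand `(R + |∇f|²) e^{-f}` in coordinates. -/
noncomputable def energyCoord (G : Coord n → Matrix (Fin n) (Fin n) ℝ) (f : Coord n → ℝ)
    (y : Coord n) : ℝ :=
  (scalCoord G y + gradCoord G f f y) * Real.exp (-f y)

/-- The first variation density in coordinates. -/
noncomputable def variationCoord (G : Coord n → Matrix (Fin n) (Fin n) ℝ) (f : Coord n → ℝ)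
    (v : Coord n → Matrix (Fin n) (Fin n) ℝ) (h : Coord n → ℝ) (y : Coord n) : ℝ :=
  Real.exp (-f y) * (-pairWith (G y) (v y) (ricciCoord G y + hessianCoord G f y)
    + (trCoord G v y / 2 - h y) * (2 * lapCoord G f y - gradCoord G f f y + scalCoord G y))

/-- The covector `v_bj g^jk ∂_k f`. -/
noncomputable def contractCoord (G v : Coord n → Matrix (Fin n) (Fin n) ℝ) (f : Coord n → ℝ)
    (b : Fin n) (y : Coord n) : ℝ :=
  traceWith (G y) (Matrix.of fun j k => v y b j * pd k f y)

/-- The covector field whose weighted divergence is the difference between the variation of the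
energy density and the first variation density. -/
noncomputable def fluxCoord (G : Coord n → Matrix (Fin n) (Fin n) ℝ) (f : Coord n → ℝ)
    (v : Coord n → Matrix (Fin n) (Fin n) ℝ) (h : Coord n → ℝ) (b : Fin n) (y : Coord n) : ℝ :=
  divCoord G v b y - pd b (trCoord G v) y + contractCoord G v f b y
    + (2 * h y - trCoord G v y) * pd b f y

namespace IsMetricOn

theorem contDiffOn_contractCoord (hm : IsMetricOn G Ω)
    (hv : ∀ i j, ContDiffOn ℝ ∞ (fun z => v z i j) Ω) (hf : ContDiffOn ℝ ∞ f Ω) (b : Fin n) :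
    ContDiffOn ℝ ∞ (contractCoord G v f b) Ω :=
  contDiffOn_traceWith hm.contDiffOn hm.det_pos fun j k =>
    (hv b j).mul (contDiffOn_pd hm.isOpen hf k)

theorem contDiffOn_fluxCoord (hm : IsMetricOn G Ω)
    (hv : ∀ i j, ContDiffOn ℝ ∞ (fun z => v z i j) Ω) (hf : ContDiffOn ℝ ∞ f Ω)
    (hh : ContDiffOn ℝ ∞ h Ω) (b : Fin n) : ContDiffOn ℝ ∞ (fluxCoord G f v h b) Ω :=
  (((hm.contDiffOn_divCoord hv b).sub (contDiffOn_pd hm.isOpen (hm.contDiffOn_trCoord hv) b)).add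
    (hm.contDiffOn_contractCoord hv hf b)).add
    (((contDiffOn_const.mul hh).sub (hm.contDiffOn_trCoord hv)).mul
      (contDiffOn_pd hm.isOpen hf b))

theorem sum_contract_eq_pairWith (hm : IsMetricOn G Ω) (hy : y ∈ Ω)
    (A B : Matrix (Fin n) (Fin n) ℝ) :
    ∑ a, ∑ b, (G y)⁻¹ a b * ∑ j, ∑ k, (G y)⁻¹ j k * (A b j * B a k) = pairWith (G y) A B := by
  simp only [pairWith, Finset.mul_sum]
  rw [Finset.sum_comm]
  refine Finset.sum_congr rfl fun b _ => ?_
  rw [Finset.sum_comm]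
  exact Finset.sum_congr rfl fun j _ => Finset.sum_congr rfl fun a _ =>
    Finset.sum_congr rfl fun k _ => by rw [hm.inv_symm_apply hy b a]; ring

/-- Leibniz rule for the covector v(∇f, ·). Symmetry of v identifies the contraction of ∇v that
appears with div v. -/
theorem covectorDiv_contractCoord (hm : IsMetricOn G Ω) (hy : y ∈ Ω)
    (hv : ∀ i j, ContDiffOn ℝ ∞ (fun z => v z i j) Ω)
    (hvs : ∀ z ∈ Ω, (v z).transpose = v z) (hf : ContDiffOn ℝ ∞ f Ω) :
    covectorDiv G (contractCoord G v f) y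
      = ∑ a, ∑ b, (G y)⁻¹ a b * (pd a f y * divCoord G v b y)
        + pairWith (G y) (v y) (hessianCoord G f y) := by
  have hvd : ∀ i j, DifferentiableAt ℝ (fun z => v z i j) y := fun i j =>
    (hv i j).differentiableAt_of_isOpen hm.isOpen hy
  have hfd : ∀ k, DifferentiableAt ℝ (pd k f) y := fun k =>
    (contDiffOn_pd hm.isOpen hf k).differentiableAt_of_isOpen hm.isOpen hy
  have h1 : ∀ a b, pd a (contractCoord G v f b) y
      - ∑ l, christoffel G l a b y * contractCoord G v f l y
      = ∑ j, ∑ k, (G y)⁻¹ j k * (covDerivTwo G v a b j y * pd k f y)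
        + ∑ j, ∑ k, (G y)⁻¹ j k * (v y b j * hessianCoord G f y a k) := by
    intro a b
    have e1 : pd a (contractCoord G v f b) y
        = traceWith (G y) (cov G (fun z => Matrix.of fun j k => v z b j * pd k f z) a y) :=
      hm.pd_traceWith hy (fun j k => (hvd b j).fun_mul (hfd k)) a
    have e2 : ∑ l, christoffel G l a b y * contractCoord G v f l y
        = ∑ j, ∑ k, (G y)⁻¹ j k * ((∑ l, christoffel G l a b y * v y l j) * pd k f y) := by
      simp only [contractCoord, traceWith, Finset.mul_sum, Finset.sum_mul, Matrix.of_apply]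
      rw [Finset.sum_comm]
      refine Finset.sum_congr rfl fun j _ => ?_
      rw [Finset.sum_comm]
      exact Finset.sum_congr rfl fun k _ => Finset.sum_congr rfl fun b _ => by ring
    rw [e1, e2]
    simp only [traceWith, ← Finset.sum_sub_distrib, ← Finset.sum_add_distrib, ← mul_sub,
      ← mul_add]
    refine Finset.sum_congr rfl fun j _ => Finset.sum_congr rfl fun k _ => ?_
    simp only [cov, Matrix.of_apply, covDerivTwo, hessianCoord]
    rw [pd_mul (hvd b j) (hfd k), Finset.sum_congr rfl fun l _ => (mul_assoc _ (v y b l) _).symm,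
      ← Finset.sum_mul, Finset.sum_congr rfl (f := fun l => christoffel G l a k y * _)
        fun l _ => mul_left_comm _ (v y b j) _, ← Finset.mul_sum]
    ring
  simp only [covectorDiv, h1, mul_add, Finset.sum_add_distrib]
  rw [hm.sum_contract_eq_pairWith hy]
  congr 1
  have e3 : ∀ b, divCoord G v b y = ∑ i, ∑ j, (G y)⁻¹ i j * covDerivTwo G v i j b y := fun b => by
    simp only [divCoord, traceWith, Matrix.of_apply]
    exact Finset.sum_congr rfl fun i _ => Finset.sum_congr rfl fun j _ => by
      rw [hm.covDerivTwo_symm hy hvs]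
  simp only [e3, Finset.mul_sum]
  rw [sum_comm_four, Finset.sum_comm]
  refine Finset.sum_congr rfl fun k _ => Finset.sum_congr rfl fun j _ =>
    Finset.sum_congr rfl fun a _ => Finset.sum_congr rfl fun b _ => ?_
  rw [hm.inv_symm_apply hy j k]
  ring

theorem gradCoord_comm (hm : IsMetricOn G Ω) (hy : y ∈ Ω) (u w : Coord n → ℝ) :
    gradCoord G u w y = gradCoord G w u y := by
  simp only [gradCoord]
  rw [← hm.traceWith_transpose hy]
  congr 1
  ext i j
  simp [mul_comm]

theorem gradCoord_two_mul_sub {p q : Coord n → ℝ} (hp : DifferentiableAt ℝ p y)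
    (hq : DifferentiableAt ℝ q y) :
    gradCoord G (fun z => 2 * p z - q z) f y = 2 * gradCoord G p f y - gradCoord G q f y := by
  simp only [gradCoord, traceWith, Finset.mul_sum, ← Finset.sum_sub_distrib, Matrix.of_apply]
  refine Finset.sum_congr rfl fun i _ => Finset.sum_congr rfl fun j _ => ?_
  rw [pd_sub (hp.const_mul 2) hq, pd_const_mul hp]
  ring

/-- The left side is the divergence of e^{-f} w divided by e^{-f}. The pieces of w are balanced so
that the cross terms ⟨∇f, div v⟩ and ⟨∇f, ∇ tr v⟩ from the weight cancel those from the Leibniz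
rule. -/
theorem covectorDiv_fluxCoord (hm : IsMetricOn G Ω) (hy : y ∈ Ω)
    (hv : ∀ i j, ContDiffOn ℝ ∞ (fun z => v z i j) Ω)
    (hvs : ∀ z ∈ Ω, (v z).transpose = v z) (hf : ContDiffOn ℝ ∞ f Ω)
    (hh : ContDiffOn ℝ ∞ h Ω) :
    covectorDiv G (fluxCoord G f v h) y
      - ∑ a, ∑ b, (G y)⁻¹ a b * (pd a f y * fluxCoord G f v h b y)
      = -lapCoord G (trCoord G v) y + divDivCoord G v y
        + pairWith (G y) (v y) (hessianCoord G f y)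
        - pairWith (G y) (v y) (Matrix.of fun i j => pd i f y * pd j f y)
        + 2 * gradCoord G h f y
        + (2 * h y - trCoord G v y) * (lapCoord G f y - gradCoord G f f y) := by
  have hd : ∀ {u : Coord n → ℝ}, ContDiffOn ℝ ∞ u Ω → DifferentiableAt ℝ u y := fun hu =>
    hu.differentiableAt_of_isOpen hm.isOpen hy
  have d1 := fun b => hd (hm.contDiffOn_divCoord hv b)
  have d2 := fun b => hd (contDiffOn_pd hm.isOpen (hm.contDiffOn_trCoord hv) b)
  have d3 := fun b => hd (hm.contDiffOn_contractCoord hv hf b)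
  have d4 := fun b => hd (contDiffOn_pd hm.isOpen hf b)
  have d5 : DifferentiableAt ℝ (fun z => 2 * h z - trCoord G v z) y :=
    ((hd hh).const_mul 2).fun_sub (hd (hm.contDiffOn_trCoord hv))
  have e1 : covectorDiv G (fluxCoord G f v h) y
      = divDivCoord G v y - lapCoord G (trCoord G v) y + covectorDiv G (contractCoord G v f) y
        + (gradCoord G (fun z => 2 * h z - trCoord G v z) f y
          + (2 * h y - trCoord G v y) * lapCoord G f y) := by
    have : fluxCoord G f v h = fun b z => (((divCoord G v b z - pd b (trCoord G v) z)
        + contractCoord G v f b z) + (2 * h z - trCoord G v z) * pd b f z) := rfl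
    rw [this, covectorDiv_add (fun b => ((d1 b).fun_sub (d2 b)).fun_add (d3 b))
      (fun b => d5.fun_mul (d4 b)), covectorDiv_add (fun b => (d1 b).fun_sub (d2 b)) d3,
      covectorDiv_sub d1 d2, hm.covectorDiv_divCoord hy hv,
      covectorDiv_mul_pd d5 d4]
    rfl
  have e2 : ∑ a, ∑ b, (G y)⁻¹ a b * (pd a f y * fluxCoord G f v h b y)
      = ∑ a, ∑ b, (G y)⁻¹ a b * (pd a f y * divCoord G v b y) - gradCoord G f (trCoord G v) y
        + pairWith (G y) (v y) (Matrix.of fun i j => pd i f y * pd j f y)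
        + (2 * h y - trCoord G v y) * gradCoord G f f y := by
    have e3 : pairWith (G y) (v y) (Matrix.of fun i j => pd i f y * pd j f y)
        = ∑ a, ∑ b, (G y)⁻¹ a b * (pd a f y * contractCoord G v f b y) := by
      rw [← hm.sum_contract_eq_pairWith hy]
      refine Finset.sum_congr rfl fun a _ => Finset.sum_congr rfl fun b _ => ?_
      simp only [contractCoord, traceWith, Matrix.of_apply, Finset.mul_sum]
      exact Finset.sum_congr rfl fun j _ => Finset.sum_congr rfl fun k _ => by ring
    rw [e3]
    simp only [fluxCoord, gradCoord, traceWith, Matrix.of_apply, Finset.mul_sum,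
      ← Finset.sum_sub_distrib, ← Finset.sum_add_distrib]
    exact Finset.sum_congr rfl fun a _ => Finset.sum_congr rfl fun b _ => by ring
  rw [e1, e2, hm.covectorDiv_contractCoord hy hv hvs hf,
    gradCoord_two_mul_sub (hd hh) (hd (hm.contDiffOn_trCoord hv)),
    hm.gradCoord_comm hy f (trCoord G v)]
  ring

end IsMetricOn

namespace IsVelocityOn

/-- The first variation of the energy density with respect to the coordinate measure, up to a
divergence. -/
theorem hasDerivAt_energyCoord (hm : IsVelocityOn 𝒢 v O) (hy : ((0 : ℝ), y) ∈ O)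
    {ℱ : ℝ → Coord n → ℝ} (hF : ContDiffOn ℝ ∞ (fun q : ℝ × Coord n => ℱ q.1 q.2) O)
    (hFh : ∀ z, ((0 : ℝ), z) ∈ O → HasDerivAt (fun s => ℱ s z) (h z) 0) :
    HasDerivAt (fun s => energyCoord (𝒢 s) (ℱ s) y * √(𝒢 s y).det)
      (variationCoord (𝒢 0) (ℱ 0) v h y * √(𝒢 0 y).det
        + ∑ i, pd i (fun z => √(𝒢 0 z).det * (Real.exp (-ℱ 0 z) *
          ∑ b, (𝒢 0 z)⁻¹ i b * fluxCoord (𝒢 0) (ℱ 0) v h b z)) y) 0 := by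
  have h0 := hm.slice 0
  have hv := hm.contDiffOn_velocity
  have hvs : ∀ z ∈ {z : Coord n | ((0 : ℝ), z) ∈ O}, (v z).transpose = v z :=
    fun z hz => hm.velocity_symm hz
  have hf := contDiffOn_slice hF 0
  have hh := contDiffOn_of_hasDerivAt hm.isOpen hF hFh
  have hFi : ∀ i, HasDerivAt (fun s => pd i (ℱ s) y) (pd i h y) 0 :=
    hasDerivAt_pd_param hm.isOpen hF hy hFh
  have hgrad : HasDerivAt (fun s => gradCoord (𝒢 s) (ℱ s) (ℱ s) y)
      (2 * gradCoord (𝒢 0) h (ℱ 0) y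
        - pairWith (𝒢 0 y) (v y) (Matrix.of fun i j => pd i (ℱ 0) y * pd j (ℱ 0) y)) 0 := by
    have h1 := (hm.hasMDerivAt y hy).traceWith (S := fun s => Matrix.of fun i j =>
      pd i (ℱ s) y * pd j (ℱ s) y) (S' := Matrix.of fun i j =>
      pd i h y * pd j (ℱ 0) y + pd i (ℱ 0) y * pd j h y)
      (fun i j => (hFi i).fun_mul (hFi j)) (hm.det_pos _ hy) (hm.symm _ hy)
    refine h1.congr_deriv ?_
    congr 1
    have : (Matrix.of fun i j => pd i h y * pd j (ℱ 0) y + pd i (ℱ 0) y * pd j h y)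
        = (Matrix.of fun i j => pd i h y * pd j (ℱ 0) y)
          + Matrix.of fun i j => pd i (ℱ 0) y * pd j h y := rfl
    rw [this, traceWith_add]
    change gradCoord (𝒢 0) h (ℱ 0) y + gradCoord (𝒢 0) (ℱ 0) h y = _
    rw [h0.gradCoord_comm hy (ℱ 0) h]
    ring
  have hexp := (hFh y hy).fun_neg.exp
  have hdet := (hm.hasMDerivAt y hy).sqrt_det (hm.det_pos _ hy)
  have htr : ((𝒢 0 y)⁻¹ * v y).trace = trCoord (𝒢 0) v y := by
    rw [trCoord, traceWith_eq, hm.velocity_symm hy]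
  have h2 := (((hm.hasDerivAt_scalCoord hy).fun_add hgrad).fun_mul hexp).fun_mul hdet
  refine h2.congr_deriv ?_
  -- The divergence contributes (2h - tr v)(Δf - |∇f|²). Added to (½ tr v - h)(2Δf - |∇f|² + R), it
  -- leaves (½ tr v - h)(R + |∇f|²), the variation of e^{-f} √det g.
  rw [h0.sum_pd_weighted hy
    (fun b => (h0.contDiffOn_fluxCoord hv hf hh b).differentiableAt_of_isOpen h0.isOpen hy)
    (hf.differentiableAt_of_isOpen h0.isOpen hy), ← covectorDiv,
    h0.covectorDiv_fluxCoord hy hv hvs hf hh, htr, variationCoord, pairWith_add_right]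
  ring

end IsVelocityOn

end Energy

/-! ### Change of coordinates -/

section Jacobian

variable {n : ℕ} {Φ : Coord n → Coord n} {y : Coord n}

/-- The Jacobian matrix `∂_i Φ^a`. -/
noncomputable def jac (Φ : Coord n → Coord n) (y : Coord n) : Matrix (Fin n) (Fin n) ℝ :=
  Matrix.of fun a i => pd i (fun z => Φ z a) y

theorem sum_smul_single (w : Coord n) :
    ∑ a, w a • EuclideanSpace.single a (1 : ℝ) = w := by
  ext b
  simp [Finset.sum_apply, Pi.single_apply]

theorem jac_apply (hΦ : DifferentiableAt ℝ Φ y) (a i : Fin n) :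
    jac Φ y a i = fderiv ℝ Φ y (EuclideanSpace.single i 1) a := by
  have h := (EuclideanSpace.proj (𝕜 := ℝ) a).hasFDerivAt.comp y
    hΦ.hasFDerivAt
  have h' : HasFDerivAt (fun z => Φ z a) _ y := h
  simp only [jac, Matrix.of_apply, pd]
  rw [h'.fderiv]
  rfl

theorem fderiv_single_eq_sum (hΦ : DifferentiableAt ℝ Φ y) (i : Fin n) :
    fderiv ℝ Φ y (EuclideanSpace.single i 1)
      = ∑ a, jac Φ y a i • EuclideanSpace.single a (1 : ℝ) := by
  rw [← sum_smul_single (fderiv ℝ Φ y (EuclideanSpace.single i 1))]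
  exact Finset.sum_congr rfl fun a _ => by rw [jac_apply hΦ]

theorem pd_comp {u : Coord n → ℝ} (hu : DifferentiableAt ℝ u (Φ y))
    (hΦ : DifferentiableAt ℝ Φ y) (i : Fin n) :
    pd i (fun z => u (Φ z)) y = ∑ a, jac Φ y a i * pd a u (Φ y) := by
  have h : HasFDerivAt (fun z => u (Φ z)) _ y := hu.hasFDerivAt.comp y hΦ.hasFDerivAt
  rw [pd, h.fderiv, ContinuousLinearMap.comp_apply, fderiv_single_eq_sum hΦ, map_sum]
  exact Finset.sum_congr rfl fun a _ => by rw [map_smul, smul_eq_mul, pd]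

theorem mpd_comp {S : Coord n → Matrix (Fin n) (Fin n) ℝ}
    (hS : ∀ a b, DifferentiableAt ℝ (fun z => S z a b) (Φ y))
    (hΦ : DifferentiableAt ℝ Φ y) (i : Fin n) :
    mpd i (fun z => S (Φ z)) y = ∑ a, jac Φ y a i • mpd a S (Φ y) := by
  ext b c
  simp only [mpd, Matrix.of_apply, Matrix.sum_apply, Matrix.smul_apply, smul_eq_mul]
  exact pd_comp (hS b c) hΦ i

theorem contDiffOn_jac {Ω : Set (Coord n)} (hΩ : IsOpen Ω) (hΦ : ContDiffOn ℝ ∞ Φ Ω)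
    (a i : Fin n) : ContDiffOn ℝ ∞ (fun z => jac Φ z a i) Ω := by
  have : ContDiffOn ℝ ∞ (fun z => Φ z a) Ω :=
    (EuclideanSpace.proj (𝕜 := ℝ) a).contDiff.comp_contDiffOn hΦ
  exact contDiffOn_pd hΩ this i

theorem traceWith_congruence {J g A : Matrix (Fin n) (Fin n) ℝ} (hJ : IsUnit J.det) :
    traceWith (J.transpose * g * J) (J.transpose * A * J) = traceWith g A := by
  have hJ' : IsUnit J.transpose.det := by rwa [Matrix.det_transpose]
  simp only [traceWith_eq, Matrix.mul_inv_rev, Matrix.transpose_mul, Matrix.transpose_transpose]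
  rw [Matrix.mul_assoc, Matrix.trace_mul_comm]
  simp only [Matrix.mul_assoc]
  rw [Matrix.mul_nonsing_inv _ hJ, Matrix.mul_one, Matrix.nonsing_inv_mul_cancel_left _ _ hJ']

theorem pairWith_congruence {J g A B : Matrix (Fin n) (Fin n) ℝ} (hJ : IsUnit J.det) :
    pairWith (J.transpose * g * J) (J.transpose * A * J) (J.transpose * B * J)
      = pairWith g A B := by
  have hJ' : IsUnit J.transpose.det := by rwa [Matrix.det_transpose]
  simp only [pairWith_eq, Matrix.mul_inv_rev, Matrix.transpose_mul, Matrix.transpose_transpose,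
    Matrix.transpose_nonsing_inv]
  simp only [Matrix.mul_assoc]
  rw [Matrix.trace_mul_comm]
  simp only [Matrix.mul_assoc]
  rw [Matrix.nonsing_inv_mul_cancel_left _ _ hJ', Matrix.mul_nonsing_inv_cancel_left _ _ hJ,
    Matrix.nonsing_inv_mul_cancel_left _ _ hJ', Matrix.mul_nonsing_inv _ hJ, Matrix.mul_one]

end Jacobian

/-! ### Uniqueness of the Levi-Civita connection -/

section Uniqueness

variable {n : ℕ} {Ω : Set (Coord n)} {G : Coord n → Matrix (Fin n) (Fin n) ℝ} {y : Coord n}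

/-- The Levi-Civita connection is the only torsion-free metric connection. -/
theorem IsMetricOn.gam_unique (h : IsMetricOn G Ω) (hy : y ∈ Ω)
    {C : Fin n → Matrix (Fin n) (Fin n) ℝ} (hsymm : ∀ i j k, C i k j = C j k i)
    (hcompat : ∀ i, mpd i G y = (C i).transpose * G y + G y * C i) (i : Fin n) :
    C i = gam G i y := by
  have hB : ∀ i j m, (G y * C i) m j = (G y * C j) m i := fun i j m => by
    simp only [Matrix.mul_apply]
    exact Finset.sum_congr rfl fun k _ => by rw [hsymm]
  have hT : ∀ i, (C i).transpose * G y = (G y * C i).transpose := fun i => by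
    rw [Matrix.transpose_mul, h.symm y hy]
  have hpd : ∀ i j m, pd i (fun z => G z j m) y = (G y * C i) m j + (G y * C i) j m := by
    intro i j m
    have := congrFun (congrFun (hcompat i) j) m
    rw [hT] at this
    exact this
  -- Koszul's argument: the combination of three compatibility equations in the first-kind symbol
  -- isolates g C_i once torsion-freeness identifies the other terms in pairs.
  have key : G y * C i = G y * gam G i y := by
    ext m j
    have h1 : (G y * gam G i y) m j = ∑ k, G y m k * christoffel G k i j y := rfl
    rw [h1, h.sum_mul_christoffel hy, hpd, hpd, hpd, hB i m j, hB j m i, hB j i m]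
    ring
  have h2 := congrArg (fun X => (G y)⁻¹ * X) key
  simpa only [← Matrix.mul_assoc, inv_mul_of_det_pos (h.det_pos y hy), Matrix.one_mul] using h2

end Uniqueness

/-! ### Pullback of the connection under a coordinate change -/

section Isometry

variable {n : ℕ} {Ω Ω' : Set (Coord n)} {G G' v v' : Coord n → Matrix (Fin n) (Fin n) ℝ}
  {Φ : Coord n → Coord n} {y : Coord n} {f f' h h' : Coord n → ℝ}

/-- The smooth map `Φ` pulls the metric `G` on `Ω` back to the metric `G'` on `Ω'`. -/
structure IsPullbackOn (Φ : Coord n → Coord n) (G' : Coord n → Matrix (Fin n) (Fin n) ℝ)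
    (Ω' : Set (Coord n)) (G : Coord n → Matrix (Fin n) (Fin n) ℝ) (Ω : Set (Coord n)) :
    Prop where
  source : IsMetricOn G' Ω'
  target : IsMetricOn G Ω
  mapsTo : MapsTo Φ Ω' Ω
  contDiffOn : ContDiffOn ℝ ∞ Φ Ω'
  eq : ∀ z ∈ Ω', G' z = (jac Φ z).transpose * G (Φ z) * jac Φ z

/-- The curvature matrix `∂_i Γ_j - ∂_j Γ_i + [Γ_i, Γ_j]`. -/
noncomputable def curv (G : Coord n → Matrix (Fin n) (Fin n) ℝ) (i j : Fin n) (y : Coord n) :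
    Matrix (Fin n) (Fin n) ℝ :=
  mpd i (gam G j) y + gam G i y * gam G j y - (mpd j (gam G i) y + gam G j y * gam G i y)

/-- Writes Ricci as a contraction of curvature matrices, so that its tensoriality can be read off
from how those matrices change under the Jacobian. -/
theorem ricciCoord_apply (G : Coord n → Matrix (Fin n) (Fin n) ℝ) (y : Coord n) (j k : Fin n) :
    ricciCoord G y j k = ∑ i, curv G i j y i k := by
  simp only [ricciCoord, Matrix.of_apply, curv, Matrix.sub_apply, Matrix.add_apply, mpd,
    Matrix.mul_apply]
  refine Finset.sum_congr rfl fun i _ => ?_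
  rw [Finset.sum_sub_distrib]
  simp only [gam, Matrix.of_apply]
  have : ∀ a b c, (fun z => christoffel G a b c z) = christoffel G a b c := fun _ _ _ => rfl
  simp only [this]
  ring

namespace IsPullbackOn

theorem differentiableAt (hp : IsPullbackOn Φ G' Ω' G Ω) (hy : y ∈ Ω') :
    DifferentiableAt ℝ Φ y :=
  (hp.contDiffOn.contDiffAt (hp.source.mem_nhds hy)).differentiableAt (by simp)

/-- A degenerate Jacobian would make the pulled-back metric degenerate. -/
theorem isUnit_det (hp : IsPullbackOn Φ G' Ω' G Ω) (hy : y ∈ Ω') : IsUnit (jac Φ y).det := by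
  have h1 := hp.source.det_pos y hy
  rw [hp.eq y hy, Matrix.det_mul] at h1
  exact isUnit_iff_ne_zero.2 fun h0 => by simp [h0] at h1

theorem differentiableAt_jac (hp : IsPullbackOn Φ G' Ω' G Ω) (hy : y ∈ Ω') (a i : Fin n) :
    DifferentiableAt ℝ (fun z => jac Φ z a i) y :=
  (contDiffOn_jac hp.source.isOpen hp.contDiffOn a i).differentiableAt_of_isOpen
    hp.source.isOpen hy

theorem contDiffOn_apply (hp : IsPullbackOn Φ G' Ω' G Ω) (a : Fin n) :
    ContDiffOn ℝ ∞ (fun z => Φ z a) Ω' :=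
  (EuclideanSpace.proj (𝕜 := ℝ) a).contDiff.comp_contDiffOn
    hp.contDiffOn

theorem mpd_jac_symm (hp : IsPullbackOn Φ G' Ω' G Ω) (hy : y ∈ Ω') (i j a : Fin n) :
    mpd i (jac Φ) y a j = mpd j (jac Φ) y a i :=
  pd_comm hp.source.isOpen (hp.contDiffOn_apply a) hy i j

/-- The pulled back connection matrix. -/
noncomputable def pullGam (Φ : Coord n → Coord n) (G : Coord n → Matrix (Fin n) (Fin n) ℝ)
    (i : Fin n) (y : Coord n) : Matrix (Fin n) (Fin n) ℝ :=
  ∑ a, jac Φ y a i • gam G a (Φ y)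

theorem mpd_comp' (hp : IsPullbackOn Φ G' Ω' G Ω) (hy : y ∈ Ω')
    {S : Coord n → Matrix (Fin n) (Fin n) ℝ} (hS : ∀ a b, ContDiffOn ℝ ∞ (fun z => S z a b) Ω)
    (i : Fin n) : mpd i (fun z => S (Φ z)) y = ∑ a, jac Φ y a i • mpd a S (Φ y) :=
  mpd_comp (fun a b => (hS a b).differentiableAt_of_isOpen hp.target.isOpen (hp.mapsTo hy))
    (hp.differentiableAt hy) i

theorem contDiffOn_comp (hp : IsPullbackOn Φ G' Ω' G Ω) {u : Coord n → ℝ}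
    (hu : ContDiffOn ℝ ∞ u Ω) : ContDiffOn ℝ ∞ (fun z => u (Φ z)) Ω' :=
  hu.comp hp.contDiffOn hp.mapsTo

theorem mpd_congruence (hp : IsPullbackOn Φ G' Ω' G Ω) (hy : y ∈ Ω')
    {S S' : Coord n → Matrix (Fin n) (Fin n) ℝ}
    (hS : ∀ a b, ContDiffOn ℝ ∞ (fun z => S z a b) Ω)
    (hS' : ∀ z ∈ Ω', S' z = (jac Φ z).transpose * S (Φ z) * jac Φ z) (i : Fin n) :
    mpd i S' y = (mpd i (jac Φ) y).transpose * S (Φ y) * jac Φ y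
      + (jac Φ y).transpose * (∑ a, jac Φ y a i • mpd a S (Φ y)) * jac Φ y
      + (jac Φ y).transpose * S (Φ y) * mpd i (jac Φ) y := by
  have hJ := hp.differentiableAt_jac hy
  have hSd : ∀ a b, DifferentiableAt ℝ (fun z => S (Φ z) a b) y := fun a b =>
    (hp.contDiffOn_comp (hS a b)).differentiableAt_of_isOpen hp.source.isOpen hy
  have hJS : ∀ a b, DifferentiableAt ℝ (fun z => ((jac Φ z).transpose * S (Φ z)) a b) y := by
    intro a b
    simp only [Matrix.mul_apply, Matrix.transpose_apply]
    exact DifferentiableAt.fun_sum fun k _ => (hJ k a).fun_mul (hSd k b)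
  rw [mpd_congr (B := fun z => (jac Φ z).transpose * S (Φ z) * jac Φ z) (by
      filter_upwards [hp.source.mem_nhds hy] with z hz using hS' z hz),
    mpd_mul hJS hJ, mpd_mul (A := fun z => (jac Φ z).transpose) (fun a b => hJ b a) hSd,
    hp.mpd_comp' hy hS, mpd_transpose, Matrix.add_mul]

/-- Transformation of the Christoffel symbols. -/
theorem jac_mul_gam (hp : IsPullbackOn Φ G' Ω' G Ω) (hy : y ∈ Ω') (i : Fin n) :
    jac Φ y * gam G' i y = pullGam Φ G i y * jac Φ y + mpd i (jac Φ) y := by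
  have hJ := hp.isUnit_det hy
  have hJi : jac Φ y * (jac Φ y)⁻¹ = 1 := Matrix.mul_nonsing_inv _ hJ
  have hΦy := hp.mapsTo hy
  -- The candidate is the pulled-back connection in the new frame, J⁻¹(ΓJ + ∂J). It is torsion-free
  -- because second partials of Φ commute and Γ is symmetric, and compatible because G' = JᵀGJ, so
  -- uniqueness identifies it.
  set C : Fin n → Matrix (Fin n) (Fin n) ℝ := fun i =>
    (jac Φ y)⁻¹ * (pullGam Φ G i y * jac Φ y + mpd i (jac Φ) y) with hC
  have hJC : ∀ i, jac Φ y * C i = pullGam Φ G i y * jac Φ y + mpd i (jac Φ) y := fun i => by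
    rw [hC, ← Matrix.mul_assoc, hJi, Matrix.one_mul]
  have hsymm0 : ∀ i j c, (pullGam Φ G i y * jac Φ y + mpd i (jac Φ) y) c j
      = (pullGam Φ G j y * jac Φ y + mpd j (jac Φ) y) c i := by
    intro i j c
    rw [Matrix.add_apply, Matrix.add_apply, hp.mpd_jac_symm hy]
    congr 1
    simp only [pullGam, Matrix.mul_apply, Matrix.sum_apply, Matrix.smul_apply, smul_eq_mul,
      Finset.sum_mul]
    rw [Finset.sum_comm]
    refine Finset.sum_congr rfl fun a _ => Finset.sum_congr rfl fun b _ => ?_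
    simp only [gam, Matrix.of_apply]
    rw [hp.target.christoffel_symm hΦy]
    ring
  have hsymm : ∀ i j k, C i k j = C j k i := fun i j k => by
    simp only [hC]
    rw [Matrix.mul_apply, Matrix.mul_apply]
    exact Finset.sum_congr rfl fun c _ => by rw [hsymm0]
  have hcompat : ∀ i, mpd i G' y = (C i).transpose * G' y + G' y * C i := by
    intro i
    have e1 : ∑ a, jac Φ y a i • mpd a G (Φ y)
        = (pullGam Φ G i y).transpose * G (Φ y) + G (Φ y) * pullGam Φ G i y := by
      simp only [pullGam, Matrix.transpose_sum, Matrix.sum_mul, Matrix.mul_sum,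
        ← Finset.sum_add_distrib]
      refine Finset.sum_congr rfl fun a _ => ?_
      rw [hp.target.mpd_eq hΦy, Matrix.transpose_smul, Matrix.smul_mul, Matrix.mul_smul,
        smul_add]
    have e2 : (C i).transpose * G' y = (jac Φ y * C i).transpose * G (Φ y) * jac Φ y := by
      rw [hp.eq y hy, Matrix.transpose_mul (jac Φ y) (C i)]
      simp only [Matrix.mul_assoc]
    have e3 : G' y * C i = (jac Φ y).transpose * G (Φ y) * (jac Φ y * C i) := by
      rw [hp.eq y hy]
      simp only [Matrix.mul_assoc]
    rw [hp.mpd_congruence hy hp.target.contDiffOn hp.eq, e1, e2, e3, hJC,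
      Matrix.transpose_add, Matrix.transpose_mul]
    noncomm_ring
  rw [← hp.source.gam_unique hy hsymm hcompat i, hJC]

/-- Transformation of the covariant derivative of a 2-tensor. -/
theorem cov_eq_congruence (hp : IsPullbackOn Φ G' Ω' G Ω) (hy : y ∈ Ω')
    (hv : ∀ a b, ContDiffOn ℝ ∞ (fun z => v z a b) Ω)
    (hv' : ∀ z ∈ Ω', v' z = (jac Φ z).transpose * v (Φ z) * jac Φ z) (i : Fin n) :
    cov G' v' i y = (jac Φ y).transpose * (∑ a, jac Φ y a i • cov G v a (Φ y)) * jac Φ y := by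
  have e1 : ∑ a, jac Φ y a i • cov G v a (Φ y) = (∑ a, jac Φ y a i • mpd a v (Φ y))
      - (pullGam Φ G i y).transpose * v (Φ y) - v (Φ y) * pullGam Φ G i y := by
    simp only [pullGam, Matrix.transpose_sum, Matrix.sum_mul, Matrix.mul_sum,
      ← Finset.sum_sub_distrib]
    refine Finset.sum_congr rfl fun a _ => ?_
    rw [cov_eq, Matrix.transpose_smul, Matrix.smul_mul, Matrix.mul_smul, smul_sub, smul_sub]
  have e2 : (gam G' i y).transpose * v' y
      = (jac Φ y * gam G' i y).transpose * v (Φ y) * jac Φ y := by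
    rw [hv' y hy, Matrix.transpose_mul]
    simp only [Matrix.mul_assoc]
  have e3 : v' y * gam G' i y = (jac Φ y).transpose * v (Φ y) * (jac Φ y * gam G' i y) := by
    rw [hv' y hy]
    simp only [Matrix.mul_assoc]
  rw [cov_eq, hp.mpd_congruence hy hv hv', e1, e2, e3, hp.jac_mul_gam hy,
    Matrix.transpose_add, Matrix.transpose_mul]
  noncomm_ring

end IsPullbackOn

end Isometry

/-! ### Invariance of curvature, Hessian, divergence and flux -/

section Invariance

variable {n : ℕ} {Ω Ω' : Set (Coord n)} {G G' v v' : Coord n → Matrix (Fin n) (Fin n) ℝ}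
  {Φ : Coord n → Coord n} {y : Coord n} {f f' h h' : Coord n → ℝ}

theorem traceWith_sum_smul {ι : Type*} [Fintype ι] (g : Matrix (Fin n) (Fin n) ℝ) (c : ι → ℝ)
    (A : ι → Matrix (Fin n) (Fin n) ℝ) :
    traceWith g (∑ q, c q • A q) = ∑ q, c q * traceWith g (A q) := by
  simp only [traceWith_eq, Matrix.transpose_sum, Matrix.transpose_smul, Matrix.mul_sum,
    Matrix.mul_smul, Matrix.trace_sum, Matrix.trace_smul, smul_eq_mul]

theorem traceWith_sum_smul_congruence {ι : Type*} [Fintype ι] {J g : Matrix (Fin n) (Fin n) ℝ}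
    (hJ : IsUnit J.det) (c : ι → ℝ) (A : ι → Matrix (Fin n) (Fin n) ℝ) :
    traceWith (J.transpose * g * J) (∑ q, c q • (J.transpose * A q * J))
      = ∑ q, c q * traceWith g (A q) := by
  rw [traceWith_sum_smul]
  exact Finset.sum_congr rfl fun q _ => by rw [traceWith_congruence hJ]

theorem congruence_apply (J A : Matrix (Fin n) (Fin n) ℝ) (i j : Fin n) :
    (J.transpose * A * J) i j = ∑ a, ∑ b, J a i * J b j * A a b := by
  simp only [Matrix.mul_apply, Matrix.transpose_apply, Finset.sum_mul]
  rw [Finset.sum_comm]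
  exact Finset.sum_congr rfl fun a _ => Finset.sum_congr rfl fun b _ => by ring

namespace IsMetricOn

theorem contDiffOn_gam (hm : IsMetricOn G Ω) (a : Fin n) (i j : Fin n) :
    ContDiffOn ℝ ∞ (fun z => gam G a z i j) Ω :=
  hm.contDiffOn_christoffel i a j

end IsMetricOn

namespace IsPullbackOn

theorem mpd_pullGam (hp : IsPullbackOn Φ G' Ω' G Ω) (hy : y ∈ Ω') (i j : Fin n) :
    mpd i (pullGam Φ G j) y = ∑ a, mpd i (jac Φ) y a j • gam G a (Φ y)
      + ∑ a, ∑ b, (jac Φ y a j * jac Φ y b i) • mpd b (gam G a) (Φ y) := by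
  ext c d
  have hg : ∀ a, DifferentiableAt ℝ (fun z => gam G a (Φ z) c d) y := fun a =>
    (hp.contDiffOn_comp (hp.target.contDiffOn_gam a c d)).differentiableAt_of_isOpen
      hp.source.isOpen hy
  have hJ := hp.differentiableAt_jac hy
  have hcomp : ∀ a, pd i (fun z => gam G a (Φ z) c d) y
      = ∑ b, jac Φ y b i * mpd b (gam G a) (Φ y) c d := fun a =>
    pd_comp (u := fun z => gam G a z c d) ((hp.target.contDiffOn_gam a c d
      ).differentiableAt_of_isOpen hp.target.isOpen (hp.mapsTo hy)) (hp.differentiableAt hy) i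
  have h1 : mpd i (pullGam Φ G j) y c d
      = pd i (fun z => ∑ a, jac Φ z a j * gam G a (Φ z) c d) y := by
    simp only [mpd, Matrix.of_apply, pullGam, Matrix.sum_apply, Matrix.smul_apply, smul_eq_mul]
  rw [h1, pd_sum fun a _ => (hJ a j).fun_mul (hg a)]
  simp only [Matrix.add_apply, Matrix.sum_apply, Matrix.smul_apply, smul_eq_mul,
    ← Finset.sum_add_distrib]
  refine Finset.sum_congr rfl fun a _ => ?_
  rw [pd_mul (hJ a j) (hg a), hcomp, Finset.mul_sum]
  congr 1
  exact Finset.sum_congr rfl fun b _ => by ring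

/-- Transformation of the curvature matrices. -/
theorem jac_mul_curv (hp : IsPullbackOn Φ G' Ω' G Ω) (hy : y ∈ Ω') (i j : Fin n) :
    jac Φ y * curv G' i j y
      = (∑ a, ∑ b, (jac Φ y a i * jac Φ y b j) • curv G a b (Φ y)) * jac Φ y := by
  have hJ := hp.differentiableAt_jac hy
  have hg' : ∀ i a b, DifferentiableAt ℝ (fun z => gam G' i z a b) y := fun i a b =>
    (hp.source.contDiffOn_gam i a b).differentiableAt_of_isOpen hp.source.isOpen hy
  have hpg : ∀ i a b, DifferentiableAt ℝ (fun z => pullGam Φ G i z a b) y := by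
    intro i a b
    simp only [pullGam, Matrix.sum_apply, Matrix.smul_apply, smul_eq_mul]
    exact DifferentiableAt.fun_sum fun c _ => (hJ c i).fun_mul
      ((hp.contDiffOn_comp (hp.target.contDiffOn_gam c a b)).differentiableAt_of_isOpen
        hp.source.isOpen hy)
  have hmJ : ∀ j a b, DifferentiableAt ℝ (fun z => mpd j (jac Φ) z a b) y := fun j a b =>
    (contDiffOn_pd hp.source.isOpen (contDiffOn_jac hp.source.isOpen hp.contDiffOn a b)
      j).differentiableAt_of_isOpen hp.source.isOpen hy
  have hpJ : ∀ j a b, DifferentiableAt ℝ (fun z => (pullGam Φ G j z * jac Φ z) a b) y := by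
    intro j a b
    simp only [Matrix.mul_apply]
    exact DifferentiableAt.fun_sum fun c _ => (hpg j a c).fun_mul (hJ c b)
  -- The transformation law J Γ' = P J + ∂J, with P the pulled-back connection, is an identity on an
  -- open set and can be differentiated.
  have hD : ∀ i j, mpd i (jac Φ) y * gam G' j y + jac Φ y * mpd i (gam G' j) y
      = mpd i (pullGam Φ G j) y * jac Φ y + pullGam Φ G j y * mpd i (jac Φ) y
        + mpd i (mpd j (jac Φ)) y := by
    intro i j
    rw [← mpd_mul hJ (hg' j), ← mpd_mul (hpg j) hJ, ← mpd_add (hpJ j) (hmJ j)]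
    exact mpd_congr (by
      filter_upwards [hp.source.mem_nhds hy] with z hz using hp.jac_mul_gam hz j) i
  have hcomm : mpd i (mpd j (jac Φ)) y = mpd j (mpd i (jac Φ)) y := by
    ext a b
    exact pd_comm hp.source.isOpen (contDiffOn_jac hp.source.isOpen hp.contDiffOn a b) hy i j
  -- All terms containing derivatives of J are symmetric in i, j as a whole, so they disappear on
  -- antisymmetrizing.
  have hS : ∀ i j, jac Φ y * (mpd i (gam G' j) y + gam G' i y * gam G' j y)
      = (mpd i (pullGam Φ G j) y + pullGam Φ G i y * pullGam Φ G j y) * jac Φ y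
        + pullGam Φ G j y * mpd i (jac Φ) y + pullGam Φ G i y * mpd j (jac Φ) y
        + mpd i (mpd j (jac Φ)) y := by
    intro i j
    have e1 : jac Φ y * mpd i (gam G' j) y = mpd i (pullGam Φ G j) y * jac Φ y
        + pullGam Φ G j y * mpd i (jac Φ) y + mpd i (mpd j (jac Φ)) y
        - mpd i (jac Φ) y * gam G' j y := by
      rw [← hD i j]; abel
    rw [Matrix.mul_add, e1, ← Matrix.mul_assoc, hp.jac_mul_gam hy i, Matrix.add_mul,
      Matrix.mul_assoc (pullGam Φ G i y), hp.jac_mul_gam hy j]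
    noncomm_ring
  -- The curvature of the pulled-back connection is the pullback of the curvature: its only extra
  -- term, (∂_i ∂_j Φ^a) Γ_a, is symmetric.
  have hF : mpd i (pullGam Φ G j) y + pullGam Φ G i y * pullGam Φ G j y
      - (mpd j (pullGam Φ G i) y + pullGam Φ G j y * pullGam Φ G i y)
      = ∑ a, ∑ b, (jac Φ y a i * jac Φ y b j) • curv G a b (Φ y) := by
    have e1 : ∀ i j, pullGam Φ G i y * pullGam Φ G j y
        = ∑ a, ∑ b, (jac Φ y a i * jac Φ y b j) • (gam G a (Φ y) * gam G b (Φ y)) := by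
      intro i j
      simp only [pullGam, Matrix.sum_mul, Matrix.mul_sum, Matrix.smul_mul, Matrix.mul_smul,
        Finset.smul_sum]
      rw [Finset.sum_comm]
      exact Finset.sum_congr rfl fun a _ => Finset.sum_congr rfl fun b _ => by
        rw [smul_smul, mul_comm]
    have e2 : ∑ a, mpd i (jac Φ) y a j • gam G a (Φ y)
        = ∑ a, mpd j (jac Φ) y a i • gam G a (Φ y) :=
      Finset.sum_congr rfl fun a _ => by rw [hp.mpd_jac_symm hy]
    have e3 : ∑ a, ∑ b, (jac Φ y a j * jac Φ y b i) • mpd b (gam G a) (Φ y)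
        = ∑ a, ∑ b, (jac Φ y a i * jac Φ y b j) • mpd a (gam G b) (Φ y) := by
      rw [Finset.sum_comm]
      exact Finset.sum_congr rfl fun a _ => Finset.sum_congr rfl fun b _ => by rw [mul_comm]
    have e4 : pullGam Φ G j y * pullGam Φ G i y
        = ∑ a, ∑ b, (jac Φ y a i * jac Φ y b j) • (gam G b (Φ y) * gam G a (Φ y)) := by
      rw [e1, Finset.sum_comm]
      exact Finset.sum_congr rfl fun a _ => Finset.sum_congr rfl fun b _ => by rw [mul_comm]
    rw [hp.mpd_pullGam hy, hp.mpd_pullGam hy, e1 i j, e4, e2, e3]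
    simp only [curv, smul_sub, smul_add, Finset.sum_sub_distrib, Finset.sum_add_distrib]
    abel
  rw [← hF, curv, Matrix.mul_sub, hS i j, hS j i, hcomm, Matrix.sub_mul]
  abel

/-- The Ricci tensor is a tensor. -/
theorem ricciCoord_eq (hp : IsPullbackOn Φ G' Ω' G Ω) (hy : y ∈ Ω') :
    ricciCoord G' y = (jac Φ y).transpose * ricciCoord G (Φ y) * jac Φ y := by
  have hJ := hp.isUnit_det hy
  ext j k
  rw [ricciCoord_apply, congruence_apply]
  have h1 : ∀ i, curv G' i j y
      = ∑ a, ∑ b, (jac Φ y a i * jac Φ y b j) • ((jac Φ y)⁻¹ * (curv G a b (Φ y) * jac Φ y)) := by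
    intro i
    have := congrArg (fun X => (jac Φ y)⁻¹ * X) (hp.jac_mul_curv hy i j)
    simp only [← Matrix.mul_assoc, Matrix.nonsing_inv_mul _ hJ, Matrix.one_mul] at this
    rw [this]
    simp only [Matrix.mul_sum, Matrix.sum_mul, Matrix.mul_smul, Matrix.smul_mul,
      Matrix.mul_assoc]
  -- The contracted index carries J on one side and J⁻¹ on the other, which cancel.
  have h2 : ∀ a b, ∑ i, jac Φ y a i * ((jac Φ y)⁻¹ * (curv G a b (Φ y) * jac Φ y)) i k
      = (curv G a b (Φ y) * jac Φ y) a k := by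
    intro a b
    have : (jac Φ y * ((jac Φ y)⁻¹ * (curv G a b (Φ y) * jac Φ y))) a k
        = (curv G a b (Φ y) * jac Φ y) a k := by
      rw [Matrix.mul_nonsing_inv_cancel_left _ _ hJ]
    rw [← this, Matrix.mul_apply]
  calc ∑ i, curv G' i j y i k
      = ∑ i, ∑ a, ∑ b, jac Φ y b j * (jac Φ y a i *
          ((jac Φ y)⁻¹ * (curv G a b (Φ y) * jac Φ y)) i k) := by
        refine Finset.sum_congr rfl fun i _ => ?_
        rw [h1]
        simp only [Matrix.sum_apply, Matrix.smul_apply, smul_eq_mul]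
        exact Finset.sum_congr rfl fun a _ => Finset.sum_congr rfl fun b _ => by ring
    _ = ∑ a, ∑ b, jac Φ y b j * (curv G a b (Φ y) * jac Φ y) a k := by
        rw [Finset.sum_comm]
        refine Finset.sum_congr rfl fun a _ => ?_
        rw [Finset.sum_comm]
        exact Finset.sum_congr rfl fun b _ => by rw [← Finset.mul_sum, h2]
    _ = ∑ b, ∑ d, jac Φ y b j * jac Φ y d k * ricciCoord G (Φ y) b d := by
        rw [Finset.sum_comm]
        refine Finset.sum_congr rfl fun b _ => ?_
        simp only [ricciCoord_apply, Matrix.mul_apply, Finset.mul_sum]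
        rw [Finset.sum_comm]
        exact Finset.sum_congr rfl fun a _ => Finset.sum_congr rfl fun d _ => by ring

theorem traceWith_eq_congruence (hp : IsPullbackOn Φ G' Ω' G Ω) (hy : y ∈ Ω')
    {A A' : Matrix (Fin n) (Fin n) ℝ} (hA : A' = (jac Φ y).transpose * A * jac Φ y) :
    traceWith (G' y) A' = traceWith (G (Φ y)) A := by
  rw [hp.eq y hy, hA, traceWith_congruence (hp.isUnit_det hy)]

theorem scalCoord_eq (hp : IsPullbackOn Φ G' Ω' G Ω) (hy : y ∈ Ω') :
    scalCoord G' y = scalCoord G (Φ y) :=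
  hp.traceWith_eq_congruence hy (hp.ricciCoord_eq hy)

theorem trCoord_eq (hp : IsPullbackOn Φ G' Ω' G Ω) (hy : y ∈ Ω')
    (hv' : ∀ z ∈ Ω', v' z = (jac Φ z).transpose * v (Φ z) * jac Φ z) :
    trCoord G' v' y = trCoord G v (Φ y) :=
  hp.traceWith_eq_congruence hy (hv' y hy)

theorem pd_eq (hp : IsPullbackOn Φ G' Ω' G Ω) (hy : y ∈ Ω') (hf : ContDiffOn ℝ ∞ f Ω)
    (hf' : ∀ z ∈ Ω', f' z = f (Φ z)) (i : Fin n) :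
    pd i f' y = ∑ a, jac Φ y a i * pd a f (Φ y) := by
  rw [pd_congr (w := fun z => f (Φ z)) (by
    filter_upwards [hp.source.mem_nhds hy] with z hz using hf' z hz)]
  exact pd_comp (hf.differentiableAt_of_isOpen hp.target.isOpen (hp.mapsTo hy))
    (hp.differentiableAt hy) i

theorem outer_eq_congruence {J : Matrix (Fin n) (Fin n) ℝ} {p q p' q' : Fin n → ℝ}
    (hpp : ∀ i, p' i = ∑ a, J a i * p a) (hqq : ∀ i, q' i = ∑ a, J a i * q a) :
    (Matrix.of fun i j => p' i * q' j)
      = J.transpose * (Matrix.of fun i j => p i * q j) * J := by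
  ext i j
  rw [congruence_apply, Matrix.of_apply, hpp, hqq, Finset.sum_mul_sum]
  exact Finset.sum_congr rfl fun a _ => Finset.sum_congr rfl fun b _ => by
    rw [Matrix.of_apply]; ring

theorem gradCoord_eq (hp : IsPullbackOn Φ G' Ω' G Ω) (hy : y ∈ Ω') (hf : ContDiffOn ℝ ∞ f Ω)
    (hf' : ∀ z ∈ Ω', f' z = f (Φ z)) (hh : ContDiffOn ℝ ∞ h Ω)
    (hh' : ∀ z ∈ Ω', h' z = h (Φ z)) : gradCoord G' f' h' y = gradCoord G f h (Φ y) :=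
  hp.traceWith_eq_congruence hy
    (outer_eq_congruence (hp.pd_eq hy hf hf') (hp.pd_eq hy hh hh'))

theorem hessianCoord_eq (hp : IsPullbackOn Φ G' Ω' G Ω) (hy : y ∈ Ω')
    (hf : ContDiffOn ℝ ∞ f Ω) (hf' : ∀ z ∈ Ω', f' z = f (Φ z)) :
    hessianCoord G' f' y = (jac Φ y).transpose * hessianCoord G f (Φ y) * jac Φ y := by
  have hΦy := hp.mapsTo hy
  ext i j
  rw [congruence_apply]
  simp only [hessianCoord, Matrix.of_apply]
  have hpf : ∀ a, ContDiffOn ℝ ∞ (pd a f) Ω := fun a => contDiffOn_pd hp.target.isOpen hf a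
  have hpfd : ∀ a, DifferentiableAt ℝ (fun z => pd a f (Φ z)) y := fun a =>
    (hp.contDiffOn_comp (hpf a)).differentiableAt_of_isOpen hp.source.isOpen hy
  have h1 : pd i (pd j f') y = ∑ a, mpd i (jac Φ) y a j * pd a f (Φ y)
      + ∑ a, ∑ b, jac Φ y a i * jac Φ y b j * pd a (pd b f) (Φ y) := by
    rw [pd_congr (w := fun z => ∑ a, jac Φ z a j * pd a f (Φ z)) (by
      filter_upwards [hp.source.mem_nhds hy] with z hz using hp.pd_eq hz hf hf' j),
      pd_sum fun a _ => (hp.differentiableAt_jac hy a j).fun_mul (hpfd a),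
      Finset.sum_comm, ← Finset.sum_add_distrib]
    refine Finset.sum_congr rfl fun a _ => ?_
    rw [pd_mul (hp.differentiableAt_jac hy a j) (hpfd a),
      pd_comp ((hpf a).differentiableAt_of_isOpen hp.target.isOpen hΦy)
        (hp.differentiableAt hy), Finset.mul_sum]
    congr 1
    exact Finset.sum_congr rfl fun b _ => by ring
  -- The inhomogeneous term of the Christoffel law is the second derivative of Φ that the chain rule
  -- puts into ∂_i ∂_j f'; the two cancel in the Hessian.
  have h2 : ∀ a, ∑ k, jac Φ y a k * christoffel G' k i j y
      = ∑ b, ∑ c, jac Φ y b i * jac Φ y c j * christoffel G a b c (Φ y)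
        + mpd i (jac Φ) y a j := by
    intro a
    have := congrFun (congrFun (hp.jac_mul_gam hy i) a) j
    simp only [Matrix.add_apply, Matrix.mul_apply, pullGam, Matrix.sum_apply, Matrix.smul_apply,
      smul_eq_mul, gam, Matrix.of_apply, Finset.sum_mul] at this
    rw [this]
    congr 1
    exact Finset.sum_congr rfl fun b _ => Finset.sum_congr rfl fun c _ => by ring
  have h3 : ∑ k, christoffel G' k i j y * pd k f' y
      = ∑ a, (∑ b, ∑ c, jac Φ y b i * jac Φ y c j * christoffel G a b c (Φ y)) * pd a f (Φ y)
        + ∑ a, mpd i (jac Φ) y a j * pd a f (Φ y) := by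
    rw [← Finset.sum_add_distrib]
    simp only [hp.pd_eq hy hf hf', Finset.mul_sum, ← add_mul, ← h2]
    rw [Finset.sum_comm]
    refine Finset.sum_congr rfl fun a _ => ?_
    rw [Finset.sum_mul]
    exact Finset.sum_congr rfl fun k _ => by ring
  have h4 : ∑ a, (∑ b, ∑ c, jac Φ y b i * jac Φ y c j * christoffel G a b c (Φ y))
        * pd a f (Φ y)
      = ∑ b, ∑ c, jac Φ y b i * jac Φ y c j *
        ∑ a, christoffel G a b c (Φ y) * pd a f (Φ y) := by
    simp only [Finset.sum_mul, Finset.mul_sum]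
    rw [Finset.sum_comm]
    refine Finset.sum_congr rfl fun b _ => ?_
    rw [Finset.sum_comm]
    exact Finset.sum_congr rfl fun c _ => Finset.sum_congr rfl fun a _ => by ring
  rw [h1, h3, h4]
  simp only [mul_sub, Finset.sum_sub_distrib]
  ring

theorem lapCoord_eq (hp : IsPullbackOn Φ G' Ω' G Ω) (hy : y ∈ Ω')
    (hf : ContDiffOn ℝ ∞ f Ω) (hf' : ∀ z ∈ Ω', f' z = f (Φ z)) :
    lapCoord G' f' y = lapCoord G f (Φ y) :=
  hp.traceWith_eq_congruence hy (hp.hessianCoord_eq hy hf hf')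

theorem energyCoord_eq (hp : IsPullbackOn Φ G' Ω' G Ω) (hy : y ∈ Ω')
    (hf : ContDiffOn ℝ ∞ f Ω) (hf' : ∀ z ∈ Ω', f' z = f (Φ z)) :
    energyCoord G' f' y = energyCoord G f (Φ y) := by
  rw [energyCoord, hp.scalCoord_eq hy, hp.gradCoord_eq hy hf hf' hf hf', hf' y hy, energyCoord]

theorem variationCoord_eq (hp : IsPullbackOn Φ G' Ω' G Ω) (hy : y ∈ Ω')
    (hf : ContDiffOn ℝ ∞ f Ω) (hf' : ∀ z ∈ Ω', f' z = f (Φ z))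
    (hv' : ∀ z ∈ Ω', v' z = (jac Φ z).transpose * v (Φ z) * jac Φ z)
    (hh' : ∀ z ∈ Ω', h' z = h (Φ z)) :
    variationCoord G' f' v' h' y = variationCoord G f v h (Φ y) := by
  rw [variationCoord, hp.scalCoord_eq hy, hp.gradCoord_eq hy hf hf' hf hf', hf' y hy,
    hp.lapCoord_eq hy hf hf', hp.trCoord_eq hy hv', hh' y hy, hp.eq y hy, hv' y hy,
    hp.ricciCoord_eq hy, hp.hessianCoord_eq hy hf hf', ← Matrix.add_mul, ← Matrix.mul_add,
    pairWith_congruence (hp.isUnit_det hy), variationCoord]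

theorem divCoord_eq (hp : IsPullbackOn Φ G' Ω' G Ω) (hy : y ∈ Ω')
    (hv : ∀ a b, ContDiffOn ℝ ∞ (fun z => v z a b) Ω)
    (hv' : ∀ z ∈ Ω', v' z = (jac Φ z).transpose * v (Φ z) * jac Φ z) (a : Fin n) :
    divCoord G' v' a y = ∑ q, jac Φ y q a * divCoord G v q (Φ y) := by
  have h1 : (Matrix.of fun j b => covDerivTwo G' v' j a b y)
      = ∑ q, jac Φ y q a • ((jac Φ y).transpose *
        (Matrix.of fun p r => covDerivTwo G v p q r (Φ y)) * jac Φ y) := by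
    ext j b
    have h2 : covDerivTwo G' v' j a b y = cov G' v' j y a b := rfl
    rw [Matrix.of_apply, h2, hp.cov_eq_congruence hy hv hv', congruence_apply]
    simp only [Matrix.sum_apply, Matrix.smul_apply, smul_eq_mul, congruence_apply,
      Matrix.of_apply, Finset.mul_sum, cov]
    refine Finset.sum_congr rfl fun q _ => ?_
    rw [Finset.sum_comm]
    exact Finset.sum_congr rfl fun p _ => Finset.sum_congr rfl fun r _ => by ring
  rw [divCoord, h1, hp.eq y hy, traceWith_sum_smul_congruence (hp.isUnit_det hy)]
  rfl

theorem contractCoord_eq (hp : IsPullbackOn Φ G' Ω' G Ω) (hy : y ∈ Ω')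
    (hf : ContDiffOn ℝ ∞ f Ω) (hf' : ∀ z ∈ Ω', f' z = f (Φ z))
    (hv' : ∀ z ∈ Ω', v' z = (jac Φ z).transpose * v (Φ z) * jac Φ z) (a : Fin n) :
    contractCoord G' v' f' a y = ∑ q, jac Φ y q a * contractCoord G v f q (Φ y) := by
  have h1 : (Matrix.of fun j k => v' y a j * pd k f' y)
      = ∑ q, jac Φ y q a • ((jac Φ y).transpose *
        (Matrix.of fun p r => v (Φ y) q p * pd r f (Φ y)) * jac Φ y) := by
    ext j k
    rw [Matrix.of_apply, hv' y hy, congruence_apply, hp.pd_eq hy hf hf']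
    simp only [Matrix.sum_apply, Matrix.smul_apply, smul_eq_mul, congruence_apply,
      Matrix.of_apply, Finset.mul_sum, Finset.sum_mul]
    rw [Finset.sum_comm]
    refine Finset.sum_congr rfl fun q _ => ?_
    rw [Finset.sum_comm]
    exact Finset.sum_congr rfl fun p _ => Finset.sum_congr rfl fun r _ => by ring
  rw [contractCoord, h1, hp.eq y hy, traceWith_sum_smul_congruence (hp.isUnit_det hy)]
  rfl

theorem fluxCoord_eq (hp : IsPullbackOn Φ G' Ω' G Ω) (hy : y ∈ Ω')
    (hf : ContDiffOn ℝ ∞ f Ω) (hf' : ∀ z ∈ Ω', f' z = f (Φ z))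
    (hv : ∀ a b, ContDiffOn ℝ ∞ (fun z => v z a b) Ω)
    (hv' : ∀ z ∈ Ω', v' z = (jac Φ z).transpose * v (Φ z) * jac Φ z)
    (hh' : ∀ z ∈ Ω', h' z = h (Φ z)) (b : Fin n) :
    fluxCoord G' f' v' h' b y = ∑ q, jac Φ y q b * fluxCoord G f v h q (Φ y) := by
  simp only [fluxCoord]
  rw [hp.divCoord_eq hy hv hv', hp.contractCoord_eq hy hf hf' hv', hp.pd_eq hy hf hf',
    hp.pd_eq hy (hp.target.contDiffOn_trCoord hv) fun z hz => hp.trCoord_eq hz hv',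
    hp.trCoord_eq hy hv', hh' y hy, Finset.mul_sum, ← Finset.sum_sub_distrib,
    ← Finset.sum_add_distrib, ← Finset.sum_add_distrib]
  exact Finset.sum_congr rfl fun q _ => by ring

end IsPullbackOn

/-- The weighted pairing `e^{-f} ⟨dχ, w⟩` of the differential of `χ` with the flux. -/
noncomputable def fluxPairing (G : Coord n → Matrix (Fin n) (Fin n) ℝ) (f : Coord n → ℝ)
    (v : Coord n → Matrix (Fin n) (Fin n) ℝ) (h χ : Coord n → ℝ) (y : Coord n) : ℝ :=
  Real.exp (-f y) * traceWith (G y) (Matrix.of fun i b => pd i χ y * fluxCoord G f v h b y)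

theorem IsPullbackOn.fluxPairing_eq (hp : IsPullbackOn Φ G' Ω' G Ω) (hy : y ∈ Ω')
    (hf : ContDiffOn ℝ ∞ f Ω) (hf' : ∀ z ∈ Ω', f' z = f (Φ z))
    (hv : ∀ a b, ContDiffOn ℝ ∞ (fun z => v z a b) Ω)
    (hv' : ∀ z ∈ Ω', v' z = (jac Φ z).transpose * v (Φ z) * jac Φ z)
    (hh' : ∀ z ∈ Ω', h' z = h (Φ z)) {χ χ' : Coord n → ℝ} (hχ : ContDiffOn ℝ ∞ χ Ω)
    (hχ' : ∀ z ∈ Ω', χ' z = χ (Φ z)) :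
    fluxPairing G' f' v' h' χ' y = fluxPairing G f v h χ (Φ y) := by
  rw [fluxPairing, hf' y hy, hp.traceWith_eq_congruence hy (outer_eq_congruence
    (hp.pd_eq hy hχ hχ') (hp.fluxCoord_eq hy hf hf' hv hv' hh')), fluxPairing]

end Invariance

/-! ### Tensor fields in charts -/

section Charts

variable {n : ℕ} {M : Type*} [TopologicalSpace M] [ChartedSpace (Coord n) M]
  [IsManifold (𝓡 n) ∞ M]

theorem mdifferentiableAt_extChartAt_symm' (p : M) {y : Coord n}
    (hy : y ∈ (extChartAt (𝓡 n) p).target) :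
    MDifferentiableAt (𝓡 n) (𝓡 n) (extChartAt (𝓡 n) p).symm y := by
  have : IsManifold (𝓡 n) 1 M := .of_le (n := ∞) (by simp)
  have h := mdifferentiableWithinAt_extChartAt_symm (I := 𝓡 n) hy
  rwa [ModelWithCorners.range_eq_univ, mdifferentiableWithinAt_univ] at h

/-- The coordinate frame is the tangent map of the inverse chart applied to a constant vector field.
The idle time variable allows pairing with a time-dependent tensor. -/
theorem contMDiffOn_chart_frame (p : M) (e : Coord n) :
    ContMDiffOn 𝓘(ℝ, ℝ × Coord n) ((𝓡 n).prod 𝓘(ℝ, Coord n)) ∞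
      (fun q : ℝ × Coord n => Bundle.TotalSpace.mk' (Coord n)
        (E := fun x : M => TangentSpace (𝓡 n) x) ((extChartAt (𝓡 n) p).symm q.2)
        (mfderiv (𝓡 n) (𝓡 n) (extChartAt (𝓡 n) p).symm q.2 e))
      (univ ×ˢ (extChartAt (𝓡 n) p).target) := by
  have : IsManifold (𝓡 n) 1 M := .of_le (n := ∞) (by simp)
  have ho := isOpen_extChartAt_target (I := 𝓡 n) p
  have h1 := (contMDiffOn_extChartAt_symm (I := 𝓡 n) (n := ∞) p).contMDiffOn_tangentMapWithin
    (m := ∞) (by simp) ho.uniqueMDiffOn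
  have h2 : ContMDiff 𝓘(ℝ, ℝ × Coord n) ((𝓡 n).prod 𝓘(ℝ, Coord n)) ∞
      (fun q : ℝ × Coord n => (Bundle.TotalSpace.mk' (Coord n)
        (E := fun x : Coord n => TangentSpace (𝓡 n) x) q.2 e)) := by
    have h0 : ContMDiff (𝓡 n) ((𝓡 n).prod 𝓘(ℝ, Coord n)) ∞
        (fun y : Coord n => (Bundle.TotalSpace.mk' (Coord n)
          (E := fun x : Coord n => TangentSpace (𝓡 n) x) y e)) :=
      contMDiff_vectorSpace_iff_contDiff.2 contDiff_const
    exact h0.comp contDiff_snd.contMDiff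
  have h3 := h1.comp h2.contMDiffOn (s := univ ×ˢ (extChartAt (𝓡 n) p).target)
    (fun q hq => hq.2)
  refine h3.congr fun q hq => ?_
  simp only [Function.comp, tangentMapWithin]
  rw [mfderivWithin_of_isOpen ho hq.2]

/-- Evaluating a smooth section on smooth frames gives a smooth section of the trivial line bundle,
whose fibre coordinate is the component. -/
theorem contDiffOn_inChart {G : ℝ → TwoTensorField n M} {ε : ℝ}
    (hG : ContMDiffOn (𝓘(ℝ, ℝ).prod (𝓡 n))
      ((𝓡 n).prod 𝓘(ℝ, Coord n →L[ℝ] Coord n →L[ℝ] ℝ)) ∞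
      (fun q : ℝ × M => Bundle.TotalSpace.mk' (Coord n →L[ℝ] Coord n →L[ℝ] ℝ)
        (E := fun x : M => TangentSpace (𝓡 n) x →L[ℝ] TangentSpace (𝓡 n) x →L[ℝ] ℝ)
        q.2 (G q.1 q.2))
      (Ioo (-ε) ε ×ˢ univ)) (p : M) (i j : Fin n) :
    ContDiffOn ℝ ∞ (fun q : ℝ × Coord n => inChart p (G q.1) q.2 i j)
      (Ioo (-ε) ε ×ˢ (extChartAt (𝓡 n) p).target) := by
  have hbase : ContMDiffOn 𝓘(ℝ, ℝ × Coord n) (𝓘(ℝ, ℝ).prod (𝓡 n)) ∞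
      (fun q : ℝ × Coord n => (q.1, (extChartAt (𝓡 n) p).symm q.2))
      (Ioo (-ε) ε ×ˢ (extChartAt (𝓡 n) p).target) :=
    contDiff_fst.contMDiff.contMDiffOn.prodMk
      ((contMDiffOn_extChartAt_symm (I := 𝓡 n) (n := ∞) p).comp
        contDiff_snd.contMDiff.contMDiffOn fun q hq => hq.2)
  have h1 := hG.comp hbase fun q hq => ⟨hq.1, mem_univ _⟩
  have hf := fun e => (contMDiffOn_chart_frame p e).mono
    (prod_mono (subset_univ (Ioo (-ε) ε)) (subset_refl (extChartAt (𝓡 n) p).target))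
  have h2 : ContMDiffOn 𝓘(ℝ, ℝ × Coord n) ((𝓡 n).prod 𝓘(ℝ, ℝ)) ∞
      (fun q : ℝ × Coord n => Bundle.TotalSpace.mk' ℝ (E := Bundle.Trivial M ℝ)
        ((extChartAt (𝓡 n) p).symm q.2) (inChart p (G q.1) q.2 i j))
      (Ioo (-ε) ε ×ˢ (extChartAt (𝓡 n) p).target) :=
    ContMDiffOn.clm_bundle_apply₂ (F₁ := Coord n) (F₂ := Coord n) h1
      (hf (EuclideanSpace.single i 1)) (hf (EuclideanSpace.single j 1))
  rw [← contMDiffOn_iff_contDiffOn]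
  intro q hq
  have h3 := h2 q hq
  rw [Bundle.contMDiffWithinAt_totalSpace] at h3
  exact h3.2

theorem contDiffOn_funInChart {F : ℝ → M → ℝ} {ε : ℝ}
    (hF : ContMDiffOn (𝓘(ℝ, ℝ).prod (𝓡 n)) 𝓘(ℝ, ℝ) ∞ (fun q : ℝ × M => F q.1 q.2)
      (Ioo (-ε) ε ×ˢ univ)) (p : M) :
    ContDiffOn ℝ ∞ (fun q : ℝ × Coord n => funInChart p (F q.1) q.2)
      (Ioo (-ε) ε ×ˢ (extChartAt (𝓡 n) p).target) := by
  have hbase : ContMDiffOn 𝓘(ℝ, ℝ × Coord n) (𝓘(ℝ, ℝ).prod (𝓡 n)) ∞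
      (fun q : ℝ × Coord n => (q.1, (extChartAt (𝓡 n) p).symm q.2))
      (Ioo (-ε) ε ×ˢ (extChartAt (𝓡 n) p).target) :=
    contDiff_fst.contMDiff.contMDiffOn.prodMk
      ((contMDiffOn_extChartAt_symm (I := 𝓡 n) (n := ∞) p).comp
        contDiff_snd.contMDiff.contMDiffOn fun q hq => hq.2)
  have h1 := hF.comp hbase fun q hq => ⟨hq.1, mem_univ _⟩
  exact contMDiffOn_iff_contDiffOn.1 h1

theorem contDiffOn_funInChart_of_contMDiff {u : M → ℝ}
    (hu : ContMDiff (𝓡 n) 𝓘(ℝ, ℝ) ∞ u) (p : M) :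
    ContDiffOn ℝ ∞ (funInChart p u) (extChartAt (𝓡 n) p).target :=
  contMDiffOn_iff_contDiffOn.1 (hu.comp_contMDiffOn
    (contMDiffOn_extChartAt_symm (I := 𝓡 n) (n := ∞) p))

/-- The transition map from the chart at `p` to the chart at `q`. -/
noncomputable def transition (n : ℕ) {M : Type*} [TopologicalSpace M] [ChartedSpace (Coord n) M]
    (p q : M) (y : Coord n) : Coord n :=
  extChartAt (𝓡 n) q ((extChartAt (𝓡 n) p).symm y)

/-- The domain of the transition map from the chart at `p` to the chart at `q`. -/
def overlap (n : ℕ) {M : Type*} [TopologicalSpace M] [ChartedSpace (Coord n) M] (p q : M) :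
    Set (Coord n) :=
  (extChartAt (𝓡 n) p).target ∩ (extChartAt (𝓡 n) p).symm ⁻¹' (extChartAt (𝓡 n) q).source

omit [IsManifold (𝓡 n) ∞ M] in
theorem isOpen_overlap (p q : M) : IsOpen (overlap n p q) :=
  (continuousOn_extChartAt_symm (I := 𝓡 n) p).isOpen_inter_preimage
    (isOpen_extChartAt_target p) (isOpen_extChartAt_source q)

theorem contDiffOn_transition (p q : M) : ContDiffOn ℝ ∞ (transition n p q) (overlap n p q) :=
  (contDiffOn_ext_coord_change (I := 𝓡 n) (n := ∞) q p)

omit [IsManifold (𝓡 n) ∞ M] in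
theorem mapsTo_transition (p q : M) :
    MapsTo (transition n p q) (overlap n p q) (extChartAt (𝓡 n) q).target :=
  fun _ hy => (extChartAt (𝓡 n) q).map_source hy.2

omit [IsManifold (𝓡 n) ∞ M] in
theorem symm_transition {p q : M} {y : Coord n} (hy : y ∈ overlap n p q) :
    (extChartAt (𝓡 n) q).symm (transition n p q y) = (extChartAt (𝓡 n) p).symm y :=
  (extChartAt (𝓡 n) q).left_inv hy.2

theorem mfderiv_symm_eq {p q : M} {y : Coord n} (hy : y ∈ overlap n p q) (i : Fin n) :
    (mfderiv (𝓡 n) (𝓡 n) (extChartAt (𝓡 n) p).symm y (EuclideanSpace.single i (1 : ℝ)) :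
      Coord n) = ∑ a, jac (transition n p q) y a i •
        (mfderiv (𝓡 n) (𝓡 n) (extChartAt (𝓡 n) q).symm (transition n p q y)
          (EuclideanSpace.single a (1 : ℝ)) : Coord n) := by
  have hd : DifferentiableAt ℝ (transition n p q) y :=
    ((contDiffOn_transition p q).contDiffAt ((isOpen_overlap p q).mem_nhds hy)).differentiableAt
      (by simp)
  have h1 : (extChartAt (𝓡 n) p).symm =ᶠ[𝓝 y]
      (extChartAt (𝓡 n) q).symm ∘ transition n p q := by
    filter_upwards [(isOpen_overlap p q).mem_nhds hy] with z hz using (symm_transition hz).symm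
  have h2 := (mdifferentiableAt_extChartAt_symm' q (mapsTo_transition p q hy)).hasMFDerivAt.comp y
    hd.hasFDerivAt.hasMFDerivAt
  have h3 := (h2.congr_of_eventuallyEq h1).mfderiv
  rw [h3]
  change mfderiv (𝓡 n) (𝓡 n) (extChartAt (𝓡 n) q).symm (transition n p q y)
    (fderiv ℝ (transition n p q) y (EuclideanSpace.single i (1 : ℝ))) = _
  rw [fderiv_single_eq_sum hd]
  erw [map_sum]
  refine Finset.sum_congr rfl fun a _ => ?_
  erw [map_smul]

/-- Components transform as a tensor. -/
theorem inChart_eq {p q : M} {y : Coord n} (hy : y ∈ overlap n p q) (T : TwoTensorField n M) :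
    inChart p T y = (jac (transition n p q) y).transpose * inChart q T (transition n p q y)
      * jac (transition n p q) y := by
  set B : M → Coord n →L[ℝ] Coord n →L[ℝ] ℝ := T with hB
  have h1 : ∀ (r : M) (z : Coord n) (i j : Fin n), inChart r T z i j
      = B ((extChartAt (𝓡 n) r).symm z)
        (mfderiv (𝓡 n) (𝓡 n) (extChartAt (𝓡 n) r).symm z (EuclideanSpace.single i (1 : ℝ)) :
          Coord n)
        (mfderiv (𝓡 n) (𝓡 n) (extChartAt (𝓡 n) r).symm z (EuclideanSpace.single j (1 : ℝ)) :
          Coord n) := fun _ _ _ _ => rfl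
  ext i j
  rw [congruence_apply, h1, mfderiv_symm_eq hy, mfderiv_symm_eq hy, ← symm_transition hy]
  have key : ∀ (b : Coord n →L[ℝ] Coord n →L[ℝ] ℝ) (c d : Fin n → ℝ) (u : Fin n → Coord n),
      b (∑ a, c a • u a) (∑ a, d a • u a) = ∑ a, ∑ e, c a * d e * b (u a) (u e) := by
    intro b c d u
    simp only [map_sum, map_smul, _root_.sum_apply, _root_.smul_apply, smul_eq_mul,
      Finset.mul_sum]
    rw [Finset.sum_comm]
    exact Finset.sum_congr rfl fun a _ => Finset.sum_congr rfl fun b _ => by ring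
  exact key _ _ _ _

end Charts

/-! ### The Riemannian volume measure -/

section Volume

variable {n : ℕ} {M : Type*} [TopologicalSpace M] [ChartedSpace (Coord n) M]
  [MeasurableSpace M] [BorelSpace M] {T : TwoTensorField n M}

/-- The Riemannian volume measure on the domain of the chart at `p`. -/
noncomputable def chartMeasure (T : TwoTensorField n M) (p : M) : Measure M :=
  Measure.map (extChartAt (𝓡 n) p).symm
    ((volume.restrict (extChartAt (𝓡 n) p).target).withDensity
      fun y => ENNReal.ofReal (Real.sqrt (inChart p T y).det))

omit [MeasurableSpace M] [BorelSpace M] in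
theorem measurableSet_target (p : M) : MeasurableSet (extChartAt (𝓡 n) p).target :=
  (isOpen_extChartAt_target (I := 𝓡 n) p).measurableSet

theorem measurableSet_source (p : M) : MeasurableSet (extChartAt (𝓡 n) p).source :=
  (isOpen_extChartAt_source (I := 𝓡 n) p).measurableSet

theorem aemeasurable_symm (T : TwoTensorField n M) (p : M) :
    AEMeasurable (extChartAt (𝓡 n) p).symm
      ((volume.restrict (extChartAt (𝓡 n) p).target).withDensity
        fun y => ENNReal.ofReal (Real.sqrt (inChart p T y).det)) :=
  ((continuousOn_extChartAt_symm (I := 𝓡 n) p).aemeasurable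
    (measurableSet_target p)).mono_ac (withDensity_absolutelyContinuous _ _)

/-- The inverse chart is continuous only on its target, so measurability is obtained on that subtype
and pushed forward. -/
theorem measurableSet_chart_preimage (p : M) {A : Set M} (hA : MeasurableSet A) :
    MeasurableSet ((extChartAt (𝓡 n) p).target ∩ (extChartAt (𝓡 n) p).symm ⁻¹' A) := by
  have h := (continuousOn_extChartAt_symm (I := 𝓡 n) p).domRestrict.measurable hA
  have h2 := (measurableSet_target p).subtype_image h
  convert h2 using 1
  ext y
  simp [and_comm]

theorem chartMeasure_apply (p : M) {A : Set M} (hA : MeasurableSet A) :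
    chartMeasure T p A
      = ∫⁻ y in (extChartAt (𝓡 n) p).target ∩ (extChartAt (𝓡 n) p).symm ⁻¹' A,
        ENNReal.ofReal (Real.sqrt (inChart p T y).det) := by
  set t := (extChartAt (𝓡 n) p).target with ht
  have htm : MeasurableSet t := measurableSet_target (n := n) p
  have hm := measurableSet_chart_preimage (n := n) p hA
  rw [chartMeasure, Measure.map_apply_of_aemeasurable (aemeasurable_symm T p) hA]
  set ν := (volume.restrict t).withDensity
    fun y => ENNReal.ofReal (Real.sqrt (inChart p T y).det) with hν
  have h1 : ν tᶜ = 0 := withDensity_absolutelyContinuous _ _ (by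
    rw [Measure.restrict_apply htm.compl, compl_inter_self, measure_empty])
  have h2 : ν ((extChartAt (𝓡 n) p).symm ⁻¹' A) = ν (t ∩ (extChartAt (𝓡 n) p).symm ⁻¹' A) := by
    rw [inter_comm]
    exact (measure_inter_conull h1).symm
  rw [h2, hν, withDensity_apply _ hm, Measure.restrict_restrict hm]
  congr 2
  ext y; simp only [mem_inter_iff]; tauto

theorem chartMeasure_inter_source (p : M) {A : Set M} (hA : MeasurableSet A) :
    chartMeasure T p (A ∩ (extChartAt (𝓡 n) p).source) = chartMeasure T p A := by
  rw [chartMeasure_apply p hA, chartMeasure_apply p (hA.inter (measurableSet_source p))]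
  congr 2
  ext y
  simp only [mem_inter_iff, mem_preimage]
  constructor
  · rintro ⟨h1, h2, -⟩; exact ⟨h1, h2⟩
  · rintro ⟨h1, h2⟩; exact ⟨h1, h2, (extChartAt (𝓡 n) p).map_target h1⟩

omit [TopologicalSpace M] [ChartedSpace (Coord n) M] [MeasurableSpace M] [BorelSpace M] in
theorem det_fderiv_eq_det_jac {Φ : Coord n → Coord n} {y : Coord n}
    (hΦ : DifferentiableAt ℝ Φ y) : (fderiv ℝ Φ y).det = (jac Φ y).det := by
  rw [ContinuousLinearMap.det, ← LinearMap.det_toMatrix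
    (EuclideanSpace.basisFun (Fin n) ℝ).toBasis]
  congr 1
  ext a i
  rw [jac_apply hΦ, LinearMap.toMatrix_apply]
  simp

variable [IsManifold (𝓡 n) ∞ M]

omit [MeasurableSpace M] [BorelSpace M] in
theorem sqrt_det_inChart {p q : M} {y : Coord n} (hy : y ∈ overlap n p q) :
    √(inChart p T y).det = |(jac (transition n p q) y).det|
      * √(inChart q T (transition n p q y)).det := by
  rw [inChart_eq hy, Matrix.det_mul, Matrix.det_mul, Matrix.det_transpose,
    mul_right_comm, ← pow_two, Real.sqrt_mul (sq_nonneg _), Real.sqrt_sq_eq_abs]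

/-- Change of variables along the transition map: the factor |det J| it introduces is the one by
which √det g differs between the charts. -/
theorem chartMeasure_eq_of_subset (p q : M) {A : Set M} (hA : MeasurableSet A)
    (hp : A ⊆ (extChartAt (𝓡 n) p).source) (hq : A ⊆ (extChartAt (𝓡 n) q).source) :
    chartMeasure T p A = chartMeasure T q A := by
  rw [chartMeasure_apply p hA, chartMeasure_apply q hA]
  set S := (extChartAt (𝓡 n) p).target ∩ (extChartAt (𝓡 n) p).symm ⁻¹' A with hS
  have hSo : S ⊆ overlap n p q := fun y hy => ⟨hy.1, hq hy.2⟩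
  have hd : ∀ y ∈ S, DifferentiableAt ℝ (transition n p q) y := fun y hy =>
    ((contDiffOn_transition p q).contDiffAt
      ((isOpen_overlap p q).mem_nhds (hSo hy))).differentiableAt (by simp)
  have himage : (extChartAt (𝓡 n) q).target ∩ (extChartAt (𝓡 n) q).symm ⁻¹' A
      = transition n p q '' S := by
    ext z
    constructor
    · rintro ⟨h1, h2⟩
      refine ⟨extChartAt (𝓡 n) p ((extChartAt (𝓡 n) q).symm z), ⟨?_, ?_⟩, ?_⟩
      · exact (extChartAt (𝓡 n) p).map_source (hp h2)
      · rw [mem_preimage, (extChartAt (𝓡 n) p).left_inv (hp h2)]; exact h2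
      · rw [transition, (extChartAt (𝓡 n) p).left_inv (hp h2),
          (extChartAt (𝓡 n) q).right_inv h1]
    · rintro ⟨y, hy, rfl⟩
      refine ⟨mapsTo_transition p q (hSo hy), ?_⟩
      rw [mem_preimage, symm_transition (hSo hy)]
      exact hy.2
  have hinj : InjOn (transition n p q) S := by
    intro y hy z hz hyz
    have := congrArg (extChartAt (𝓡 n) q).symm hyz
    rw [symm_transition (hSo hy), symm_transition (hSo hz)] at this
    exact (extChartAt (𝓡 n) p).symm.injOn hy.1 hz.1 this
  rw [himage, lintegral_image_eq_lintegral_abs_det_fderiv_mul volume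
    (measurableSet_chart_preimage p hA)
    (fun y hy => (hd y hy).hasFDerivAt.hasFDerivWithinAt) hinj]
  refine setLIntegral_congr_fun (measurableSet_chart_preimage p hA) fun y hy => ?_
  rw [sqrt_det_inChart (hSo hy), ENNReal.ofReal_mul (abs_nonneg _),
    det_fderiv_eq_det_jac (hd y hy)]

/-- The supremum of measures dominates the chart measure at q by definition. The converse needs one
measure that bounds all chart measures and agrees with that of q on its domain. -/
theorem volumeMeasure_apply_of_subset (q : M) {A : Set M} (hA : MeasurableSet A)
    (hq : A ⊆ (extChartAt (𝓡 n) q).source) : volumeMeasure T A = chartMeasure T q A := by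
  set U := (extChartAt (𝓡 n) q).source with hU
  have hUm : MeasurableSet U := measurableSet_source q
  have hle : ∀ p, chartMeasure T p ≤ volumeMeasure T := fun p => le_iSup (chartMeasure T) p
  refine le_antisymm ?_ (hle q A)
  -- On the domain of q every chart measure is at most that of q, by agreement on overlaps; on the
  -- complement the volume itself is the bound. The second summand vanishes on A.
  have h1 : volumeMeasure T ≤ chartMeasure T q + (volumeMeasure T).restrict Uᶜ := by
    refine iSup_le fun p => ?_
    refine Measure.le_iff.2 fun B hB => ?_
    change chartMeasure T p B ≤ _
    rw [Measure.add_apply, Measure.restrict_apply hB, ← sdiff_eq,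
      ← measure_inter_add_sdiff (μ := chartMeasure T p) B hUm]
    refine add_le_add ?_ (hle p _)
    rw [← chartMeasure_inter_source p (hB.inter hUm),
      chartMeasure_eq_of_subset p q ((hB.inter hUm).inter (measurableSet_source p))
        inter_subset_right (inter_subset_left.trans inter_subset_right)]
    exact measure_mono (inter_subset_left.trans inter_subset_left)
  refine (h1 A).trans ?_
  rw [Measure.add_apply, Measure.restrict_apply hA, disjoint_iff_inter_eq_empty.1
    (disjoint_compl_right_iff_subset.2 hq), measure_empty, add_zero]

theorem volumeMeasure_restrict_source (p : M) :
    (volumeMeasure T).restrict (extChartAt (𝓡 n) p).source = chartMeasure T p := by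
  refine Measure.ext fun A hA => ?_
  rw [Measure.restrict_apply hA, volumeMeasure_apply_of_subset p
    (hA.inter (measurableSet_source p)) inter_subset_right, chartMeasure_inter_source p hA]

omit [MeasurableSpace M] [BorelSpace M] [IsManifold (𝓡 n) ∞ M] in
theorem continuousOn_det_inChart {p : M}
    (hT : ∀ i j, ContinuousOn (fun y => inChart p T y i j) (extChartAt (𝓡 n) p).target) :
    ContinuousOn (fun y => √(inChart p T y).det) (extChartAt (𝓡 n) p).target := by
  simp only [Matrix.det_apply']
  refine ContinuousOn.sqrt ?_
  exact continuousOn_finsetSum _ fun σ _ => continuousOn_const.mul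
    (continuousOn_finsetProd _ fun i _ => hT _ _)

/-- Integrals of functions supported in a chart domain. -/
theorem integral_volumeMeasure_eq {p : M}
    (hT : ∀ i j, ContinuousOn (fun y => inChart p T y i j) (extChartAt (𝓡 n) p).target)
    {w : M → ℝ} (hw : Continuous w) (hsupp : ∀ x ∉ (extChartAt (𝓡 n) p).source, w x = 0) :
    ∫ x, w x ∂(volumeMeasure T) = ∫ y in (extChartAt (𝓡 n) p).target,
      funInChart p w y * √(inChart p T y).det := by
  rw [← setIntegral_eq_integral_of_forall_compl_eq_zero hsupp, volumeMeasure_restrict_source,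
    chartMeasure, integral_map (aemeasurable_symm T p) hw.aestronglyMeasurable,
    integral_withDensity_eq_integral_toReal_smul₀]
  · refine integral_congr_ae (Eventually.of_forall fun y => ?_)
    simp only [ENNReal.toReal_ofReal (Real.sqrt_nonneg _), smul_eq_mul, funInChart]
    ring
  · exact ((continuousOn_det_inChart hT).aemeasurable (measurableSet_target p)).ennreal_ofReal
  · exact Eventually.of_forall fun y => ENNReal.ofReal_lt_top

/-- Locally the density is continuous on a compact coordinate ball, so every point has a
neighbourhood of finite volume; compactness does the rest. -/
theorem isFiniteMeasure_volumeMeasure [CompactSpace M]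
    (hT : ∀ p i j, ContinuousOn (fun y => inChart p T y i j) (extChartAt (𝓡 n) p).target) :
    IsFiniteMeasure (volumeMeasure T) := by
  refine ⟨isCompact_univ.measure_lt_top_of_nhdsWithin fun x _ => ?_⟩
  rw [nhdsWithin_univ]
  obtain ⟨r, hr, hrt⟩ := Metric.nhds_basis_closedBall.mem_iff.1
    ((isOpen_extChartAt_target (I := 𝓡 n) x).mem_nhds (mem_extChartAt_target x))
  have hopen : IsOpen ((extChartAt (𝓡 n) x).source ∩
      extChartAt (𝓡 n) x ⁻¹' Metric.ball (extChartAt (𝓡 n) x x) r) :=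
    (continuousOn_extChartAt (I := 𝓡 n) x).isOpen_inter_preimage
      (isOpen_extChartAt_source x) Metric.isOpen_ball
  refine ⟨_, hopen.mem_nhds ⟨mem_extChartAt_source x, Metric.mem_ball_self hr⟩, ?_⟩
  rw [volumeMeasure_apply_of_subset x hopen.measurableSet inter_subset_left,
    chartMeasure_apply x hopen.measurableSet]
  refine lt_of_le_of_lt (lintegral_mono_set (t := Metric.closedBall (extChartAt (𝓡 n) x x) r) ?_)
    (((continuousOn_det_inChart (hT x)).mono hrt).integrableOn_compact
      (isCompact_closedBall _ _)).lintegral_lt_top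
  rintro y ⟨hy, -, hyb⟩
  rw [mem_preimage, (extChartAt (𝓡 n) x).right_inv hy] at hyb
  exact Metric.ball_subset_closedBall hyb

end Volume

/-! ### Integration over a coordinate domain -/

section Integration

variable {n : ℕ} {Ω K : Set (Coord n)} {s : Coord n → ℝ}

/-- Differentiation under the integral sign, for integrands supported in a fixed compact set. -/
theorem hasDerivAt_setIntegral_mul (hΩ : IsOpen Ω) (hK : IsCompact K) (hKΩ : K ⊆ Ω)
    (hs : ContinuousOn s Ω) (hsK : ∀ y ∈ Ω \ K, s y = 0) {δ : ℝ} (hδ : 0 < δ)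
    {L : ℝ → Coord n → ℝ}
    (hL : ContDiffOn ℝ ∞ (fun q : ℝ × Coord n => L q.1 q.2) (Ioo (-δ) δ ×ˢ Ω))
    {D : Coord n → ℝ} (hD : ∀ y ∈ Ω, HasDerivAt (fun t => L t y) (D y) 0) :
    HasDerivAt (fun t => ∫ y in Ω, s y * L t y) (∫ y in Ω, s y * D y) 0 := by
  have hO : IsOpen (Ioo (-δ) δ ×ˢ Ω) := isOpen_Ioo.prod hΩ
  set L' : ℝ → Coord n → ℝ := fun t y =>
    fderiv ℝ (fun q : ℝ × Coord n => L q.1 q.2) (t, y) ((1 : ℝ), (0 : Coord n)) with hL'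
  have hL'c : ContinuousOn (fun q : ℝ × Coord n => L' q.1 q.2) (Ioo (-δ) δ ×ˢ Ω) :=
    (contDiffOn_fderiv_uncurry_apply hO hL _).continuousOn
  have hd : ∀ t ∈ Ioo (-δ) δ, ∀ y ∈ Ω, HasDerivAt (fun t => L t y) (L' t y) t :=
    fun t ht y hy => hasDerivAt_fderiv_uncurry hO hL ⟨ht, hy⟩
  have h0 : (0 : ℝ) ∈ Ioo (-δ) δ := ⟨by linarith, hδ⟩
  have hred : ∀ u : Coord n → ℝ, ∫ y in Ω, s y * u y = ∫ y in K, s y * u y := fun u =>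
    setIntegral_eq_of_subset_of_forall_sdiff_eq_zero hΩ.measurableSet hKΩ fun y hy => by
      rw [hsK y hy, zero_mul]
  have hslice : ∀ {N : ℝ → Coord n → ℝ},
      ContinuousOn (fun q : ℝ × Coord n => N q.1 q.2) (Ioo (-δ) δ ×ˢ Ω) →
      ∀ t ∈ Ioo (-δ) δ, ContinuousOn (fun y => s y * N t y) K := fun {N} hN t ht =>
    (hs.mono hKΩ).mul (hN.comp (f := fun y : Coord n => (t, y)) (by fun_prop)
      fun y hy => ⟨ht, hKΩ hy⟩)
  -- A smaller closed time interval makes its product with K compact, so the time derivative has a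
  -- constant bound, integrable on K.
  have hsub : Icc (-(δ / 2)) (δ / 2) ⊆ Ioo (-δ) δ := fun t ht =>
    ⟨by linarith [ht.1], by linarith [ht.2]⟩
  have hcpt : ContinuousOn (fun q : ℝ × Coord n => s q.2 * L' q.1 q.2)
      (Icc (-(δ / 2)) (δ / 2) ×ˢ K) :=
    (hs.comp continuousOn_snd fun q hq => hKΩ hq.2).mul
      (hL'c.mono (prod_mono hsub hKΩ))
  obtain ⟨C, hC⟩ := (isCompact_Icc.prod hK).exists_bound_of_continuousOn hcpt
  have hmain := hasDerivAt_integral_of_dominated_loc_of_deriv_le (μ := volume.restrict K)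
    (F := fun t y => s y * L t y) (F' := fun t y => s y * L' t y) (x₀ := (0 : ℝ))
    (bound := fun _ => C) (s := Icc (-(δ / 2)) (δ / 2))
    (Icc_mem_nhds (by linarith) (by linarith))
    (by
      filter_upwards [isOpen_Ioo.mem_nhds h0] with t ht
      exact (hslice hL.continuousOn t ht).aestronglyMeasurable hK.measurableSet)
    ((hslice hL.continuousOn 0 h0).integrableOn_compact hK)
    ((hslice hL'c 0 h0).aestronglyMeasurable hK.measurableSet)
    (by
      filter_upwards [ae_restrict_mem hK.measurableSet] with y hy t ht
      exact hC (t, y) ⟨ht, hy⟩)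
    (integrableOn_const hK.measure_lt_top.ne)
    (by
      filter_upwards [ae_restrict_mem hK.measurableSet] with y hy t ht
      exact (hd t (hsub ht) y (hKΩ hy)).const_mul _)
  simp only [hred]
  refine hmain.2.congr_deriv ?_
  refine setIntegral_congr_fun hK.measurableSet fun y hy => ?_
  rw [(hD y (hKΩ hy)).unique (hd 0 h0 y (hKΩ hy))]

theorem integrableOn_mul_of_compact (hΩ : IsOpen Ω) (hK : IsCompact K) (hKΩ : K ⊆ Ω)
    (hs : ContinuousOn s Ω) (hsK : ∀ y ∈ Ω \ K, s y = 0) {u : Coord n → ℝ}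
    (hu : ContinuousOn u Ω) : IntegrableOn (fun y => s y * u y) Ω := by
  have h1 : IntegrableOn (fun y => s y * u y) K :=
    ((hs.mul hu).mono hKΩ).integrableOn_compact hK
  refine h1.of_forall_sdiff_eq_zero hΩ.measurableSet fun y hy => ?_
  rw [hsK y hy, zero_mul]

/-- Integration by parts for a compactly supported factor. -/
theorem setIntegral_mul_pd (hΩ : IsOpen Ω) (hK : IsCompact K) (hKΩ : K ⊆ Ω)
    (hs : ContDiffOn ℝ ∞ s Ω) (hsK : ∀ y ∈ Ω \ K, s y = 0) {W : Coord n → ℝ}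
    (hW : ContDiffOn ℝ ∞ W Ω) (i : Fin n) :
    IntegrableOn (fun y => s y * pd i W y) Ω ∧ IntegrableOn (fun y => pd i s y * W y) Ω ∧
    ∫ y in Ω, s y * pd i W y = -∫ y in Ω, pd i s y * W y := by
  have hKc : IsClosed K := hK.isClosed
  -- Extension by zero is differentiable everywhere, since it agrees with s on Ω and vanishes off
  -- the closed set K ⊆ Ω. This reduces the claim to integration by parts on all of ℝⁿ.
  set S : Coord n → ℝ := Ω.indicator s with hS
  have hSs : ∀ y ∈ Ω, S =ᶠ[𝓝 y] s := fun y hy => by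
    filter_upwards [hΩ.mem_nhds hy] with z hz using indicator_of_mem hz s
  have hS0 : ∀ y ∉ K, S y = 0 := fun y hy => by
    by_cases hyΩ : y ∈ Ω
    · rw [hS, indicator_of_mem hyΩ, hsK y ⟨hyΩ, hy⟩]
    · rw [hS, indicator_of_notMem hyΩ]
  have hS0' : ∀ y ∉ K, S =ᶠ[𝓝 y] fun _ => 0 := fun y hy => by
    filter_upwards [hKc.isOpen_compl.mem_nhds hy] with z hz using hS0 z hz
  have hpdS : ∀ y ∉ K, pd i S y = 0 := fun y hy => by
    rw [pd_congr (hS0' y hy), pd_const]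
  have hpdSs : ∀ y ∈ Ω, pd i S y = pd i s y := fun y hy => pd_congr (hSs y hy) i
  have hSd : Differentiable ℝ S := fun y => by
    by_cases hy : y ∈ Ω
    · exact (hs.differentiableAt_of_isOpen hΩ hy).congr_of_eventuallyEq (hSs y hy)
    · exact (differentiableAt_const (0 : ℝ)).congr_of_eventuallyEq
        (hS0' y fun h => hy (hKΩ h))
  have htsupp : tsupport S ⊆ K := closure_minimal (fun y hy => by
    by_contra h; exact hy (hS0 y h)) hKc
  have hint : ∀ {u : Coord n → ℝ}, (∀ y ∉ K, u y = 0) → ContinuousOn u K → Integrable u :=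
    fun {u} hu huc => (integrableOn_iff_integrable_of_support_subset (fun y hy => by
      by_contra h; exact hy (hu y h))).1 (huc.integrableOn_compact hK)
  have hScK : ContinuousOn S K := hSd.continuous.continuousOn
  have hpdSc : ContinuousOn (pd i S) K :=
    ((contDiffOn_pd hΩ hs i).continuousOn.mono hKΩ).congr fun y hy => hpdSs y (hKΩ hy)
  have hpdW : ContinuousOn (pd i W) K := (contDiffOn_pd hΩ hW i).continuousOn.mono hKΩ
  have hWc : ContinuousOn W K := hW.continuousOn.mono hKΩ
  have i1 : Integrable (fun y => pd i S y * W y) :=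
    hint (fun y hy => by rw [hpdS y hy, zero_mul]) (hpdSc.mul hWc)
  have i2 : Integrable (fun y => S y * pd i W y) :=
    hint (fun y hy => by rw [hS0 y hy, zero_mul]) (hScK.mul hpdW)
  have i3 : Integrable (fun y => S y * W y) :=
    hint (fun y hy => by rw [hS0 y hy, zero_mul]) (hScK.mul hWc)
  have hibp := integral_mul_fderiv_eq_neg_fderiv_mul_of_integrable (μ := volume)
    (v := EuclideanSpace.single i (1 : ℝ)) i1 i2 i3
    (fun y _ => hSd y) (fun y hy => hW.differentiableAt_of_isOpen hΩ (hKΩ (htsupp hy)))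
  have e1 : ∀ y ∈ Ω, S y * pd i W y = s y * pd i W y := fun y hy => by
    rw [hS, indicator_of_mem hy]
  have e2 : ∀ y ∈ Ω, pd i S y * W y = pd i s y * W y := fun y hy => by rw [hpdSs y hy]
  refine ⟨i2.integrableOn.congr_fun e1 hΩ.measurableSet,
    i1.integrableOn.congr_fun e2 hΩ.measurableSet, ?_⟩
  rw [← setIntegral_congr_fun hΩ.measurableSet e1, ← setIntegral_congr_fun hΩ.measurableSet e2,
    setIntegral_eq_integral_of_forall_compl_eq_zero fun y hy => by
      rw [hS0 y fun h => hy (hKΩ h), zero_mul],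
    setIntegral_eq_integral_of_forall_compl_eq_zero fun y hy => by
      rw [hpdS y fun h => hy (hKΩ h), zero_mul]]
  exact hibp

theorem setIntegral_mul_sum_pd (hΩ : IsOpen Ω) (hK : IsCompact K) (hKΩ : K ⊆ Ω)
    (hs : ContDiffOn ℝ ∞ s Ω) (hsK : ∀ y ∈ Ω \ K, s y = 0) {W : Fin n → Coord n → ℝ}
    (hW : ∀ i, ContDiffOn ℝ ∞ (W i) Ω) :
    IntegrableOn (fun y => s y * ∑ i, pd i (W i) y) Ω ∧
    ∫ y in Ω, s y * ∑ i, pd i (W i) y = -∫ y in Ω, ∑ i, pd i s y * W i y := by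
  have h := fun i => setIntegral_mul_pd hΩ hK hKΩ hs hsK (hW i) i
  simp only [Finset.mul_sum]
  refine ⟨integrable_finsetSum _ fun i _ => (h i).1, ?_⟩
  rw [integral_finsetSum _ fun i _ => (h i).1, integral_finsetSum _ fun i _ => (h i).2.1,
    ← Finset.sum_neg_distrib]
  exact Finset.sum_congr rfl fun i _ => (h i).2.2

end Integration

/-! ### Variations on a closed manifold -/

section GlobalVariation

variable {n : ℕ} {M : Type*} [TopologicalSpace M] [ChartedSpace (Coord n) M]

/-- A smooth family of metrics and functions, defined for `|t| < δ`, with velocity `(v, h)` at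
`t = 0`, read in charts. -/
structure IsVariation (G : ℝ → TwoTensorField n M) (F : ℝ → M → ℝ) (v : TwoTensorField n M)
    (h : M → ℝ) (δ : ℝ) : Prop where
  pos : 0 < δ
  contDiffOn_metric : ∀ p i j, ContDiffOn ℝ ∞ (fun q : ℝ × Coord n => inChart p (G q.1) q.2 i j)
    (Ioo (-δ) δ ×ˢ (extChartAt (𝓡 n) p).target)
  contDiffOn_fun : ∀ p, ContDiffOn ℝ ∞ (fun q : ℝ × Coord n => funInChart p (F q.1) q.2)
    (Ioo (-δ) δ ×ˢ (extChartAt (𝓡 n) p).target)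
  symm : ∀ t ∈ Ioo (-δ) δ, ∀ x X Y, G t x X Y = G t x Y X
  det_pos : ∀ t ∈ Ioo (-δ) δ, ∀ p, ∀ y ∈ (extChartAt (𝓡 n) p).target,
    0 < (inChart p (G t) y).det
  velocity : ∀ x X Y, HasDerivAt (fun t => G t x X Y) (v x X Y) 0
  velocity_fun : ∀ x, HasDerivAt (fun t => F t x) (h x) 0

variable {G : ℝ → TwoTensorField n M} {F : ℝ → M → ℝ} {v : TwoTensorField n M}
  {h : M → ℝ} {δ : ℝ} {t : ℝ}

/-- A function on `M` given at `x` by a chart-independent expression in the chart at `x` is given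
by that expression in every chart. -/
theorem funInChart_eq_of_invariant {Q : M → ℝ} {q : M → Coord n → ℝ}
    (hQ : ∀ x, Q x = q x (extChartAt (𝓡 n) x x))
    (hq : ∀ p r, ∀ y ∈ overlap n p r, q p y = q r (transition n p r y)) (p : M)
    {y : Coord n} (hy : y ∈ (extChartAt (𝓡 n) p).target) : funInChart p Q y = q p y := by
  rw [funInChart, hQ, hq p ((extChartAt (𝓡 n) p).symm y) y ⟨hy, mem_extChartAt_source _⟩]
  rfl

/-- Q is computed at each point in a different chart, so continuity is only visible after rewriting
Q near x by the expression in the single chart at x. -/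
theorem continuous_of_invariant {Q : M → ℝ} {q : M → Coord n → ℝ}
    (hQ : ∀ x, Q x = q x (extChartAt (𝓡 n) x x))
    (hq : ∀ p r, ∀ y ∈ overlap n p r, q p y = q r (transition n p r y))
    (hc : ∀ p, ContinuousOn (q p) (extChartAt (𝓡 n) p).target) : Continuous Q := by
  refine continuous_iff_continuousAt.2 fun x => ?_
  have h1 : ContinuousAt (fun z => q x (extChartAt (𝓡 n) x z)) x :=
    ((hc x).continuousAt ((isOpen_extChartAt_target (I := 𝓡 n) x).mem_nhds
      (mem_extChartAt_target x))).comp (continuousAt_extChartAt (I := 𝓡 n) x)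
  refine h1.congr ?_
  filter_upwards [extChartAt_source_mem_nhds (I := 𝓡 n) x] with z hz
  rw [← funInChart_eq_of_invariant hQ hq x ((extChartAt (𝓡 n) x).map_source hz), funInChart,
    (extChartAt (𝓡 n) x).left_inv hz]

theorem funInChart_transition {p r : M} {y : Coord n} (hy : y ∈ overlap n p r) (u : M → ℝ) :
    funInChart p u y = funInChart r u (transition n p r y) := by
  rw [funInChart, funInChart, symm_transition hy]

theorem inChart_transpose {g : TwoTensorField n M} (hg : ∀ x X Y, g x X Y = g x Y X) (p : M)
    (y : Coord n) : (inChart p g y).transpose = inChart p g y := by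
  ext i j
  exact hg _ _ _

/-- The trace of v read in a chart agrees with its coordinate formula only on the chart target;
local agreement suffices for two derivatives. -/
theorem lapCoord_congr {A : Coord n → Matrix (Fin n) (Fin n) ℝ} {u w : Coord n → ℝ}
    {y : Coord n} (huw : u =ᶠ[𝓝 y] w) : lapCoord A u y = lapCoord A w y := by
  have h1 : ∀ j, pd j u =ᶠ[𝓝 y] pd j w := fun j => by
    filter_upwards [eventually_eventuallyEq_nhds.2 huw] with z hz using pd_congr hz j
  simp only [lapCoord, hessianCoord]
  congr 2
  ext i j
  rw [pd_congr (h1 j)]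
  simp only [(h1 _).eq_of_nhds]

namespace IsVariation

theorem zero_mem (hV : IsVariation G F v h δ) : (0 : ℝ) ∈ Ioo (-δ) δ :=
  ⟨by linarith [hV.pos], hV.pos⟩

theorem isVelocityOn (hV : IsVariation G F v h δ) (p : M) :
    IsVelocityOn (fun t => inChart p (G t)) (inChart p v)
      (Ioo (-δ) δ ×ˢ (extChartAt (𝓡 n) p).target) where
  isOpen := isOpen_Ioo.prod (isOpen_extChartAt_target p)
  contDiffOn := hV.contDiffOn_metric p
  symm q hq := inChart_transpose (hV.symm q.1 hq.1) p q.2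
  det_pos q hq := hV.det_pos q.1 hq.1 p q.2 hq.2
  hasMDerivAt _ _ _ _ := hV.velocity _ _ _

theorem slice_eq (p : M) (ht : t ∈ Ioo (-δ) δ) :
    {z : Coord n | (t, z) ∈ Ioo (-δ) δ ×ˢ (extChartAt (𝓡 n) p).target}
      = (extChartAt (𝓡 n) p).target := by
  ext z; simp [ht.1, ht.2]

theorem isMetricOn (hV : IsVariation G F v h δ) (ht : t ∈ Ioo (-δ) δ) (p : M) :
    IsMetricOn (inChart p (G t)) (extChartAt (𝓡 n) p).target := by
  have := (hV.isVelocityOn p).slice t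
  rwa [slice_eq p ht] at this

theorem contDiffOn_velocity (hV : IsVariation G F v h δ) (p : M) (i j : Fin n) :
    ContDiffOn ℝ ∞ (fun y => inChart p v y i j) (extChartAt (𝓡 n) p).target := by
  have := (hV.isVelocityOn p).contDiffOn_velocity i j
  rwa [slice_eq p hV.zero_mem] at this

theorem contDiffOn_funInChart (hV : IsVariation G F v h δ) (ht : t ∈ Ioo (-δ) δ) (p : M) :
    ContDiffOn ℝ ∞ (funInChart p (F t)) (extChartAt (𝓡 n) p).target := by
  have := contDiffOn_slice (U := fun t => funInChart p (F t)) (hV.contDiffOn_fun p) t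
  rwa [slice_eq p ht] at this

theorem contDiffOn_velocity_fun (hV : IsVariation G F v h δ) (p : M) :
    ContDiffOn ℝ ∞ (funInChart p h) (extChartAt (𝓡 n) p).target := by
  have := contDiffOn_of_hasDerivAt (t := 0) (U := fun t => funInChart p (F t))
    (hV.isVelocityOn p).isOpen (hV.contDiffOn_fun p) (u := funInChart p h)
    fun z _ => hV.velocity_fun _
  rwa [slice_eq p hV.zero_mem] at this

variable [IsManifold (𝓡 n) ∞ M]

theorem isPullbackOn (hV : IsVariation G F v h δ) (ht : t ∈ Ioo (-δ) δ) (p r : M) :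
    IsPullbackOn (transition n p r) (inChart p (G t)) (overlap n p r)
      (inChart r (G t)) (extChartAt (𝓡 n) r).target where
  source := (hV.isMetricOn ht p).mono (isOpen_overlap p r) inter_subset_left
  target := hV.isMetricOn ht r
  mapsTo := mapsTo_transition p r
  contDiffOn := contDiffOn_transition p r
  eq _ hz := inChart_eq hz (G t)

/-- The first variation of the scalar curvature. -/
theorem hasDerivAt_scalarCurvature (hV : IsVariation G F v h δ) (x : M) :
    HasDerivAt (fun t => scalarCurvature (G t) x)
      (-laplacian (G 0) (trace (G 0) v) x + divDiv (G 0) v x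
        - pairWith (comps (G 0) x) (ricci (G 0) x) (comps v x)) 0 := by
  have hx : extChartAt (𝓡 n) x x ∈ (extChartAt (𝓡 n) x).target := mem_extChartAt_target x
  have hm := hV.isMetricOn hV.zero_mem x
  have h1 := (hV.isVelocityOn x).hasDerivAt_scalCoord (y := extChartAt (𝓡 n) x x)
    ⟨hV.zero_mem, hx⟩
  refine h1.congr_deriv ?_
  -- The Laplacian differentiates tr v, whose values near x are computed in other charts; its
  -- invariance moves them to the chart at x.
  have h2 : laplacian (G 0) (trace (G 0) v) x
      = lapCoord (inChart x (G 0)) (trCoord (inChart x (G 0)) (inChart x v))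
        (extChartAt (𝓡 n) x x) := by
    refine lapCoord_congr (u := funInChart x (trace (G 0) v)) ?_
    filter_upwards [hm.mem_nhds hx] with y hy
    exact funInChart_eq_of_invariant (q := fun p => trCoord (inChart p (G 0)) (inChart p v))
      (fun _ => rfl) (fun p r y hy => (hV.isPullbackOn hV.zero_mem p r).trCoord_eq hy
        fun z hz => inChart_eq hz v) x hy
  rw [h2, pairWith_comm (hm.inv_symm hx) (inChart x v _)]
  rfl

theorem energyCoord_invariant (hV : IsVariation G F v h δ) (ht : t ∈ Ioo (-δ) δ) (p r : M)
    (y : Coord n) (hy : y ∈ overlap n p r) :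
    energyCoord (inChart p (G t)) (funInChart p (F t)) y
      = energyCoord (inChart r (G t)) (funInChart r (F t)) (transition n p r y) :=
  (hV.isPullbackOn ht p r).energyCoord_eq hy (hV.contDiffOn_funInChart ht r)
    fun _ hz => funInChart_transition hz _

omit [IsManifold (𝓡 n) ∞ M] in
theorem contDiffOn_energy (hV : IsVariation G F v h δ) (p : M) :
    ContDiffOn ℝ ∞ (fun q : ℝ × Coord n =>
      energyCoord (inChart p (G q.1)) (funInChart p (F q.1)) q.2)
      (Ioo (-δ) δ ×ˢ (extChartAt (𝓡 n) p).target) := by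
  have h1 := (hV.isVelocityOn p).contDiffOn_scalCoord
  have h2 := (hV.isVelocityOn p).contDiffOn_gradCoord (U := fun t => funInChart p (F t))
    (W := fun t => funInChart p (F t)) (hV.contDiffOn_fun p) (hV.contDiffOn_fun p)
  have h3 := (hV.contDiffOn_fun p).neg.exp
  simp only [energyCoord]
  exact (h1.add h2).mul h3

omit [IsManifold (𝓡 n) ∞ M] in
theorem energyDensity_eq (g : TwoTensorField n M) (f : M → ℝ) (x : M) :
    energyDensity g f x
      = energyCoord (inChart x g) (funInChart x f) (extChartAt (𝓡 n) x x) := by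
  rw [energyDensity, energyCoord, funInChart, extChartAt_to_inv]
  rfl

omit [IsManifold (𝓡 n) ∞ M] in
theorem variationDensity_eq (g : TwoTensorField n M) (f : M → ℝ) (v : TwoTensorField n M)
    (h : M → ℝ) (x : M) :
    variationDensity g f v h x = variationCoord (inChart x g) (funInChart x f) (inChart x v)
      (funInChart x h) (extChartAt (𝓡 n) x x) := by
  rw [variationDensity, variationCoord, funInChart, funInChart, extChartAt_to_inv]
  rfl

theorem continuous_energyDensity (hV : IsVariation G F v h δ) (ht : t ∈ Ioo (-δ) δ) :
    Continuous (energyDensity (G t) (F t)) :=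
  continuous_of_invariant (q := fun p => energyCoord (inChart p (G t)) (funInChart p (F t)))
    (energyDensity_eq _ _) (hV.energyCoord_invariant ht) fun p => by
      have := (contDiffOn_slice (U := fun t => energyCoord (inChart p (G t)) (funInChart p (F t)))
        (hV.contDiffOn_energy p) t).continuousOn
      rwa [slice_eq p ht] at this

theorem variationCoord_invariant (hV : IsVariation G F v h δ) (p r : M)
    (y : Coord n) (hy : y ∈ overlap n p r) :
    variationCoord (inChart p (G 0)) (funInChart p (F 0)) (inChart p v) (funInChart p h) y
      = variationCoord (inChart r (G 0)) (funInChart r (F 0)) (inChart r v) (funInChart r h)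
        (transition n p r y) :=
  (hV.isPullbackOn hV.zero_mem p r).variationCoord_eq hy
    (hV.contDiffOn_funInChart hV.zero_mem r) (fun _ hz => funInChart_transition hz _)
    (fun _ hz => inChart_eq hz v) (fun _ hz => funInChart_transition hz _)

end IsVariation

theorem IsMetricOn.contDiffOn_variationCoord {A B : Coord n → Matrix (Fin n) (Fin n) ℝ}
    {Ω : Set (Coord n)} {u w : Coord n → ℝ} (hm : IsMetricOn A Ω)
    (hu : ContDiffOn ℝ ∞ u Ω) (hB : ∀ i j, ContDiffOn ℝ ∞ (fun z => B z i j) Ω)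
    (hw : ContDiffOn ℝ ∞ w Ω) : ContDiffOn ℝ ∞ (variationCoord A u B w) Ω := by
  -- A constant family, so that smoothness of Ricci is the time slice of the result for families.
  have hfam : IsMetricFamilyOn (fun _ => A) (univ ×ˢ Ω) :=
    ⟨isOpen_univ.prod hm.isOpen, fun i j => (hm.contDiffOn i j).comp contDiffOn_snd
      fun q hq => hq.2, fun q hq => hm.symm q.2 hq.2, fun q hq => hm.det_pos q.2 hq.2⟩
  have hs : {z : Coord n | ((0 : ℝ), z) ∈ (univ : Set ℝ) ×ˢ Ω} = Ω := by ext z; simp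
  have hric : ∀ i j, ContDiffOn ℝ ∞ (fun z => ricciCoord A z i j) Ω := fun i j => by
    have := contDiffOn_slice (U := fun _ z => ricciCoord A z i j)
      (hfam.contDiffOn_ricciCoord i j) 0
    rwa [hs] at this
  have hgrad : ContDiffOn ℝ ∞ (gradCoord A u u) Ω :=
    contDiffOn_traceWith hm.contDiffOn hm.det_pos fun i j =>
      (contDiffOn_pd hm.isOpen hu i).mul (contDiffOn_pd hm.isOpen hu j)
  have hscal : ContDiffOn ℝ ∞ (scalCoord A) Ω :=
    contDiffOn_traceWith hm.contDiffOn hm.det_pos hric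
  have hhess : ∀ i j, ContDiffOn ℝ ∞ (fun z => hessianCoord A u z i j) Ω := fun i j => by
    simp only [hessianCoord, Matrix.of_apply]
    exact (contDiffOn_pd hm.isOpen (contDiffOn_pd hm.isOpen hu j) i).sub
      (ContDiffOn.sum fun k _ => (hm.contDiffOn_christoffel k i j).mul
        (contDiffOn_pd hm.isOpen hu k))
  have hpair : ContDiffOn ℝ ∞ (fun z =>
      pairWith (A z) (B z) (ricciCoord A z + hessianCoord A u z)) Ω := by
    simp only [pairWith, Matrix.add_apply]
    exact ContDiffOn.sum fun i _ => ContDiffOn.sum fun j _ => ContDiffOn.sum fun a _ =>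
      ContDiffOn.sum fun b _ => (((hm.contDiffOn_inv i a).mul (hm.contDiffOn_inv j b)).mul
        (hB i j)).mul ((hric a b).add (hhess a b))
  have hlap : ContDiffOn ℝ ∞ (lapCoord A u) Ω :=
    contDiffOn_traceWith hm.contDiffOn hm.det_pos hhess
  have hexp := hu.neg.exp
  have htr := (hm.contDiffOn_trCoord hB).div_const 2
  have hlast := ((contDiffOn_const (c := (2 : ℝ))).mul hlap).sub hgrad |>.add hscal
  exact hexp.mul (hpair.neg.add ((htr.sub hw).mul hlast))

namespace IsVariation

variable [IsManifold (𝓡 n) ∞ M]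

omit [IsManifold (𝓡 n) ∞ M] in
theorem contDiffOn_variationCoord (hV : IsVariation G F v h δ) (p : M) :
    ContDiffOn ℝ ∞ (variationCoord (inChart p (G 0)) (funInChart p (F 0)) (inChart p v)
      (funInChart p h)) (extChartAt (𝓡 n) p).target :=
  (hV.isMetricOn hV.zero_mem p).contDiffOn_variationCoord
    (hV.contDiffOn_funInChart hV.zero_mem p) (hV.contDiffOn_velocity p)
    (hV.contDiffOn_velocity_fun p)

theorem continuous_variationDensity (hV : IsVariation G F v h δ) :
    Continuous (variationDensity (G 0) (F 0) v h) :=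
  continuous_of_invariant (q := fun p => variationCoord (inChart p (G 0)) (funInChart p (F 0))
    (inChart p v) (funInChart p h)) (variationDensity_eq _ _ _ _) hV.variationCoord_invariant
    fun p => (hV.contDiffOn_variationCoord p).continuousOn

end IsVariation

/-- The weighted pairing of `dχ` with the flux, as a function on `M`. -/
noncomputable def fluxOn (g : TwoTensorField n M) (f : M → ℝ) (v : TwoTensorField n M)
    (h χ : M → ℝ) (x : M) : ℝ :=
  fluxPairing (inChart x g) (funInChart x f) (inChart x v) (funInChart x h) (funInChart x χ)
    (extChartAt (𝓡 n) x x)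

/-- Only dχ enters. This shows that the flux term of a cutoff vanishes off its chart domain. -/
theorem fluxOn_eq_zero {g : TwoTensorField n M} {f : M → ℝ} {χ : M → ℝ} {x : M} {c : ℝ}
    (hχ : χ =ᶠ[𝓝 x] fun _ => c) : fluxOn g f v h χ x = 0 := by
  have h1 : funInChart x χ =ᶠ[𝓝 (extChartAt (𝓡 n) x x)] fun _ => c := by
    have h2 : Tendsto (extChartAt (𝓡 n) x).symm (𝓝 (extChartAt (𝓡 n) x x)) (𝓝 x) := by
      have := continuousAt_extChartAt_symm (I := 𝓡 n) x
      rwa [ContinuousAt, extChartAt_to_inv] at this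
    exact h2.eventually hχ
  have h3 : ∀ i, pd i (funInChart x χ) (extChartAt (𝓡 n) x x) = 0 := fun i => by
    rw [pd_congr h1, pd_const]
  simp only [fluxOn, fluxPairing, traceWith, Matrix.of_apply, h3, zero_mul, mul_zero,
    Finset.sum_const_zero]

namespace IsVariation

variable [IsManifold (𝓡 n) ∞ M]

theorem fluxPairing_invariant (hV : IsVariation G F v h δ) {χ : M → ℝ}
    (hχ : ContMDiff (𝓡 n) 𝓘(ℝ, ℝ) ∞ χ) (p r : M) (y : Coord n) (hy : y ∈ overlap n p r) :
    fluxPairing (inChart p (G 0)) (funInChart p (F 0)) (inChart p v) (funInChart p h)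
        (funInChart p χ) y
      = fluxPairing (inChart r (G 0)) (funInChart r (F 0)) (inChart r v) (funInChart r h)
        (funInChart r χ) (transition n p r y) :=
  (hV.isPullbackOn hV.zero_mem p r).fluxPairing_eq hy
    (hV.contDiffOn_funInChart hV.zero_mem r) (fun _ hz => funInChart_transition hz _)
    (hV.contDiffOn_velocity r) (fun _ hz => inChart_eq hz v)
    (fun _ hz => funInChart_transition hz _) (contDiffOn_funInChart_of_contMDiff hχ r)
    (fun _ hz => funInChart_transition hz _)

theorem continuous_fluxOn (hV : IsVariation G F v h δ) {χ : M → ℝ}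
    (hχ : ContMDiff (𝓡 n) 𝓘(ℝ, ℝ) ∞ χ) : Continuous (fluxOn (G 0) (F 0) v h χ) :=
  continuous_of_invariant (q := fun p => fluxPairing (inChart p (G 0)) (funInChart p (F 0))
    (inChart p v) (funInChart p h) (funInChart p χ)) (fun _ => rfl)
    (hV.fluxPairing_invariant hχ) fun p => by
      have hm := hV.isMetricOn hV.zero_mem p
      have hf := hV.contDiffOn_funInChart hV.zero_mem p
      exact (hf.neg.exp.mul (contDiffOn_traceWith hm.contDiffOn hm.det_pos fun i b =>
        (contDiffOn_pd hm.isOpen (contDiffOn_funInChart_of_contMDiff hχ p) i).mul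
          (hm.contDiffOn_fluxCoord (hV.contDiffOn_velocity p) hf
            (hV.contDiffOn_velocity_fun p) b))).continuousOn

end IsVariation

/-- The pairing is linear in dχ, and ∑ dχ_a = d1 = 0. This pointwise cancellation removes all
boundary-type terms. -/
theorem sum_fluxOn_eq_zero [IsManifold (𝓡 n) ∞ M] {g : TwoTensorField n M} {f : M → ℝ}
    {ι : Type*} {I : Finset ι} {χ : ι → M → ℝ}
    (hχ : ∀ a, ContMDiff (𝓡 n) 𝓘(ℝ, ℝ) ∞ (χ a)) (hsum : ∀ x, ∑ a ∈ I, χ a x = 1) (x : M) :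
    ∑ a ∈ I, fluxOn g f v h (χ a) x = 0 := by
  have hx : extChartAt (𝓡 n) x x ∈ (extChartAt (𝓡 n) x).target := mem_extChartAt_target x
  have h1 : ∀ i, ∑ a ∈ I, pd i (funInChart x (χ a)) (extChartAt (𝓡 n) x x) = 0 := fun i => by
    rw [← pd_sum fun a _ => (contDiffOn_funInChart_of_contMDiff (hχ a) x
      ).differentiableAt_of_isOpen (isOpen_extChartAt_target (I := 𝓡 n) x) hx]
    have : (fun z => ∑ a ∈ I, funInChart x (χ a) z) = fun _ : Coord n => (1 : ℝ) :=
      funext fun z => hsum _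
    rw [this, pd_const]
  simp only [fluxOn, fluxPairing, traceWith, Matrix.of_apply, ← Finset.mul_sum]
  rw [Finset.sum_comm]
  refine mul_eq_zero_of_right _ (Finset.sum_eq_zero fun i _ => ?_)
  rw [Finset.sum_comm]
  refine Finset.sum_eq_zero fun b _ => ?_
  rw [← Finset.mul_sum, ← Finset.sum_mul, h1, zero_mul, mul_zero]

end GlobalVariation

/-! ### The first variation of Perelman's functional -/

section ChartVariation

variable {n : ℕ} {M : Type*} [TopologicalSpace M] [ChartedSpace (Coord n) M]
  [IsManifold (𝓡 n) ∞ M] {G : ℝ → TwoTensorField n M} {F : ℝ → M → ℝ} {v : TwoTensorField n M}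
  {h χ : M → ℝ} {δ t : ℝ}

/-- In a compact manifold, a smooth partition of unity consisting of finitely many functions, each
supported in the domain of a chart. -/
theorem exists_finite_partition (n : ℕ) (M : Type*) [TopologicalSpace M]
    [ChartedSpace (Coord n) M] [IsManifold (𝓡 n) ∞ M] [CompactSpace M] [T2Space M] :
    ∃ (I : Finset M) (χ : M → M → ℝ), (∀ a, ContMDiff (𝓡 n) 𝓘(ℝ, ℝ) ∞ (χ a)) ∧
      (∀ a, tsupport (χ a) ⊆ (extChartAt (𝓡 n) a).source) ∧ ∀ x, ∑ a ∈ I, χ a x = 1 := by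
  obtain ⟨ρ, hρ⟩ := SmoothPartitionOfUnity.exists_isSubordinate_chartAt_source (𝓡 n) M
  -- Local finiteness on a compact space leaves finitely many nonempty supports, so the sum is
  -- finite.
  have hfin := ρ.locallyFinite.finite_nonempty_of_compact
  refine ⟨hfin.toFinset, fun a => ρ a, fun a => (ρ a).contMDiff, fun a => ?_, fun x => ?_⟩
  · rw [extChartAt_source]
    exact hρ a
  · rw [← ρ.sum_eq_one (mem_univ x)]
    refine (finsum_eq_finsetSum_of_support_subset _ fun a ha => ?_).symm
    exact hfin.mem_toFinset.2 ⟨x, ha⟩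

omit [IsManifold (𝓡 n) ∞ M] in
theorem isCompact_image_tsupport [CompactSpace M] {a : M}
    (hχ : tsupport χ ⊆ (extChartAt (𝓡 n) a).source) :
    IsCompact (extChartAt (𝓡 n) a '' tsupport χ) ∧
      extChartAt (𝓡 n) a '' tsupport χ ⊆ (extChartAt (𝓡 n) a).target ∧
      ∀ y ∈ (extChartAt (𝓡 n) a).target \ extChartAt (𝓡 n) a '' tsupport χ,
        funInChart a χ y = 0 := by
  refine ⟨(isClosed_tsupport χ).isCompact.image_of_continuousOn
    ((continuousOn_extChartAt (I := 𝓡 n) a).mono hχ), ?_, fun y hy => ?_⟩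
  · rintro _ ⟨x, hx, rfl⟩
    exact (extChartAt (𝓡 n) a).map_source (hχ hx)
  · by_contra h0
    exact hy.2 ⟨_, subset_tsupport χ h0, (extChartAt (𝓡 n) a).right_inv hy.1⟩

namespace IsVariation

omit [IsManifold (𝓡 n) ∞ M] in
theorem continuousOn_inChart (hV : IsVariation G F v h δ) (ht : t ∈ Ioo (-δ) δ) (p : M)
    (i j : Fin n) :
    ContinuousOn (fun y => inChart p (G t) y i j) (extChartAt (𝓡 n) p).target :=
  ((hV.isMetricOn ht p).contDiffOn i j).continuousOn

variable [CompactSpace M] [MeasurableSpace M] [BorelSpace M]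

theorem integrable_of_continuous (hV : IsVariation G F v h δ) (ht : t ∈ Ioo (-δ) δ)
    {w : M → ℝ} (hw : Continuous w) : Integrable w (volumeMeasure (G t)) := by
  have := isFiniteMeasure_volumeMeasure (T := G t) (hV.continuousOn_inChart ht)
  exact hw.integrable_of_hasCompactSupport (HasCompactSupport.of_compactSpace w)

omit [CompactSpace M] in
theorem integral_mul_eq (hV : IsVariation G F v h δ) (ht : t ∈ Ioo (-δ) δ) {a : M}
    (hχ : Continuous χ) (hsupp : tsupport χ ⊆ (extChartAt (𝓡 n) a).source)
    {w : M → ℝ} (hw : Continuous w) {q : Coord n → ℝ}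
    (hq : ∀ y ∈ (extChartAt (𝓡 n) a).target, funInChart a w y = q y) :
    ∫ x, χ x * w x ∂(volumeMeasure (G t)) = ∫ y in (extChartAt (𝓡 n) a).target,
      funInChart a χ y * (q y * √(inChart a (G t) y).det) := by
  rw [integral_volumeMeasure_eq (p := a) (w := fun x => χ x * w x)
    (hV.continuousOn_inChart ht a) (hχ.mul hw)]
  · refine setIntegral_congr_fun (measurableSet_target a) fun y hy => ?_
    rw [← hq y hy, ← mul_assoc]
    rfl
  · intro x hx
    rw [image_eq_zero_of_notMem_tsupport fun hc => hx (hsupp hc), zero_mul]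

/-- The first variation of the part of the functional cut out by a function supported in a chart. -/
theorem hasDerivAt_integral_mul_energyDensity (hV : IsVariation G F v h δ) {a : M}
    (hχ : ContMDiff (𝓡 n) 𝓘(ℝ, ℝ) ∞ χ) (hsupp : tsupport χ ⊆ (extChartAt (𝓡 n) a).source) :
    HasDerivAt (fun t => ∫ x, χ x * energyDensity (G t) (F t) x ∂(volumeMeasure (G t)))
      (∫ x, χ x * variationDensity (G 0) (F 0) v h x ∂(volumeMeasure (G 0))
        - ∫ x, fluxOn (G 0) (F 0) v h χ x ∂(volumeMeasure (G 0))) 0 := by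
  obtain ⟨hK, hKΩ, hsK⟩ := isCompact_image_tsupport hsupp
  set Ω := (extChartAt (𝓡 n) a).target with hΩdef
  have hΩ : IsOpen Ω := isOpen_extChartAt_target (I := 𝓡 n) a
  have h0 := hV.zero_mem
  have hm := hV.isMetricOn h0 a
  have hf := hV.contDiffOn_funInChart h0 a
  have hs : ContDiffOn ℝ ∞ (funInChart a χ) Ω := contDiffOn_funInChart_of_contMDiff hχ a
  have hvel := hV.isVelocityOn a
  have hchart : ∀ t ∈ Ioo (-δ) δ,
      ∫ x, χ x * energyDensity (G t) (F t) x ∂(volumeMeasure (G t)) = ∫ y in Ω, funInChart a χ y *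
        (energyCoord (inChart a (G t)) (funInChart a (F t)) y * √(inChart a (G t) y).det) :=
    fun t ht => hV.integral_mul_eq ht hχ.continuous hsupp (hV.continuous_energyDensity ht)
      fun y hy => funInChart_eq_of_invariant
        (q := fun p => energyCoord (inChart p (G t)) (funInChart p (F t)))
        (energyDensity_eq _ _) (hV.energyCoord_invariant ht) a hy
  have hL := (hV.contDiffOn_energy a).mul hvel.contDiffOn_sqrt_det
  set W : Fin n → Coord n → ℝ := fun i z => √(inChart a (G 0) z).det *
    (Real.exp (-funInChart a (F 0) z) * ∑ b, (inChart a (G 0) z)⁻¹ i b *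
      fluxCoord (inChart a (G 0)) (funInChart a (F 0)) (inChart a v) (funInChart a h) b z) with hW
  have hWc : ∀ i, ContDiffOn ℝ ∞ (W i) Ω := fun i => by
    have e := hf.neg.exp
    have s := ContDiffOn.sum (s := Finset.univ) fun b (_ : b ∈ Finset.univ) =>
      (hm.contDiffOn_inv i b).mul (hm.contDiffOn_fluxCoord (hV.contDiffOn_velocity a) hf
        (hV.contDiffOn_velocity_fun a) b)
    exact hm.contDiffOn_sqrt_det.mul (e.mul s)
  have hder := hasDerivAt_setIntegral_mul hΩ hK hKΩ hs.continuousOn hsK hV.pos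
    (L := fun t y => energyCoord (inChart a (G t)) (funInChart a (F t)) y
      * √(inChart a (G t) y).det) hL
    fun y hy => hvel.hasDerivAt_energyCoord (y := y) ⟨h0, hy⟩ (hV.contDiffOn_fun a)
      (h := funInChart a h) fun z _ => hV.velocity_fun _
  have hder' := hder.congr_of_eventuallyEq
    (f₁ := fun t => ∫ x, χ x * energyDensity (G t) (F t) x ∂(volumeMeasure (G t)))
    (by filter_upwards [isOpen_Ioo.mem_nhds h0] with t ht using hchart t ht)
  refine hder'.congr_deriv ?_
  have hibp := setIntegral_mul_sum_pd hΩ hK hKΩ hs hsK hWc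
  have hvar := (hV.contDiffOn_variationCoord a).continuousOn.mul
    hm.contDiffOn_sqrt_det.continuousOn
  -- The term left by integration by parts is written intrinsically on M, so that contributions from
  -- different charts can be added pointwise.
  have hflux : ∫ x, fluxOn (G 0) (F 0) v h χ x ∂(volumeMeasure (G 0))
      = ∫ y in Ω, ∑ i, pd i (funInChart a χ) y * W i y := by
    rw [integral_volumeMeasure_eq (p := a) (hV.continuousOn_inChart h0 a)
      (hV.continuous_fluxOn hχ)]
    · refine setIntegral_congr_fun hΩ.measurableSet fun y hy => ?_
      have := funInChart_eq_of_invariant (Q := fluxOn (G 0) (F 0) v h χ)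
        (q := fun p => fluxPairing (inChart p (G 0)) (funInChart p (F 0))
        (inChart p v) (funInChart p h) (funInChart p χ)) (fun _ => rfl)
        (hV.fluxPairing_invariant hχ) a hy
      simp only [this, fluxPairing, traceWith, Matrix.of_apply, hW, Finset.mul_sum, Finset.sum_mul]
      exact Finset.sum_congr rfl fun i _ => Finset.sum_congr rfl fun b _ => by ring
    · intro x hx
      refine fluxOn_eq_zero (c := 0) ?_
      exact notMem_tsupport_iff_eventuallyEq.1 fun hc => hx (hsupp hc)
  rw [hflux, hV.integral_mul_eq h0 hχ.continuous hsupp hV.continuous_variationDensity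
    fun y hy => funInChart_eq_of_invariant
      (q := fun p => variationCoord (inChart p (G 0)) (funInChart p (F 0)) (inChart p v)
        (funInChart p h)) (variationDensity_eq _ _ _ _) hV.variationCoord_invariant a hy,
    sub_eq_add_neg, ← hibp.2]
  refine Eq.trans ?_ (integral_add (integrableOn_mul_of_compact hΩ hK hKΩ
    hs.continuousOn hsK hvar) hibp.1)
  refine setIntegral_congr_fun hΩ.measurableSet fun y _ => ?_
  exact mul_add _ _ _

/-- The first variation of Perelman's functional. -/
theorem hasDerivAt_functionalF [T2Space M] (hV : IsVariation G F v h δ) :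
    HasDerivAt (fun t => functionalF (G t) (F t))
      (∫ x, variationDensity (G 0) (F 0) v h x ∂(volumeMeasure (G 0))) 0 := by
  obtain ⟨I, χ, hχ, hsupp, hsum⟩ := exists_finite_partition n M
  have h0 := hV.zero_mem
  have hsplit : ∀ t ∈ Ioo (-δ) δ, ∀ w : M → ℝ, Continuous w →
      ∫ x, w x ∂(volumeMeasure (G t)) = ∑ a ∈ I, ∫ x, χ a x * w x ∂(volumeMeasure (G t)) :=
    fun t ht w hw => by
      rw [← integral_finsetSum (f := fun a x => χ a x * w x) _ fun a _ =>
        hV.integrable_of_continuous ht ((hχ a).continuous.mul hw)]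
      simp only [← Finset.sum_mul, hsum, one_mul]
  have hder := HasDerivAt.fun_sum fun a (_ : a ∈ I) =>
    hV.hasDerivAt_integral_mul_energyDensity (hχ a) (hsupp a)
  have hder' := hder.congr_of_eventuallyEq (f₁ := fun t => functionalF (G t) (F t)) (by
    filter_upwards [isOpen_Ioo.mem_nhds h0] with t ht
    exact hsplit t ht _ (hV.continuous_energyDensity ht))
  refine hder'.congr_deriv ?_
  rw [Finset.sum_sub_distrib, ← hsplit 0 h0 _ hV.continuous_variationDensity,
    ← integral_finsetSum _ fun a _ =>
      hV.integrable_of_continuous h0 (hV.continuous_fluxOn (hχ a))]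
  simp only [sum_fluxOn_eq_zero hχ hsum, integral_zero, sub_zero]

end IsVariation

end ChartVariation

/-! ### Positivity of nearby metrics -/

section Positivity

variable {n : ℕ} {M : Type*} [TopologicalSpace M] [ChartedSpace (Coord n) M]
  [IsManifold (𝓡 n) ∞ M]

/-- The derivative of the chart is a left inverse. -/
theorem mfderiv_symm_injective (p : M) {y : Coord n} (hy : y ∈ (extChartAt (𝓡 n) p).target)
    {u : Coord n} (hu : (mfderiv (𝓡 n) (𝓡 n) (extChartAt (𝓡 n) p).symm y u : Coord n) = 0) :
    u = 0 := by
  have : IsManifold (𝓡 n) 1 M := .of_le (n := ∞) (by simp)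
  have h1 := mfderiv_extChartAt_comp_mfderivWithin_extChartAt_symm (I := 𝓡 n) hy
  rw [ModelWithCorners.range_eq_univ, mfderivWithin_univ] at h1
  have h2 := congrArg (fun L : Coord n →L[ℝ] Coord n => L u) h1
  change mfderiv (𝓡 n) (𝓡 n) (extChartAt (𝓡 n) p) ((extChartAt (𝓡 n) p).symm y)
    (mfderiv (𝓡 n) (𝓡 n) (extChartAt (𝓡 n) p).symm y u) = u at h2
  rw [← h2]
  exact (congrArg _ hu).trans (map_zero _)

theorem posDef_inChart {g : TwoTensorField n M} (hsymm : ∀ x X Y, g x X Y = g x Y X)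
    (hpos : ∀ x X, X ≠ 0 → 0 < g x X X) (p : M) {y : Coord n}
    (hy : y ∈ (extChartAt (𝓡 n) p).target) : (inChart p g y).PosDef := by
  refine Matrix.PosDef.of_dotProduct_mulVec_pos ?_ fun c hc => ?_
  · rw [Matrix.IsHermitian, Matrix.conjTranspose_eq_transpose_of_trivial]
    exact inChart_transpose hsymm p y
  · set D : Coord n →L[ℝ] Coord n := mfderiv (𝓡 n) (𝓡 n) (extChartAt (𝓡 n) p).symm y with hD
    set b : Coord n →L[ℝ] Coord n →L[ℝ] ℝ := g ((extChartAt (𝓡 n) p).symm y) with hb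
    set u : Coord n := ∑ i, c i • EuclideanSpace.single i (1 : ℝ) with hu
    have hui : ∀ i, u i = c i := fun i => by
      simp [hu, Finset.sum_apply, Pi.single_apply]
    have hu0 : u ≠ 0 := fun h0 => hc (funext fun i => by rw [← hui, h0]; rfl)
    have h1 : 0 < b (D u) (D u) := hpos _ _ fun h0 => hu0 (mfderiv_symm_injective p hy h0)
    refine h1.trans_eq ?_
    have h2 : ∀ i j, inChart p g y i j
      = b (D (EuclideanSpace.single i 1)) (D (EuclideanSpace.single j 1)) := fun _ _ => rfl
    simp only [hu, map_sum, map_smul, _root_.sum_apply, _root_.smul_apply, smul_eq_mul,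
      dotProduct, Matrix.mulVec, h2, star_trivial, Finset.mul_sum]
    rw [Finset.sum_comm]
    exact Finset.sum_congr rfl fun i _ => Finset.sum_congr rfl fun j _ => by ring

theorem det_inChart {p q : M} {y : Coord n} (hy : y ∈ overlap n p q) (T : TwoTensorField n M) :
    (inChart p T y).det
      = (jac (transition n p q) y).det ^ 2 * (inChart q T (transition n p q y)).det := by
  rw [inChart_eq hy, Matrix.det_mul, Matrix.det_mul, Matrix.det_transpose]
  ring

/-- A continuous family of tensors through a metric has positive determinant for small times. -/
theorem eventually_det_inChart_pos [CompactSpace M] {G : ℝ → TwoTensorField n M} {ε : ℝ}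
    (hε : 0 < ε)
    (hG : ∀ p i j, ContDiffOn ℝ ∞ (fun q : ℝ × Coord n => inChart p (G q.1) q.2 i j)
      (Ioo (-ε) ε ×ˢ (extChartAt (𝓡 n) p).target))
    (hpos : ∀ p, ∀ y ∈ (extChartAt (𝓡 n) p).target, 0 < (inChart p (G 0) y).det) :
    ∀ᶠ t in 𝓝 (0 : ℝ), ∀ p, ∀ y ∈ (extChartAt (𝓡 n) p).target, 0 < (inChart p (G t) y).det := by
  have key : ∀ᶠ t in 𝓝 (0 : ℝ), ∀ x ∈ (univ : Set M), ∀ p, x ∈ (extChartAt (𝓡 n) p).source →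
      0 < (inChart p (G t) (extChartAt (𝓡 n) p x)).det := by
    -- Compactness of M reduces uniformity in x to a statement near each (0, r). There one fixed
    -- chart controls the determinant, and other charts change it by a positive square.
    refine isCompact_univ.eventually_forall_of_forall_eventually fun r _ => ?_
    have hr : (extChartAt (𝓡 n) r) r ∈ (extChartAt (𝓡 n) r).target := mem_extChartAt_target r
    have ho : IsOpen (Ioo (-ε) ε ×ˢ (extChartAt (𝓡 n) r).target) :=
      isOpen_Ioo.prod (isOpen_extChartAt_target (I := 𝓡 n) r)
    have hc : ContinuousAt (fun q : ℝ × Coord n => (inChart r (G q.1) q.2).det)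
        (0, extChartAt (𝓡 n) r r) :=
      (contDiffOn_det (hG r)).continuousOn.continuousAt
        (ho.mem_nhds ⟨⟨by linarith, hε⟩, hr⟩)
    have hφ : ContinuousAt (fun q : ℝ × M => (q.1, extChartAt (𝓡 n) r q.2)) (0, r) :=
      continuousAt_fst.prodMk
        ((continuousAt_extChartAt (I := 𝓡 n) r).comp' continuousAt_snd)
    have hlim : ∀ D : ℝ × Coord n → ℝ, ContinuousAt D (0, extChartAt (𝓡 n) r r) →
        Tendsto (fun q : ℝ × M => D (q.1, extChartAt (𝓡 n) r q.2)) (𝓝 (0, r))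
          (𝓝 (D (0, extChartAt (𝓡 n) r r))) := fun D hD => hD.tendsto.comp hφ
    have hpos' := (hlim _ hc).eventually_const_lt (hpos r _ hr)
    have hsrc : ∀ᶠ q : ℝ × M in 𝓝 (0, r), q.2 ∈ (extChartAt (𝓡 n) r).source :=
      continuousAt_snd.eventually (extChartAt_source_mem_nhds (I := 𝓡 n) r)
    filter_upwards [hpos', hsrc] with q hq1 hq2 p hp
    have hy : extChartAt (𝓡 n) p q.2 ∈ overlap n p r :=
      ⟨(extChartAt (𝓡 n) p).map_source hp, by
        rw [mem_preimage, (extChartAt (𝓡 n) p).left_inv hp]; exact hq2⟩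
    have htr : transition n p r (extChartAt (𝓡 n) p q.2) = extChartAt (𝓡 n) r q.2 := by
      rw [transition, (extChartAt (𝓡 n) p).left_inv hp]
    -- Invertibility of the Jacobian is read off at time 0, where the determinant in chart p is
    -- already known to be positive.
    have hJ : (jac (transition n p r) (extChartAt (𝓡 n) p q.2)).det ≠ 0 := fun h0 => by
      have h1 := hpos p _ hy.1
      rw [det_inChart hy, h0] at h1
      simp at h1
    rw [det_inChart hy, htr]
    exact mul_pos (by positivity) hq1
  filter_upwards [key] with t ht p y hy
  have h1 := ht _ (mem_univ _) p ((extChartAt (𝓡 n) p).map_target hy)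
  rwa [(extChartAt (𝓡 n) p).right_inv hy] at h1

/-- A smooth family of symmetric tensors and functions through a metric is a variation for small
times. -/
theorem exists_isVariation [CompactSpace M] {G : ℝ → TwoTensorField n M} {F : ℝ → M → ℝ}
    {v : TwoTensorField n M} {h : M → ℝ} {ε : ℝ} (hε : 0 < ε)
    (hG : ContMDiffOn (𝓘(ℝ, ℝ).prod (𝓡 n))
      ((𝓡 n).prod 𝓘(ℝ, Coord n →L[ℝ] Coord n →L[ℝ] ℝ)) ∞
      (fun q : ℝ × M => Bundle.TotalSpace.mk' (Coord n →L[ℝ] Coord n →L[ℝ] ℝ)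
        (E := fun x : M => TangentSpace (𝓡 n) x →L[ℝ] TangentSpace (𝓡 n) x →L[ℝ] ℝ)
        q.2 (G q.1 q.2))
      (Ioo (-ε) ε ×ˢ univ))
    (hF : ContMDiffOn (𝓘(ℝ, ℝ).prod (𝓡 n)) 𝓘(ℝ, ℝ) ∞ (fun q : ℝ × M => F q.1 q.2)
      (Ioo (-ε) ε ×ˢ univ))
    (hGsymm : ∀ t ∈ Ioo (-ε) ε, ∀ x X Y, G t x X Y = G t x Y X)
    (hpos : ∀ x X, X ≠ 0 → 0 < G 0 x X X)
    (hGv : ∀ x X Y, HasDerivAt (fun t => G t x X Y) (v x X Y) 0)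
    (hFh : ∀ x, HasDerivAt (fun t => F t x) (h x) 0) : ∃ δ, IsVariation G F v h δ := by
  have h0 : (0 : ℝ) ∈ Ioo (-ε) ε := ⟨by linarith, hε⟩
  obtain ⟨δ', hδ', hdet⟩ := Metric.eventually_nhds_iff.1
    (eventually_det_inChart_pos hε (contDiffOn_inChart hG) fun p y hy =>
      (posDef_inChart (hGsymm 0 h0) hpos p hy).det_pos)
  have hsub : Ioo (-min ε δ') (min ε δ') ⊆ Ioo (-ε) ε := fun t ht =>
    ⟨by linarith [ht.1, min_le_left ε δ'], ht.2.trans_le (min_le_left _ _)⟩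
  refine ⟨min ε δ', lt_min hε hδ', fun p i j => ?_, fun p => ?_, fun t ht => hGsymm t (hsub ht),
    fun t ht => hdet ?_, hGv, hFh⟩
  · exact (contDiffOn_inChart hG p i j).mono (prod_mono hsub subset_rfl)
  · exact (contDiffOn_funInChart hF p).mono (prod_mono hsub subset_rfl)
  · rw [Real.dist_eq, sub_zero, abs_lt]
    exact ⟨by linarith [ht.1, min_le_right ε δ'], ht.2.trans_le (min_le_right _ _)⟩

end Positivity

end Perelman

/-! ### Assembly on a closed manifold -/

theorem theorem1p1 {n : ℕ} {M : Type*} [TopologicalSpace M] [ChartedSpace (Coord n) M]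
    [IsManifold (𝓡 n) ∞ M] [CompactSpace M] [T2Space M] [MeasurableSpace M] [BorelSpace M]
    -- a smooth Riemannian metric and a smooth function
    (g : Bundle.ContMDiffRiemannianMetric (𝓡 n) ∞ (Coord n)
      (fun x : M => TangentSpace (𝓡 n) x))
    (f : M → ℝ) (hf : ContMDiff (𝓡 n) 𝓘(ℝ, ℝ) ∞ f)
    -- a smooth symmetric covariant 2-tensor and a smooth function: the direction of variation
    (v : TwoTensorField n M)
    (hv : ContMDiff (𝓡 n) ((𝓡 n).prod 𝓘(ℝ, Coord n →L[ℝ] Coord n →L[ℝ] ℝ)) ∞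
      (fun x : M => Bundle.TotalSpace.mk' (Coord n →L[ℝ] Coord n →L[ℝ] ℝ)
        (E := fun x : M => TangentSpace (𝓡 n) x →L[ℝ] TangentSpace (𝓡 n) x →L[ℝ] ℝ) x (v x)))
    (hvsymm : ∀ x X Y, v x X Y = v x Y X)
    (h : M → ℝ) (hh : ContMDiff (𝓡 n) 𝓘(ℝ, ℝ) ∞ h)
    -- a smooth family through `(g, f)` with velocity `(v, h)` at time `0`,
    -- for instance `(g + t v, f + t h)`
    (G : ℝ → TwoTensorField n M) (F : ℝ → M → ℝ) (ε : ℝ) (hε : 0 < ε)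
    (hG : ContMDiffOn (𝓘(ℝ, ℝ).prod (𝓡 n))
      ((𝓡 n).prod 𝓘(ℝ, Coord n →L[ℝ] Coord n →L[ℝ] ℝ)) ∞
      (fun q : ℝ × M => Bundle.TotalSpace.mk' (Coord n →L[ℝ] Coord n →L[ℝ] ℝ)
        (E := fun x : M => TangentSpace (𝓡 n) x →L[ℝ] TangentSpace (𝓡 n) x →L[ℝ] ℝ)
        q.2 (G q.1 q.2))
      (Ioo (-ε) ε ×ˢ univ))
    (hF : ContMDiffOn (𝓘(ℝ, ℝ).prod (𝓡 n)) 𝓘(ℝ, ℝ) ∞ (fun q : ℝ × M => F q.1 q.2)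
      (Ioo (-ε) ε ×ˢ univ))
    (hGsymm : ∀ t ∈ Ioo (-ε) ε, ∀ x X Y, G t x X Y = G t x Y X)
    (hG0 : ∀ x, G 0 x = g.inner x) (hF0 : ∀ x, F 0 x = f x)
    (hGv : ∀ x X Y, HasDerivAt (fun t => G t x X Y) (v x X Y) 0)
    (hFh : ∀ x, HasDerivAt (fun t => F t x) (h x) 0) :
    -- the variation of the scalar curvature
    (∀ x, HasDerivAt (fun t => scalarCurvature (G t) x)
      (-laplacian g.inner (trace g.inner v) x + divDiv g.inner v x
        - pairWith (comps g.inner x) (ricci g.inner x) (comps v x)) 0) ∧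
    -- the integrals are those of integrable functions
    (∀ᶠ t in 𝓝 (0 : ℝ), Integrable (energyDensity (G t) (F t)) (volumeMeasure (G t))) ∧
    Integrable (variationDensity g.inner f v h) (volumeMeasure g.inner) ∧
    -- the first variation of the functional
    HasDerivAt (fun t => functionalF (G t) (F t))
      (∫ x, variationDensity g.inner f v h x ∂(volumeMeasure g.inner)) 0 := by
  obtain ⟨δ, hV⟩ := exists_isVariation hε hG hF hGsymm
    (fun x X hX => by rw [hG0]; exact g.pos x X hX) hGv hFh
  have hg : g.inner = G 0 := funext fun x => (hG0 x).symm
  have hf0 : f = F 0 := funext fun x => (hF0 x).symm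
  rw [hg, hf0]
  refine ⟨hV.hasDerivAt_scalarCurvature, ?_,
    hV.integrable_of_continuous hV.zero_mem hV.continuous_variationDensity,
    hV.hasDerivAt_functionalF⟩
  filter_upwards [isOpen_Ioo.mem_nhds hV.zero_mem] with t ht
  exact hV.integrable_of_continuous ht (hV.continuous_energyDensity ht)
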